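/- Let $n\ge 1$ and $\lambda>0$. Cubes $Q\subset\mathbb R^n$ have sides parallel to the axes and positive side length. Let $\Phi_\lambda(t)=t\,(\log(e+t))^{\lambda}$ for $t\ge 0$ and, for measurable $f:\mathbb R^n\to\mathbb R$, $$M_{\Phi_\lambda}f(x)=\sup_{Q\ni x}\|f\|_{\Phi_\lambda,Q},\qquad \|f\|_{\Phi_\lambda,Q}=\inf\Big\{t>0:\frac1{|Q|}\int_Q\Phi_\lambda\Big(\frac{|f|}{t}\Big)\,dx\le 1\Big\}\in[0,\infty].$$ For $1<p<\infty$, $p'=p/(p-1)$, let $A_p$ be the class of non-negative locally integrable functions $w$ on $\mathbb R^n$, not almost everywhere zero, with $$[w]_{A_p}=\sup_Q\Big(\frac1{|Q|}\int_Q w\Big)\Big(\frac1{|Q|}\int_Q w^{1-p'}\Big)^{p-1}<\infty,$$ put $\sigma=w^{1-p'}$, and let $[\sigma]_{A_\infty}=\sup_Q\frac1{\sigma(Q)}\int_Q M(\chi_Q\sigma)\,dx$, where $\sigma(Q)=\int_Q\sigma$ and $Mg(x)=\sup_{Q\ni x}\frac1{|Q|}\int_Q|g|$ is the Hardy–Littlewood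 maximal function. Let $\|M_{\Phi_\lambda}\|_{L^p(w)}$ be the least $C\in[0,\infty]$ with $\|M_{\Phi_\lambda}f\|_{L^p(w)}\le C\|f\|_{L^p(w)}$ for all $f\in L^p(w)$. (1) For every $1<p<\infty$ there is a constant $c=c(n,p,\lambda)$ such that, for every $w\in A_p$, $$\|M_{\Phi_\lambda}\|_{L^p(w)}\le c\,[w]_{A_p}^{\frac1p}[\sigma]_{A_\infty}^{\frac1p+\lambda}\qquad\text{and}\qquad [w]_{A_p}^{\frac1p}[\sigma]_{A_\infty}^{\frac1p+\lambda}\le c\,[w]_{A_p}^{\frac{1+\lambda}{p-1}}.$$ (2) The exponents are sharp, for every fixed $1<p<\infty$, in the following sense, where $c$ denotes a finite constant independent of $w$. (a) If $\beta\in\mathbb R$ and $\|M_{\Phi_\lambda}\|_{L^p(w)}\le c\,[w]_{A_p}^{\beta}$ for all $w\in A_p$, then $\beta\ge\frac{1+\lambda}{p-1}$. (b) If $\beta\in\mathbb R$ and $\|M_{\Phi_\lambda}\|_{L^p(w)}\le c\,[w]_{A_p}^{\beta}[\sigma]_{A_\infty}^{1/p+\lambda}$ for all $w\in A_p$, then $\beta\ge\frac1p$;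 if $\|M_{\Phi_\lambda}\|_{L^p(w)}\le c\,[w]_{A_p}^{1/p}[\sigma]_{A_\infty}^{\beta}$ for all $w\in A_p$, then $\beta\ge\frac1p+\lambda$. (c) More generally, if $\beta_1\in\mathbb R$, $\beta_2\ge0$ and $\|M_{\Phi_\lambda}\|_{L^p(w)}\le c\,[w]_{A_p}^{\beta_1}[\sigma]_{A_\infty}^{\beta_2}$ for all $w\in A_p$, then $\beta_1+\frac{\beta_2}{p-1}\ge\frac{1+\lambda}{p-1}$. (3) For the unweighted norms, there are constants $c_1,c_2>0$, depending only on $n$ and $\lambda$, such that for all $1<p\le2$ $$c_1(p-1)^{-1-\lambda}\le\|M_{\Phi_\lambda}\|_{L^p(\mathbb R^n)}\le c_2(p-1)^{-1-\lambda}.$$ -/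

import Mathlib

open MeasureTheory
open scoped ENNReal NNReal

noncomputable section

namespace OrliczMax

/-- The closed cube in `ℝⁿ`, with sides parallel to the axes, with lower corner `a` and
side length `r`. (Cubes are always used with `0 < r`.) -/
def cube {n : ℕ} (a : Fin n → ℝ) (r : ℝ) : Set (Fin n → ℝ) :=
  Set.Icc a (fun i => a i + r)

/-- The Hardy--Littlewood maximal function of a function with values in `[0, ∞]`:
the supremum of the averages over all cubes that contain the point. -/
def maximalFunction {n : ℕ} (g : (Fin n → ℝ) → ℝ≥0∞) (x : Fin n → ℝ) : ℝ≥0∞ :=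
  ⨆ (a : Fin n → ℝ) (r : ℝ) (_ : 0 < r) (_ : x ∈ cube a r), ⨍⁻ y in cube a r, g y ∂volume

/-- The Muckenhoupt constant `[w]_{A_p}`. The powers are taken in `[0, ∞]`, so that
`w ^ (1 - p')` is `∞` where `w` vanishes. -/
def apConst {n : ℕ} (p : ℝ) (w : (Fin n → ℝ) → ℝ) : ℝ≥0∞ :=
  ⨆ (a : Fin n → ℝ) (r : ℝ) (_ : 0 < r),
    (⨍⁻ y in cube a r, ENNReal.ofReal (w y) ∂volume) *
      (⨍⁻ y in cube a r, ENNReal.ofReal (w y) ^ (1 - p.conjExponent) ∂volume) ^ (p - 1)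

/-- `w` is a weight (non-negative, locally integrable, not almost everywhere zero) in the
Muckenhoupt class `A_p`. -/
structure IsApWeight {n : ℕ} (p : ℝ) (w : (Fin n → ℝ) → ℝ) : Prop where
  nonneg : ∀ x, 0 ≤ w x
  locallyIntegrable : LocallyIntegrable w volume
  not_ae_zero : ¬ (∀ᵐ x, w x = 0)
  apConst_lt_top : apConst p w < ∞

/-- The dual weight `σ = w ^ (1 - p')`. -/
def dualWeight {n : ℕ} (p : ℝ) (w : (Fin n → ℝ) → ℝ) (x : Fin n → ℝ) : ℝ≥0∞ :=
  ENNReal.ofReal (w x) ^ (1 - p.conjExponent)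

/-- The Fujii--Wilson constant `[s]_{A_∞} = sup_Q s(Q)⁻¹ ∫_Q M(χ_Q s)`. -/
def aInftyConst {n : ℕ} (s : (Fin n → ℝ) → ℝ≥0∞) : ℝ≥0∞ :=
  ⨆ (a : Fin n → ℝ) (r : ℝ) (_ : 0 < r),
    (∫⁻ x in cube a r, s x)⁻¹ *
      ∫⁻ x in cube a r, maximalFunction ((cube a r).indicator s) x

/-- The function `Φ_λ(t) = t log(e + t)^λ`. -/
def youngLog (lam t : ℝ) : ℝ := t * Real.log (Real.exp 1 + t) ^ lam

/-- The Luxemburg norm of `f` localized to a set `Q` (normalized by the measure of `Q`);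
it is `∞` if no `t` is admissible. -/
def luxemburgNorm {n : ℕ} (Φ : ℝ → ℝ) (Q : Set (Fin n → ℝ)) (f : (Fin n → ℝ) → ℝ) : ℝ≥0∞ :=
  ⨅ (t : ℝ) (_ : 0 < t) (_ : ⨍⁻ y in Q, ENNReal.ofReal (Φ (|f y| / t)) ∂volume ≤ 1),
    ENNReal.ofReal t

/-- The Orlicz maximal operator `M_Φ`. -/
def orliczMaximal {n : ℕ} (Φ : ℝ → ℝ) (f : (Fin n → ℝ) → ℝ) (x : Fin n → ℝ) : ℝ≥0∞ :=
  ⨆ (a : Fin n → ℝ) (r : ℝ) (_ : 0 < r) (_ : x ∈ cube a r), luxemburgNorm Φ (cube a r) f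

/-- The `L^p(w)` norm of a function with values in `[0, ∞]`. -/
def lpNorm {n : ℕ} (p : ℝ) (w : (Fin n → ℝ) → ℝ) (g : (Fin n → ℝ) → ℝ≥0∞) : ℝ≥0∞ :=
  (∫⁻ x, g x ^ p * ENNReal.ofReal (w x)) ^ (1 / p)

/-- The norm `‖T‖_{L^p(w)}` of an operator `T`: the least `C ∈ [0, ∞]` such that
`‖T f‖_{L^p(w)} ≤ C ‖f‖_{L^p(w)}` for all `f ∈ L^p(w)`. -/
def opNorm {n : ℕ} (p : ℝ) (w : (Fin n → ℝ) → ℝ)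
    (T : ((Fin n → ℝ) → ℝ) → (Fin n → ℝ) → ℝ≥0∞) : ℝ≥0∞ :=
  sInf {C : ℝ≥0∞ | ∀ f : (Fin n → ℝ) → ℝ, AEMeasurable f volume →
    lpNorm p w (fun x => ‖f x‖ₑ) < ∞ →
    lpNorm p w (T f) ≤ C * lpNorm p w (fun x => ‖f x‖ₑ)}

end OrliczMax

end

/-!
The whole argument is carried out on balls of the supremum norm, which are the cubes, and rests on
Vitali's covering theorem in one form: if `μ` of the five-fold enlargement of each ball of a family
is at most `K` times `ν` of the ball, then the same holds for the unions
(`measure_biUnion_ball_le`). Enlarged balls occur only on the side of the weight, so no power of the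
doubling constant of a weight is lost.

*Upper bound.* Since `log (e + t) ^ λ ≤ C ε ^ (-λ) (e + t) ^ ε`, the maximal function `M_Φ f` is at
most a multiple of `ε ^ (-λ) (M |f| ^ (1 + ε)) ^ (1 / (1 + ε))` (`orliczMaximal_le`). The maximal
operator `M` is of weak type `(r, r)` with a constant linear in `[w]_{A_r}`
(`withDensity_lt_supBall_le`), hence bounded on `L^q(w)` for `q > r`, with a factor `1 / (q - r)`
(`lintegral_supBall_rpow_le`). By the sharp reverse Hölder inequality
(`lintegral_rpow_one_add_le`), a weight in `A_p` is in `A_r` with `p - r` comparable to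
`1 / [σ]_{A_∞}`, and its `A_r` constant is at most a multiple of the `A_p` constant
(`hasApBound_of_reverseHolder`). With `ε`, `p - q` and `q - r` all comparable to
`1 / [σ]_{A_∞}` this is the mixed bound. For `w = 1` no reverse Hölder inequality is needed, and
`ε`, `p - q` and `q - r` are taken comparable to `p - 1` (`opNorm_one_le`).

*Reverse Hölder inequality.* The usual proof uses maximal dyadic cubes. Here every point of the
level set `{m > t}` of the maximal function `m` relative to a cube is given a ball of nearly maximal
radius with average above `t`; on its enlargement, `m` exceeds the maximal function relative to a
comparable cube by at most a multiple of `t` (`IsStopped.supBall_le`), to which the `A_∞` condition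
applies. The resulting estimates of the integrals of `m` and of the weight over `{m > t}` are
integrated in `t`.

*Comparison of the constants.* If `P` is a cube inside `Q` and `P*` its enlargement, the `A_p`
condition on `P*` bounds the average of `σ` over `P` by a power of `[w]_{A_p} |P| / w(P*)`, and
`|P| / w(P*)` is at most a maximal function, with respect to `w`, of `χ_Q / w`. The latter maximal
operator is of weak type `(1, 1)` for every measure, and Hölder's inequality gives
`[σ]_{A_∞} ≤ c [w]_{A_p} ^ (1 / (p - 1))` (`aInftyConst_dual_le`).

*Lower bounds.* For `f = |x| ^ (δ - n)` on the unit cube, `M_Φ f ≥ c δ ^ (-1 - λ) f`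
(`le_orliczMaximal_extremal`). With the weight `|x| ^ ((n - δ) (p - 1))`, whose `A_p` constant is at
most a multiple of `δ ^ (1 - p)`, letting `δ` tend to `0` gives the sharpness of the exponents
(`mixed_exponents_ge`); with `w = 1` and `δ` comparable to `p - 1` it gives the lower bound for the
unweighted norm (`le_opNorm_one`).
-/

namespace OrliczMax

open Metric Set

variable {n : ℕ}

/-! ### Cubes as balls of the supremum norm -/

theorem cube_eq_closedBall (a : Fin n → ℝ) {r : ℝ} (hr : 0 ≤ r) :
    cube a r = closedBall (fun i => a i + r / 2) (r / 2) := by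
  ext x
  rw [cube, closedBall_pi _ (by positivity), ← pi_univ_Icc]
  simp only [mem_univ_pi, mem_Icc, Real.closedBall_eq_Icc]
  refine forall_congr' fun i => ?_
  constructor <;> rintro ⟨h1, h2⟩ <;> constructor <;> linarith

theorem closedBall_eq_cube (c : Fin n → ℝ) {r : ℝ} (hr : 0 ≤ r) :
    closedBall c r = cube (fun i => c i - r) (2 * r) := by
  rw [cube_eq_closedBall _ (by positivity)]
  congr 1
  · ext i; ring
  · ring

theorem volume_ball_eq (c : Fin n → ℝ) {r : ℝ} (hr : 0 < r) :
    volume (ball c r) = ENNReal.ofReal ((2 * r) ^ n) := by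
  rw [Real.volume_pi_ball c hr, Fintype.card_fin]

theorem volume_closedBall_eq (c : Fin n → ℝ) {r : ℝ} (hr : 0 < r) :
    volume (closedBall c r) = ENNReal.ofReal ((2 * r) ^ n) := by
  rw [Real.volume_pi_closedBall c hr.le, Fintype.card_fin]

theorem volume_closedBall_nat_mul (c c' : Fin n → ℝ) {k : ℕ} (hk : 0 < k) {r : ℝ} (hr : 0 < r) :
    volume (closedBall c (k * r)) = (k : ℝ≥0∞) ^ n * volume (ball c' r) := by
  have hk' : (0 : ℝ) < k := by exact_mod_cast hk
  rw [volume_closedBall_eq c (by positivity), volume_ball_eq c' hr,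
    ← ENNReal.ofReal_natCast, ← ENNReal.ofReal_pow (by positivity),
    ← ENNReal.ofReal_mul (by positivity), ← mul_pow]
  congr 2; ring

theorem volume_ball_ne_zero (c : Fin n → ℝ) {r : ℝ} (hr : 0 < r) : volume (ball c r) ≠ 0 :=
  (measure_ball_pos volume c hr).ne'

theorem volume_closedBall_ne_zero (c : Fin n → ℝ) {r : ℝ} (hr : 0 < r) :
    volume (closedBall c r) ≠ 0 :=
  (measure_closedBall_pos volume c hr).ne'

theorem volume_ball_ne_top (c : Fin n → ℝ) (r : ℝ) : volume (ball c r) ≠ ∞ :=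
  measure_ball_lt_top.ne

theorem volume_closedBall_ne_top (c : Fin n → ℝ) (r : ℝ) : volume (closedBall c r) ≠ ∞ :=
  measure_closedBall_lt_top.ne

theorem ball_ae_eq_closedBall (c : Fin n → ℝ) {r : ℝ} (hr : 0 < r) :
    (ball c r : Set (Fin n → ℝ)) =ᵐ[volume] closedBall c r :=
  ae_eq_of_subset_of_measure_ge ball_subset_closedBall
    (by rw [volume_ball_eq c hr, volume_closedBall_eq c hr]) measurableSet_ball.nullMeasurableSet
    (volume_closedBall_ne_top c r)

theorem setLIntegral_closedBall_eq (c : Fin n → ℝ) {r : ℝ} (hr : 0 < r)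
    (g : (Fin n → ℝ) → ℝ≥0∞) :
    ∫⁻ y in closedBall c r, g y = ∫⁻ y in ball c r, g y :=
  setLIntegral_congr (ball_ae_eq_closedBall c hr).symm

/-! ### Suprema over balls and the covering lemma -/

/-- The maximal function attached to a functional `N` of balls: the supremum of `N c ρ` over all
open balls `ball c ρ` that contain the point. Open balls make it lower semicontinuous. -/
noncomputable def supBall (N : (Fin n → ℝ) → ℝ → ℝ≥0∞) (x : Fin n → ℝ) : ℝ≥0∞ :=
  ⨆ (c : Fin n → ℝ) (ρ : ℝ) (_ : 0 < ρ) (_ : x ∈ ball c ρ), N c ρ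

theorem lt_supBall_iff {N : (Fin n → ℝ) → ℝ → ℝ≥0∞} {x : Fin n → ℝ} {t : ℝ≥0∞} :
    t < supBall N x ↔ ∃ c ρ, 0 < ρ ∧ x ∈ ball c ρ ∧ t < N c ρ := by
  simp only [supBall, lt_iSup_iff, exists_prop]

theorem le_supBall (N : (Fin n → ℝ) → ℝ → ℝ≥0∞) {x c : Fin n → ℝ} {ρ : ℝ} (hρ : 0 < ρ)
    (hx : x ∈ ball c ρ) : N c ρ ≤ supBall N x :=
  le_iSup₂_of_le c ρ (le_iSup₂_of_le hρ hx le_rfl)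

theorem supBall_le_iff {N : (Fin n → ℝ) → ℝ → ℝ≥0∞} {x : Fin n → ℝ} {t : ℝ≥0∞} :
    supBall N x ≤ t ↔ ∀ c ρ, 0 < ρ → x ∈ ball c ρ → N c ρ ≤ t := by
  simp [supBall, iSup_le_iff]

theorem setOf_lt_supBall (N : (Fin n → ℝ) → ℝ → ℝ≥0∞) (t : ℝ≥0∞) :
    {x | t < supBall N x} =
      ⋃ i ∈ {i : (Fin n → ℝ) × ℝ | 0 < i.2 ∧ t < N i.1 i.2}, ball i.1 i.2 := by
  ext x
  simp only [mem_ofPred_eq, lt_supBall_iff, mem_iUnion, Prod.exists, exists_prop]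
  constructor
  · rintro ⟨c, ρ, h0, hx, ht⟩; exact ⟨c, ρ, ⟨h0, ht⟩, hx⟩
  · rintro ⟨c, ρ, ⟨h0, ht⟩, hx⟩; exact ⟨c, ρ, h0, hx, ht⟩

theorem isOpen_setOf_lt_supBall (N : (Fin n → ℝ) → ℝ → ℝ≥0∞) (t : ℝ≥0∞) :
    IsOpen {x | t < supBall N x} := by
  rw [setOf_lt_supBall]
  exact isOpen_biUnion fun i _ => isOpen_ball

theorem measurable_supBall (N : (Fin n → ℝ) → ℝ → ℝ≥0∞) : Measurable (supBall N) :=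
  measurable_of_Ioi fun t => (isOpen_setOf_lt_supBall N t).measurableSet

/-- Vitali's covering theorem for the union of a family of balls of bounded radii: an estimate of
`μ` of the five-fold enlarged ball by `ν` of the ball passes to the union. -/
theorem measure_biUnion_ball_le_of_bounded {ι : Type*} (μ ν : Measure (Fin n → ℝ)) (K : ℝ≥0∞)
    (T : Set ι) (c : ι → Fin n → ℝ) (ρ : ι → ℝ) (R : ℝ) (hρ : ∀ i ∈ T, 0 < ρ i)
    (hR : ∀ i ∈ T, ρ i ≤ R)
    (h : ∀ i ∈ T, μ (closedBall (c i) (5 * ρ i)) ≤ K * ν (ball (c i) (ρ i))) :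
    μ (⋃ i ∈ T, ball (c i) (ρ i)) ≤ K * ν (⋃ i ∈ T, ball (c i) (ρ i)) := by
  obtain ⟨u, huT, hdisj, hcov⟩ :=
    Vitali.exists_disjoint_subfamily_covering_enlargement_closedBall T c ρ R hR 5 (by norm_num)
  have hu : u.Countable := hdisj.countable_of_nonempty_interior fun i hi =>
    ⟨c i, ball_subset_interior_closedBall (mem_ball_self (hρ i (huT hi)))⟩
  calc μ (⋃ i ∈ T, ball (c i) (ρ i))
      ≤ μ (⋃ i ∈ u, closedBall (c i) (5 * ρ i)) := by
        refine measure_mono (iUnion₂_subset fun i hi => ?_)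
        obtain ⟨j, hj, hij⟩ := hcov i hi
        exact (ball_subset_closedBall.trans hij).trans (subset_biUnion_of_mem (u := fun j =>
          closedBall (c j) (5 * ρ j)) hj)
    _ ≤ ∑' i : u, μ (closedBall (c i) (5 * ρ i)) := measure_biUnion_le _ hu _
    _ ≤ ∑' i : u, K * ν (ball (c i) (ρ i)) := ENNReal.tsum_le_tsum fun i => h i (huT i.2)
    _ = K * ν (⋃ i ∈ u, ball (c i) (ρ i)) := by
        rw [ENNReal.tsum_mul_left, measure_biUnion hu
          (hdisj.mono_on fun i _ => ball_subset_closedBall) fun i _ => measurableSet_ball]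
    _ ≤ _ := by
        gcongr _ * ν ?_
        exact biUnion_subset_biUnion_left huT

theorem measure_biUnion_ball_le {ι : Type*} (μ ν : Measure (Fin n → ℝ)) (K : ℝ≥0∞)
    (T : Set ι) (c : ι → Fin n → ℝ) (ρ : ι → ℝ) (hρ : ∀ i ∈ T, 0 < ρ i)
    (h : ∀ i ∈ T, μ (closedBall (c i) (5 * ρ i)) ≤ K * ν (ball (c i) (ρ i))) :
    μ (⋃ i ∈ T, ball (c i) (ρ i)) ≤ K * ν (⋃ i ∈ T, ball (c i) (ρ i)) := by
  have key : (⋃ i ∈ T, ball (c i) (ρ i)) =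
      ⋃ k : ℕ, ⋃ i ∈ {i ∈ T | ρ i ≤ k}, ball (c i) (ρ i) := by
    ext x
    simp only [mem_iUnion, mem_ofPred_eq, exists_prop]
    constructor
    · rintro ⟨i, hi, hx⟩
      obtain ⟨k, hk⟩ := exists_nat_ge (ρ i)
      exact ⟨k, i, ⟨hi, hk⟩, hx⟩
    · rintro ⟨k, i, ⟨hi, -⟩, hx⟩
      exact ⟨i, hi, hx⟩
  have hmono : Monotone fun k : ℕ => ⋃ i ∈ {i ∈ T | ρ i ≤ k}, ball (c i) (ρ i) := by
    intro k l hkl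
    refine biUnion_subset_biUnion_left fun i hi => ⟨hi.1, hi.2.trans ?_⟩
    exact_mod_cast hkl
  conv_lhs => rw [key]
  rw [hmono.measure_iUnion]
  refine iSup_le fun k => ?_
  refine (measure_biUnion_ball_le_of_bounded μ ν K _ c ρ k (fun i hi => hρ i hi.1)
    (fun i hi => hi.2) fun i hi => h i hi.1).trans ?_
  gcongr _ * ν ?_
  rw [key]
  exact subset_iUnion (fun k : ℕ => ⋃ i ∈ {i ∈ T | ρ i ≤ k}, ball (c i) (ρ i)) k

theorem measure_lt_supBall_le (μ ν : Measure (Fin n → ℝ)) (K : ℝ≥0∞)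
    (N : (Fin n → ℝ) → ℝ → ℝ≥0∞) (t : ℝ≥0∞)
    (h : ∀ c ρ, 0 < ρ → t < N c ρ → μ (closedBall c (5 * ρ)) ≤ K * ν (ball c ρ)) :
    μ {x | t < supBall N x} ≤ K * ν {x | t < supBall N x} := by
  rw [setOf_lt_supBall]
  exact measure_biUnion_ball_le μ ν K {i : (Fin n → ℝ) × ℝ | 0 < i.2 ∧ t < N i.1 i.2} Prod.fst
    Prod.snd (fun i hi => And.left hi) fun i hi => h i.1 i.2 (And.left hi) (And.right hi)

/-! ### Layer cake formula and Marcinkiewicz interpolation with `L^∞` -/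

theorem rpow_eq_lintegral_Ioi (u : ℝ≥0∞) {a : ℝ} (ha : 0 < a) :
    u ^ a = ∫⁻ t in Ioi (0 : ℝ),
      (if ENNReal.ofReal t < u then ENNReal.ofReal (a * t ^ (a - 1)) else 0) := by
  have fin : ∀ r : ℝ, 0 ≤ r → ENNReal.ofReal (r ^ a) = ∫⁻ t in Ioi (0 : ℝ),
      (if t < r then ENNReal.ofReal (a * t ^ (a - 1)) else 0) := by
    intro r hr
    have := lintegral_rpow_eq_lintegral_meas_lt_mul (Measure.dirac ()) (f := fun _ => r)
      (Filter.Eventually.of_forall fun _ => hr) aemeasurable_const ha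
    rw [lintegral_dirac, ← lintegral_const_mul' _ _ ENNReal.ofReal_ne_top] at this
    rw [this]
    refine lintegral_congr fun t => ?_
    split_ifs with h <;> simp [h, ENNReal.ofReal_mul ha.le]
  by_cases hu : u = ∞
  · subst hu
    rw [ENNReal.top_rpow_of_pos ha]
    refine (ENNReal.eq_top_of_forall_nnreal_le fun r => ?_).symm
    have h1 := fin ((r : ℝ) ^ a⁻¹) (by positivity)
    rw [← Real.rpow_mul r.coe_nonneg, inv_mul_cancel₀ ha.ne', Real.rpow_one, ENNReal.ofReal_coe_nnreal] at h1
    rw [h1]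
    refine lintegral_mono fun t => ?_
    simp only [ENNReal.ofReal_lt_top, if_true]
    split_ifs <;> simp
  · have h1 := fin u.toReal ENNReal.toReal_nonneg
    rw [← ENNReal.ofReal_rpow_of_nonneg ENNReal.toReal_nonneg ha.le, ENNReal.ofReal_toReal hu] at h1
    rw [h1]
    refine setLIntegral_congr_fun measurableSet_Ioi fun t ht => ?_
    simp only [ENNReal.ofReal_lt_iff_lt_toReal (le_of_lt ht) hu]

theorem measurableSet_ofReal_lt {α : Type*} [MeasurableSpace α] {u : α → ℝ≥0∞}
    (hu : Measurable u) : MeasurableSet {z : α × ℝ | ENNReal.ofReal z.2 < u z.1} :=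
  measurableSet_lt (ENNReal.measurable_ofReal.comp measurable_snd) (hu.comp measurable_fst)

theorem lintegral_rpow_eq_lintegral_measure_lt {α : Type*} [MeasurableSpace α] (μ : Measure α)
    [SFinite μ] {u : α → ℝ≥0∞} (hu : Measurable u) {a : ℝ} (ha : 0 < a) :
    ∫⁻ x, u x ^ a ∂μ = ∫⁻ t in Ioi (0 : ℝ),
      ENNReal.ofReal (a * t ^ (a - 1)) * μ {x | ENNReal.ofReal t < u x} := by
  simp_rw [rpow_eq_lintegral_Ioi _ ha]
  rw [lintegral_lintegral_swap]
  · refine lintegral_congr fun t => ?_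
    have hm : MeasurableSet {x | ENNReal.ofReal t < u x} := measurableSet_lt measurable_const hu
    rw [← lintegral_indicator_const hm]
    refine lintegral_congr fun x => ?_
    simp [indicator_apply]
  · refine (Measurable.ite (measurableSet_ofReal_lt hu) ?_ measurable_const).aemeasurable
    fun_prop

/-- Marcinkiewicz interpolation between a weak type `(r, r)` estimate and the trivial `L^∞`
estimate. The hypothesis is the form in which the two are used: only the part of `g` above height
`s` contributes to the level set of `G` at height `2 s`. -/
theorem lintegral_rpow_le_of_weak_type {α : Type*} [MeasurableSpace α] (μ : Measure α)
    [SFinite μ] {g G : α → ℝ≥0∞} (hg : Measurable g) (hG : Measurable G) {r p : ℝ} (hr : 0 < r)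
    (hrp : r < p) (K : ℝ≥0∞)
    (h : ∀ s : ℝ, 0 < s → μ {x | ENNReal.ofReal (2 * s) < G x} ≤
      K * ENNReal.ofReal (s ^ (-r)) * ∫⁻ x in {x | ENNReal.ofReal s < g x}, g x ^ r ∂μ) :
    ∫⁻ x, G x ^ p ∂μ ≤ ENNReal.ofReal (2 ^ p * p / (p - r)) * K * ∫⁻ x, g x ^ p ∂μ := by
  have hp : 0 < p := hr.trans hrp
  have hpr : 0 < p - r := sub_pos.2 hrp
  rw [lintegral_rpow_eq_lintegral_measure_lt μ hG hp]
  have hset : ∀ t : ℝ, 0 < t → ∀ x, (ENNReal.ofReal (t / 2) < g x ↔ ENNReal.ofReal t < 2 * g x) := by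
    intro t ht x
    rw [show ENNReal.ofReal t = 2 * ENNReal.ofReal (t / 2) by
      rw [← ENNReal.ofReal_ofNat 2, ← ENNReal.ofReal_mul (by norm_num)]; congr 1; ring]
    exact (ENNReal.mul_lt_mul_iff_right (by norm_num) (by norm_num)).symm
  calc ∫⁻ t in Ioi (0 : ℝ), ENNReal.ofReal (p * t ^ (p - 1)) * μ {x | ENNReal.ofReal t < G x}
      ≤ ∫⁻ t in Ioi (0 : ℝ), ∫⁻ x, K * ENNReal.ofReal (2 ^ r * p / (p - r)) * (g x ^ r *
          (if ENNReal.ofReal t < 2 * g x then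
            ENNReal.ofReal ((p - r) * t ^ (p - r - 1)) else 0)) ∂μ := by
        refine setLIntegral_mono' measurableSet_Ioi fun t ht => ?_
        have ht : 0 < t := ht
        have h1 := h (t / 2) (by positivity)
        rw [mul_div_cancel₀ t two_ne_zero] at h1
        refine (mul_le_mul_right h1 _).trans (le_of_eq ?_)
        rw [← lintegral_indicator (measurableSet_lt measurable_const hg),
          ← lintegral_const_mul _ (((hg.pow_const r).indicator
            (measurableSet_lt measurable_const hg))),
          ← lintegral_const_mul _ (by
            refine Measurable.const_mul ((hg.pow_const r).indicator
              (measurableSet_lt measurable_const hg)) _)]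
        refine lintegral_congr fun x => ?_
        simp only [indicator_apply, mem_ofPred_eq, hset t ht x]
        split_ifs with hx
        · have e : ENNReal.ofReal (p * t ^ (p - 1)) * ENNReal.ofReal ((t / 2) ^ (-r)) =
              ENNReal.ofReal (2 ^ r * p / (p - r)) * ENNReal.ofReal ((p - r) * t ^ (p - r - 1)) := by
            rw [← ENNReal.ofReal_mul (by positivity), ← ENNReal.ofReal_mul (by positivity)]
            congr 1
            rw [Real.div_rpow ht.le (by norm_num), Real.rpow_neg (by norm_num : (0 : ℝ) ≤ 2),
              show p - r - 1 = (p - 1) + (-r) by ring, Real.rpow_add ht]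
            field_simp
          calc _ = K * (ENNReal.ofReal (p * t ^ (p - 1)) * ENNReal.ofReal ((t / 2) ^ (-r)))
                * g x ^ r := by ring
            _ = _ := by rw [e]; ring
        · simp
    _ = ∫⁻ x, ∫⁻ t in Ioi (0 : ℝ), K * ENNReal.ofReal (2 ^ r * p / (p - r)) * (g x ^ r *
          (if ENNReal.ofReal t < 2 * g x then
            ENNReal.ofReal ((p - r) * t ^ (p - r - 1)) else 0)) ∂volume ∂μ := by
        rw [← lintegral_lintegral_swap]
        refine Measurable.aemeasurable ?_
        refine Measurable.const_mul (Measurable.mul (by fun_prop) ?_) _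
        refine Measurable.ite (measurableSet_ofReal_lt (hg.const_mul 2)) ?_ measurable_const
        fun_prop
    _ = ∫⁻ x, ENNReal.ofReal (2 ^ p * p / (p - r)) * K * g x ^ p ∂μ := by
        refine lintegral_congr fun x => ?_
        have hm : Measurable fun t : ℝ => (if ENNReal.ofReal t < 2 * g x then
            ENNReal.ofReal ((p - r) * t ^ (p - r - 1)) else 0) := by
          refine Measurable.ite (measurableSet_lt ENNReal.measurable_ofReal measurable_const) ?_
            measurable_const
          fun_prop
        rw [lintegral_const_mul _ (hm.const_mul _), lintegral_const_mul _ hm,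
          ← rpow_eq_lintegral_Ioi _ hpr, ENNReal.mul_rpow_of_nonneg _ _ hpr.le]
        have e2 : ENNReal.ofReal (2 ^ p * p / (p - r)) =
            ENNReal.ofReal (2 ^ r * p / (p - r)) * 2 ^ (p - r) := by
          rw [← ENNReal.ofReal_ofNat 2, ENNReal.ofReal_rpow_of_pos (by norm_num),
            ← ENNReal.ofReal_mul (by positivity), Real.rpow_sub (by norm_num)]
          congr 1
          field_simp
        have e3 : g x ^ p = g x ^ r * g x ^ (p - r) := by
          rw [← ENNReal.rpow_add_of_nonneg _ _ hr.le hpr.le]; congr 1; ring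
        rw [e2, e3]; ring
    _ = _ := lintegral_const_mul _ (hg.pow_const p)

/-! ### Weak and strong type estimates for the maximal function -/

/-- The Muckenhoupt `A_r` condition with constant `A`, on balls and in a form without averages. -/
def HasApBound (r : ℝ) (W : (Fin n → ℝ) → ℝ≥0∞) (A : ℝ≥0∞) : Prop :=
  ∀ (c : Fin n → ℝ) (ρ : ℝ), 0 < ρ →
    (∫⁻ y in closedBall c ρ, W y) * (∫⁻ y in closedBall c ρ, W y ^ (-1 / (r - 1))) ^ (r - 1) ≤
      A * volume (closedBall c ρ) ^ r

theorem lintegral_rpow_le_mul_dual {α : Type*} [MeasurableSpace α] (μ : Measure α)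
    {g W : α → ℝ≥0∞} (hg : Measurable g) (hW : Measurable W) (h0 : ∀ᵐ x ∂μ, W x ≠ 0)
    (ht : ∀ x, W x ≠ ∞) {r : ℝ} (hr : 1 < r) :
    (∫⁻ x, g x ∂μ) ^ r ≤
      (∫⁻ x, g x ^ r * W x ∂μ) * (∫⁻ x, W x ^ (-1 / (r - 1)) ∂μ) ^ (r - 1) := by
  have hr0 : 0 < r := by linarith
  have hr1 : 0 < r - 1 := by linarith
  have hc : r.HolderConjugate r.conjExponent := Real.HolderConjugate.conjExponent hr
  have hold := ENNReal.lintegral_mul_le_Lp_mul_Lq μ hc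
    (f := fun x => g x * W x ^ (1 / r)) (g := fun x => W x ^ (-(1 / r)))
    (hg.mul (hW.pow_const _)).aemeasurable (hW.pow_const _).aemeasurable
  have e1 : ∫⁻ x, g x ∂μ = ∫⁻ x, ((fun x => g x * W x ^ (1 / r)) *
      (fun x => W x ^ (-(1 / r)))) x ∂μ := by
    refine lintegral_congr_ae (h0.mono fun x hx => ?_)
    simp only [Pi.mul_apply]
    rw [mul_assoc, ← ENNReal.rpow_add _ _ hx (ht x), add_neg_cancel, ENNReal.rpow_zero, mul_one]
  have e2 : ∫⁻ x, (g x * W x ^ (1 / r)) ^ r ∂μ = ∫⁻ x, g x ^ r * W x ∂μ := by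
    refine lintegral_congr fun x => ?_
    rw [ENNReal.mul_rpow_of_nonneg _ _ hr0.le, ← ENNReal.rpow_mul, one_div_mul_cancel hr0.ne',
      ENNReal.rpow_one]
  have e3 : ∫⁻ x, (W x ^ (-(1 / r))) ^ r.conjExponent ∂μ = ∫⁻ x, W x ^ (-1 / (r - 1)) ∂μ := by
    refine lintegral_congr fun x => ?_
    rw [← ENNReal.rpow_mul, Real.conjExponent]
    congr 1
    field_simp
  rw [← e1, e2, e3] at hold
  calc (∫⁻ x, g x ∂μ) ^ r ≤ _ := ENNReal.rpow_le_rpow hold hr0.le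
    _ = _ := by
      rw [ENNReal.mul_rpow_of_nonneg _ _ hr0.le, ← ENNReal.rpow_mul, ← ENNReal.rpow_mul,
        one_div_mul_cancel hr0.ne', ENNReal.rpow_one]
      congr 2
      rw [Real.conjExponent]
      field_simp

theorem withDensity_closedBall (W : (Fin n → ℝ) → ℝ≥0∞) (c : Fin n → ℝ) (ρ : ℝ) :
    (volume.withDensity W) (closedBall c ρ) = ∫⁻ y in closedBall c ρ, W y :=
  withDensity_apply _ measurableSet_closedBall

/-- The interplay of Hölder's inequality on a ball with the `A_r` condition on its enlargement. -/
theorem lintegral_rpow_mul_lintegral_le {W g : (Fin n → ℝ) → ℝ≥0∞} (hg : Measurable g)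
    (hW : Measurable W) (h0 : ∀ᵐ x, W x ≠ 0) (ht : ∀ x, W x ≠ ∞) {r : ℝ} (hr : 1 < r)
    {A : ℝ≥0∞} (hA : HasApBound r W A) (c : Fin n → ℝ) {ρ : ℝ} (hρ : 0 < ρ) :
    (∫⁻ y in ball c ρ, g y) ^ r * ∫⁻ y in closedBall c (5 * ρ), W y ≤
      (∫⁻ y in ball c ρ, g y ^ r * W y) * (A * (((5 : ℝ≥0∞) ^ n) ^ r * volume (ball c ρ) ^ r)) := by
  have hr0 : 0 < r := by linarith
  have hr1 : 0 < r - 1 := by linarith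
  have hBD : ball c ρ ⊆ closedBall c (5 * ρ) :=
    ball_subset_closedBall.trans (closedBall_subset_closedBall (by linarith))
  have hvD : volume (closedBall c (5 * ρ)) = (5 : ℝ≥0∞) ^ n * volume (ball c ρ) := by
    simpa using volume_closedBall_nat_mul c c (k := 5) (by norm_num) hρ
  have h1 : (∫⁻ y in ball c ρ, g y) ^ r ≤ (∫⁻ y in ball c ρ, g y ^ r * W y) *
      (∫⁻ y in closedBall c (5 * ρ), W y ^ (-1 / (r - 1))) ^ (r - 1) := by
    refine (lintegral_rpow_le_mul_dual _ hg hW (ae_restrict_of_ae h0) ht hr).trans ?_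
    gcongr
  rw [← ENNReal.mul_rpow_of_nonneg _ _ hr0.le, ← hvD]
  calc _ ≤ (∫⁻ y in ball c ρ, g y ^ r * W y) *
          (∫⁻ y in closedBall c (5 * ρ), W y ^ (-1 / (r - 1))) ^ (r - 1) *
          ∫⁻ y in closedBall c (5 * ρ), W y := by gcongr
    _ = (∫⁻ y in ball c ρ, g y ^ r * W y) * ((∫⁻ y in closedBall c (5 * ρ), W y) *
          (∫⁻ y in closedBall c (5 * ρ), W y ^ (-1 / (r - 1))) ^ (r - 1)) := by ring
    _ ≤ _ := mul_le_mul_right (hA c (5 * ρ) (by positivity)) _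

theorem le_mul_of_rpow_mul_le {t r : ℝ} (ht : 0 < t) (hr : 0 < r) {V I D G A : ℝ≥0∞} (hV0 : V ≠ 0)
    (hV : V ≠ ∞) (hI : ENNReal.ofReal t * V ≤ I) (h : I ^ r * D ≤ G * (A * V ^ r)) :
    D ≤ A * ENNReal.ofReal (t ^ (-r)) * G := by
  have hvr0 : V ^ r ≠ 0 := by simp [ENNReal.rpow_eq_zero_iff, hV0, hV]
  have hvrt : V ^ r ≠ ∞ := ENNReal.rpow_ne_top_of_nonneg hr.le hV
  have h2 : ENNReal.ofReal t ^ r * D ≤ G * A := by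
    refine (ENNReal.mul_le_mul_iff_left hvr0 hvrt).1 ?_
    calc _ = (ENNReal.ofReal t * V) ^ r * D := by
          rw [ENNReal.mul_rpow_of_nonneg _ _ hr.le]; ring
      _ ≤ I ^ r * D := by gcongr
      _ ≤ _ := h
      _ = _ := by ring
  have htr : ENNReal.ofReal (t ^ (-r)) * ENNReal.ofReal t ^ r = 1 := by
    rw [ENNReal.ofReal_rpow_of_pos ht, ← ENNReal.ofReal_mul (by positivity), ← Real.rpow_add ht]
    simp
  calc D = ENNReal.ofReal (t ^ (-r)) * (ENNReal.ofReal t ^ r * D) := by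
        rw [← mul_assoc, htr, one_mul]
    _ ≤ ENNReal.ofReal (t ^ (-r)) * (G * A) := by gcongr
    _ = _ := by ring

/-- The maximal operator is of weak type `(r, r)` with respect to an `A_r` weight, with a constant
linear in the `A_r` constant. In the Vitali covering argument, the function is averaged over the
small disjoint balls, and the `A_r` condition is used on the enlarged balls only. -/
theorem withDensity_lt_supBall_le {W g : (Fin n → ℝ) → ℝ≥0∞} (hg : Measurable g)
    (hW : Measurable W) (h0 : ∀ᵐ x, W x ≠ 0) (ht : ∀ x, W x ≠ ∞) {r : ℝ} (hr : 1 < r)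
    {A : ℝ≥0∞} (hA : HasApBound r W A) {t : ℝ} (htpos : 0 < t) :
    (volume.withDensity W)
        {x | ENNReal.ofReal t < supBall (fun c ρ => ⨍⁻ y in ball c ρ, g y ∂volume) x} ≤
      ((5 : ℝ≥0∞) ^ n) ^ r * A * ENNReal.ofReal (t ^ (-r)) *
        ∫⁻ x, g x ^ r ∂(volume.withDensity W) := by
  have hr0 : 0 < r := by linarith
  set μ := volume.withDensity W with hμ
  set ν := μ.withDensity (fun x => g x ^ r) with hν
  refine (measure_lt_supBall_le μ ν (((5 : ℝ≥0∞) ^ n) ^ r * A * ENNReal.ofReal (t ^ (-r))) _ _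
    fun c ρ hρ hlt => ?_).trans ?_
  · have hν' : ν (ball c ρ) = ∫⁻ y in ball c ρ, g y ^ r * W y := by
      rw [hν, withDensity_apply _ measurableSet_ball, hμ,
        restrict_withDensity measurableSet_ball,
        lintegral_withDensity_eq_lintegral_mul _ hW (hg.pow_const r)]
      exact lintegral_congr fun x => mul_comm _ _
    have hT : ENNReal.ofReal t * volume (ball c ρ) ≤ ∫⁻ y in ball c ρ, g y := by
      rw [setLAverage_eq] at hlt
      exact ENNReal.mul_le_of_le_div hlt.le
    rw [hν', withDensity_closedBall W c]
    have h1 := lintegral_rpow_mul_lintegral_le hg hW h0 ht hr hA c hρ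
    refine le_mul_of_rpow_mul_le htpos hr0 (volume_ball_ne_zero c hρ) (volume_ball_ne_top c ρ) hT
      (h1.trans (le_of_eq ?_))
    ring
  · refine mul_le_mul_right ?_ _
    rw [hν]
    refine (measure_mono (subset_univ _)).trans (le_of_eq ?_)
    rw [withDensity_apply _ MeasurableSet.univ, Measure.restrict_univ]

theorem setLAverage_const_le (s : Set (Fin n → ℝ)) (C : ℝ≥0∞) : ⨍⁻ _ in s, C ∂volume ≤ C := by
  rw [setLAverage_eq, setLIntegral_const]
  exact ENNReal.div_le_of_le_mul le_rfl

theorem le_indicator_add {α : Type*} (g : α → ℝ≥0∞) (s : ℝ≥0∞) (x : α) :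
    g x ≤ {x | s < g x}.indicator g x + s := by
  by_cases h : s < g x
  · rw [indicator_of_mem (by exact h)]; exact le_self_add
  · exact (not_lt.1 h).trans le_add_self

/-- The strong type estimate for the maximal operator with respect to a weight in `A_r`, on `L^q`
for `q > r`. -/
theorem lintegral_supBall_rpow_le {W g : (Fin n → ℝ) → ℝ≥0∞} (hg : Measurable g)
    (hW : Measurable W) (h0 : ∀ᵐ x, W x ≠ 0) (ht : ∀ x, W x ≠ ∞) {r q : ℝ} (hr : 1 < r)
    (hrq : r < q) {A : ℝ≥0∞} (hA : HasApBound r W A) :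
    ∫⁻ x, supBall (fun c ρ => ⨍⁻ y in ball c ρ, g y ∂volume) x ^ q * W x ≤
      ENNReal.ofReal (2 ^ q * q / (q - r)) * (((5 : ℝ≥0∞) ^ n) ^ r * A) * ∫⁻ x, g x ^ q * W x := by
  have hr0 : 0 < r := by linarith
  have hM := measurable_supBall (fun c ρ => ⨍⁻ y in ball c ρ, g y ∂volume)
  have e : ∀ u : (Fin n → ℝ) → ℝ≥0∞, Measurable u →
      ∫⁻ x, u x ^ q * W x = ∫⁻ x, u x ^ q ∂(volume.withDensity W) := by
    intro u hu
    rw [lintegral_withDensity_eq_lintegral_mul _ hW (hu.pow_const q)]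
    exact lintegral_congr fun x => mul_comm _ _
  rw [e _ hM, e _ hg]
  refine lintegral_rpow_le_of_weak_type _ hg hM hr0 hrq _ fun s hs => ?_
  have hms : MeasurableSet {x | ENNReal.ofReal s < g x} := measurableSet_lt measurable_const hg
  have hind : Measurable ({x | ENNReal.ofReal s < g x}.indicator g) := hg.indicator hms
  have := withDensity_lt_supBall_le hind hW h0 ht hr hA hs
  have e2 : ∫⁻ x, {x | ENNReal.ofReal s < g x}.indicator g x ^ r ∂(volume.withDensity W) =
      ∫⁻ x in {x | ENNReal.ofReal s < g x}, g x ^ r ∂(volume.withDensity W) := by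
    rw [← lintegral_indicator hms]
    refine lintegral_congr fun x => ?_
    simp only [indicator_apply]
    split_ifs <;> simp [hr0]
  rw [e2] at this
  refine (measure_mono fun x hx => ?_).trans this
  simp only [mem_ofPred_eq, lt_supBall_iff] at hx ⊢
  obtain ⟨c, ρ, hρ, hxb, hlt⟩ := hx
  refine ⟨c, ρ, hρ, hxb, ?_⟩
  by_contra hcon
  refine absurd hlt (not_lt.2 ?_)
  calc ⨍⁻ y in ball c ρ, g y ∂volume
      ≤ ⨍⁻ y in ball c ρ, ({x | ENNReal.ofReal s < g x}.indicator g y + ENNReal.ofReal s) ∂volume :=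
        laverage_mono_ae (ae_of_all _ fun y => le_indicator_add g _ y)
    _ = (⨍⁻ y in ball c ρ, {x | ENNReal.ofReal s < g x}.indicator g y ∂volume) +
        ⨍⁻ _ in ball c ρ, ENNReal.ofReal s ∂volume := by
        simp only [setLAverage_eq]
        rw [lintegral_add_right _ measurable_const, ENNReal.add_div]
    _ ≤ ENNReal.ofReal s + ENNReal.ofReal s :=
        add_le_add (not_lt.1 hcon) (setLAverage_const_le _ _)
    _ = ENNReal.ofReal (2 * s) := by
        rw [← ENNReal.ofReal_add hs.le hs.le]; congr 1; ring

/-! ### Comparison of the Luxemburg norm with power averages -/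

/-- The constant in the comparison of the Luxemburg norm of `t log(e + t)^λ` with power means. -/
noncomputable def luxConst (lam : ℝ) : ℝ := max (8 * lam ^ lam) 1

theorem one_le_luxConst (lam : ℝ) : 1 ≤ luxConst lam := le_max_right _ _

theorem log_rpow_le {lam ε y : ℝ} (hlam : 0 < lam) (hε : 0 < ε) (hy : 1 ≤ y) :
    Real.log y ^ lam ≤ lam ^ lam * ε ^ (-lam) * y ^ ε := by
  have hy0 : 0 ≤ y := by linarith
  have h1 := Real.log_le_rpow_div hy0 (div_pos hε hlam)
  calc Real.log y ^ lam ≤ (y ^ (ε / lam) / (ε / lam)) ^ lam :=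
        Real.rpow_le_rpow (Real.log_nonneg hy) h1 hlam.le
    _ = _ := by
        rw [Real.div_rpow (by positivity) (by positivity), ← Real.rpow_mul hy0,
          div_mul_cancel₀ _ hlam.ne', Real.div_rpow hε.le hlam.le, Real.rpow_neg hε.le]
        field_simp

theorem exp_one_add_rpow_le {u ε : ℝ} (hu : 0 ≤ u) (hε : 0 < ε) (hε1 : ε ≤ 1) :
    u * (Real.exp 1 + u) ^ ε ≤ 4 * (1 + u ^ (1 + ε)) := by
  have he : Real.exp 1 < 3 := Real.exp_one_lt_three
  have he0 : 0 < Real.exp 1 := Real.exp_pos 1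
  have h4 : (4 : ℝ) ^ ε ≤ 4 := by
    simpa using Real.rpow_le_rpow_of_exponent_le (by norm_num : (1 : ℝ) ≤ 4) hε1
  have hup : 0 ≤ u ^ (1 + ε) := by positivity
  rcases le_total u 1 with h | h
  · have : (Real.exp 1 + u) ^ ε ≤ 4 :=
      (Real.rpow_le_rpow (by positivity) (by linarith) hε.le).trans h4
    nlinarith
  · have h1 : (Real.exp 1 + u) ^ ε ≤ 4 * u ^ ε := by
      calc (Real.exp 1 + u) ^ ε ≤ (4 * u) ^ ε :=
            Real.rpow_le_rpow (by positivity) (by nlinarith) hε.le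
        _ = 4 ^ ε * u ^ ε := Real.mul_rpow (by norm_num) hu
        _ ≤ _ := by gcongr
    have h2 : u ^ (1 + ε) = u * u ^ ε := by
      rw [Real.rpow_add (by linarith), Real.rpow_one]
    rw [h2]
    nlinarith

theorem youngLog_div_le {lam ε u : ℝ} (hlam : 0 < lam) (hε : 0 < ε) (hε1 : ε ≤ 1) (hu : 0 ≤ u) :
    youngLog lam (u / (luxConst lam * ε ^ (-lam))) ≤ (1 + u ^ (1 + ε)) / 2 := by
  set L := luxConst lam * ε ^ (-lam) with hL
  have hεl : 1 ≤ ε ^ (-lam) := by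
    rw [Real.rpow_neg hε.le]
    exact (one_le_inv₀ (by positivity)).2 (Real.rpow_le_one hε.le hε1 hlam.le)
  have hL1 : 1 ≤ L := one_le_mul_of_one_le_of_one_le (one_le_luxConst lam) hεl
  have hL0 : 0 < L := by linarith
  have hK : 8 * lam ^ lam ≤ luxConst lam := le_max_left _ _
  have he1 : 1 ≤ Real.exp 1 := Real.one_le_exp (by norm_num)
  have hdiv : u / L ≤ u := div_le_self hu hL1
  have hd0 : 0 ≤ u / L := by positivity
  have h1 : Real.log (Real.exp 1 + u / L) ^ lam ≤ lam ^ lam * ε ^ (-lam) * (Real.exp 1 + u) ^ ε :=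
    (Real.rpow_le_rpow (Real.log_nonneg (by linarith))
      (Real.log_le_log (by linarith) (by linarith)) hlam.le).trans
      (log_rpow_le hlam hε (by linarith))
  have hle : lam ^ lam * ε ^ (-lam) ≤ L / 8 := by
    rw [hL]
    have : 0 < ε ^ (-lam) := by positivity
    nlinarith
  have h3 := exp_one_add_rpow_le hu hε hε1
  calc youngLog lam (u / L) ≤ u / L * (L / 8 * (Real.exp 1 + u) ^ ε) := by
        unfold youngLog
        gcongr
        exact h1.trans (by gcongr)
    _ = (u * (Real.exp 1 + u) ^ ε) / 8 := by field_simp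
    _ ≤ _ := by linarith

theorem luxemburgNorm_le {lam ε : ℝ} (hlam : 0 < lam) (hε : 0 < ε) (hε1 : ε ≤ 1)
    (Q : Set (Fin n → ℝ)) (f : (Fin n → ℝ) → ℝ) :
    luxemburgNorm (youngLog lam) Q f ≤ ENNReal.ofReal (luxConst lam * ε ^ (-lam)) *
      (⨍⁻ y in Q, ‖f y‖ₑ ^ (1 + ε) ∂volume) ^ (1 / (1 + ε)) := by
  set L := luxConst lam * ε ^ (-lam) with hL
  have hL0 : 0 < L := mul_pos (by linarith [one_le_luxConst lam]) (by positivity)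
  set X := ⨍⁻ y in Q, ‖f y‖ₑ ^ (1 + ε) ∂volume with hX
  have hθ : 0 < 1 + ε := by linarith
  by_cases hXt : X ^ (1 / (1 + ε)) = ∞
  · rw [hXt, ENNReal.mul_top (by simpa using hL0)]; exact le_top
  have key : ∀ a : ℝ, 0 < a → X ^ (1 / (1 + ε)) ≤ ENNReal.ofReal a →
      luxemburgNorm (youngLog lam) Q f ≤ ENNReal.ofReal (L * a) := by
    intro a ha hXa
    have hXa' : X ≤ ENNReal.ofReal (a ^ (1 + ε)) := by
      rw [← ENNReal.ofReal_rpow_of_pos ha, ← ENNReal.rpow_inv_le_iff hθ]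
      simpa using hXa
    refine iInf_le_of_le (L * a) (iInf₂_le_of_le (by positivity) ?_ le_rfl)
    have pt : ∀ y, ENNReal.ofReal (youngLog lam (|f y| / (L * a))) ≤
        2⁻¹ + 2⁻¹ * ENNReal.ofReal (a ^ (-(1 + ε))) * ‖f y‖ₑ ^ (1 + ε) := by
      intro y
      have h := youngLog_div_le hlam hε hε1 (u := |f y| / a) (by positivity)
      rw [← hL, div_div, mul_comm a L] at h
      refine (ENNReal.ofReal_le_ofReal h).trans (le_of_eq ?_)
      rw [Real.div_rpow (abs_nonneg _) ha.le, show (1 + |f y| ^ (1 + ε) / a ^ (1 + ε)) / 2 =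
        2⁻¹ + 2⁻¹ * a ^ (-(1 + ε)) * |f y| ^ (1 + ε) by rw [Real.rpow_neg ha.le]; field_simp,
        ENNReal.ofReal_add (by positivity) (by positivity), ENNReal.ofReal_mul (by positivity),
        ENNReal.ofReal_mul (by positivity), ENNReal.ofReal_inv_of_pos (by norm_num),
        ENNReal.ofReal_ofNat, ← ENNReal.ofReal_rpow_of_nonneg (abs_nonneg _) hθ.le,
        Real.enorm_eq_ofReal_abs]
    have hc : (2⁻¹ : ℝ≥0∞) * ENNReal.ofReal (a ^ (-(1 + ε))) ≠ ∞ :=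
      ENNReal.mul_ne_top (by simp) ENNReal.ofReal_ne_top
    calc ⨍⁻ y in Q, ENNReal.ofReal (youngLog lam (|f y| / (L * a))) ∂volume
        ≤ ⨍⁻ y in Q, (2⁻¹ + 2⁻¹ * ENNReal.ofReal (a ^ (-(1 + ε))) * ‖f y‖ₑ ^ (1 + ε)) ∂volume :=
          laverage_mono_ae (ae_of_all _ pt)
      _ = (⨍⁻ _ in Q, (2⁻¹ : ℝ≥0∞) ∂volume) + 2⁻¹ * ENNReal.ofReal (a ^ (-(1 + ε))) * X := by
          rw [hX]
          simp only [setLAverage_eq]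
          rw [lintegral_add_left measurable_const, lintegral_const_mul' _ _ hc, ENNReal.add_div,
            mul_div_assoc]
      _ ≤ 2⁻¹ + 2⁻¹ * ENNReal.ofReal (a ^ (-(1 + ε))) * ENNReal.ofReal (a ^ (1 + ε)) := by
          gcongr
          exact setLAverage_const_le _ _
      _ = 1 := by
          rw [mul_assoc, ← ENNReal.ofReal_mul (by positivity), ← Real.rpow_add ha]
          simp [ENNReal.inv_two_add_inv_two]
  refine ENNReal.le_of_forall_pos_le_add fun η hη _ => ?_
  set Y := (X ^ (1 / (1 + ε))).toReal with hY
  have hY0 : 0 ≤ Y := ENNReal.toReal_nonneg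
  have hη' : (0 : ℝ) < η := hη
  have h := key (Y + η / L) (by positivity) (by
    rw [← ENNReal.ofReal_toReal hXt]
    exact ENNReal.ofReal_le_ofReal (by rw [← hY]; linarith [div_pos hη' hL0]))
  refine h.trans (le_of_eq ?_)
  rw [mul_add, mul_div_cancel₀ _ hL0.ne', ENNReal.ofReal_add (by positivity) (by positivity),
    ENNReal.ofReal_mul hL0.le, hY, ENNReal.ofReal_toReal hXt, ENNReal.ofReal_coe_nnreal]

theorem setLAverage_closedBall_le (c : Fin n → ℝ) {ρ : ℝ} (hρ : 0 < ρ)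
    (g : (Fin n → ℝ) → ℝ≥0∞) :
    ⨍⁻ y in closedBall c ρ, g y ∂volume ≤ (2 : ℝ≥0∞) ^ n * ⨍⁻ y in ball c (2 * ρ), g y ∂volume := by
  have hv : volume (ball c (2 * ρ)) = (2 : ℝ≥0∞) ^ n * volume (closedBall c ρ) := by
    have := volume_closedBall_nat_mul c c (k := 2) (by norm_num) hρ
    rw [measure_congr (ball_ae_eq_closedBall c (by positivity : 0 < 2 * ρ)),
      ← measure_congr (ball_ae_eq_closedBall c hρ)]
    exact_mod_cast this
  rw [setLAverage_eq, setLAverage_eq, hv, ← mul_div_assoc,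
    ENNReal.mul_div_mul_left _ _ (by positivity) (by simp)]
  gcongr
  exact closedBall_subset_ball (by linarith)

theorem orliczMaximal_le {lam ε : ℝ} (hlam : 0 < lam) (hε : 0 < ε) (hε1 : ε ≤ 1)
    (f : (Fin n → ℝ) → ℝ) (x : Fin n → ℝ) :
    orliczMaximal (youngLog lam) f x ≤ ENNReal.ofReal (luxConst lam * ε ^ (-lam)) * 2 ^ n *
      supBall (fun c ρ => ⨍⁻ y in ball c ρ, ‖f y‖ₑ ^ (1 + ε) ∂volume) x ^ (1 / (1 + ε)) := by
  have hθ : 0 < 1 + ε := by linarith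
  refine iSup_le fun a => iSup_le fun r => iSup₂_le fun hr hx => ?_
  rw [cube_eq_closedBall a hr.le] at hx ⊢
  set c : Fin n → ℝ := fun i => a i + r / 2
  have hr2 : 0 < r / 2 := by positivity
  refine (luxemburgNorm_le hlam hε hε1 _ f).trans ?_
  rw [mul_assoc]
  gcongr
  have h2 : (1 : ℝ≥0∞) ≤ 2 ^ n := one_le_pow₀ (by norm_num)
  calc (⨍⁻ y in closedBall c (r / 2), ‖f y‖ₑ ^ (1 + ε) ∂volume) ^ (1 / (1 + ε))
      ≤ (2 ^ n * supBall (fun c ρ => ⨍⁻ y in ball c ρ, ‖f y‖ₑ ^ (1 + ε) ∂volume) x) ^ (1 / (1 + ε)) := by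
        gcongr
        refine (setLAverage_closedBall_le c hr2 _).trans ?_
        gcongr
        exact le_supBall (fun c ρ => ⨍⁻ y in ball c ρ, ‖f y‖ₑ ^ (1 + ε) ∂volume)
          (by positivity : 0 < 2 * (r / 2)) (closedBall_subset_ball (by linarith) hx)
    _ ≤ _ := by
        rw [ENNReal.mul_rpow_of_nonneg _ _ (by positivity)]
        gcongr
        calc ((2 : ℝ≥0∞) ^ n) ^ (1 / (1 + ε)) ≤ ((2 : ℝ≥0∞) ^ n) ^ (1 : ℝ) := by
              apply ENNReal.rpow_le_rpow_of_exponent_le h2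
              rw [div_le_one hθ]; linarith
          _ = _ := ENNReal.rpow_one _

theorem orliczMaximal_congr_ae {Φ : ℝ → ℝ} {f g : (Fin n → ℝ) → ℝ} (h : f =ᵐ[volume] g) :
    orliczMaximal Φ f = orliczMaximal Φ g := by
  have hl : ∀ Q, luxemburgNorm Φ Q f = luxemburgNorm Φ Q g := by
    intro Q
    unfold luxemburgNorm
    have : ∀ t : ℝ, ⨍⁻ y in Q, ENNReal.ofReal (Φ (|f y| / t)) ∂volume =
        ⨍⁻ y in Q, ENNReal.ofReal (Φ (|g y| / t)) ∂volume := fun t =>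
      laverage_congr ((ae_restrict_of_ae h).mono fun y hy => by simp only [hy])
    simp_rw [this]
  unfold orliczMaximal
  simp_rw [hl]

/-- The weak type `(r, r)` estimate, interpolated with `L^∞`, is applied on `L^q` to
`|f| ^ (p / q)`; the excess `p / q - 1` of this power over `1` absorbs the logarithm. -/
theorem opNorm_orliczMaximal_le {lam : ℝ} (hlam : 0 < lam) {w : (Fin n → ℝ) → ℝ}
    (hw : Measurable w) (h0 : ∀ᵐ x, ENNReal.ofReal (w x) ≠ 0) {r q p : ℝ} (hr : 1 < r)
    (hrq : r < q) (hqp : q < p) (hp : p ≤ 2 * q) {A : ℝ≥0∞}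
    (hA : HasApBound r (fun x => ENNReal.ofReal (w x)) A) :
    opNorm p w (orliczMaximal (youngLog lam)) ≤
      ENNReal.ofReal (luxConst lam * (p / q - 1) ^ (-lam)) * 2 ^ n *
        (ENNReal.ofReal (2 ^ q * q / (q - r)) * (((5 : ℝ≥0∞) ^ n) ^ r * A)) ^ (1 / p) := by
  have hq0 : 0 < q := by linarith
  have hp0 : 0 < p := by linarith
  refine sInf_le fun f hf _ => ?_
  set ε := p / q - 1 with hεdef
  have hθ : 1 + ε = p / q := by rw [hεdef]; ring
  have hε : 0 < ε := by rw [hεdef, sub_pos, lt_div_iff₀ hq0]; linarith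
  have hε1 : ε ≤ 1 := by
    have : p / q ≤ 2 := by rw [div_le_iff₀ hq0]; linarith
    rw [hεdef]; linarith
  have hfm : Measurable (hf.mk f) := hf.measurable_mk
  have hfe : f =ᵐ[volume] hf.mk f := hf.ae_eq_mk
  rw [orliczMaximal_congr_ae hfe]
  have hlp : lpNorm p w (fun x => ‖f x‖ₑ) = lpNorm p w (fun x => ‖hf.mk f x‖ₑ) := by
    unfold lpNorm
    congr 1
    exact lintegral_congr_ae (hfe.mono fun x hx => by simp only [hx])
  rw [hlp]
  generalize hf.mk f = f at hfm
  set L := ENNReal.ofReal (luxConst lam * ε ^ (-lam)) * 2 ^ n with hL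
  have hLt : L ≠ ∞ := ENNReal.mul_ne_top ENNReal.ofReal_ne_top (by simp)
  set g : (Fin n → ℝ) → ℝ≥0∞ := fun y => ‖f y‖ₑ ^ (1 + ε) with hg
  have hgm : Measurable g := hfm.enorm.pow_const _
  have hstrong := lintegral_supBall_rpow_le hgm hw.ennreal_ofReal h0
    (fun x => ENNReal.ofReal_ne_top) hr hrq hA
  set C := ENNReal.ofReal (2 ^ q * q / (q - r)) * (((5 : ℝ≥0∞) ^ n) ^ r * A) with hC
  have h1 : ∫⁻ x, orliczMaximal (youngLog lam) f x ^ p * ENNReal.ofReal (w x) ≤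
      L ^ p * (C * ∫⁻ x, ‖f x‖ₑ ^ p * ENNReal.ofReal (w x)) := by
    calc ∫⁻ x, orliczMaximal (youngLog lam) f x ^ p * ENNReal.ofReal (w x)
        ≤ ∫⁻ x, L ^ p * (supBall (fun c ρ => ⨍⁻ y in ball c ρ, g y ∂volume) x ^ q *
            ENNReal.ofReal (w x)) := by
          refine lintegral_mono fun x => ?_
          rw [← mul_assoc]
          gcongr
          refine (ENNReal.rpow_le_rpow (orliczMaximal_le hlam hε hε1 f x) hp0.le).trans ?_
          rw [ENNReal.mul_rpow_of_nonneg _ _ hp0.le, ← ENNReal.rpow_mul]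
          have : 1 / (1 + ε) * p = q := by rw [hθ]; field_simp
          rw [this]
      _ = L ^ p * ∫⁻ x, supBall (fun c ρ => ⨍⁻ y in ball c ρ, g y ∂volume) x ^ q *
            ENNReal.ofReal (w x) :=
          lintegral_const_mul' _ _ (ENNReal.rpow_ne_top_of_nonneg hp0.le hLt)
      _ ≤ L ^ p * (C * ∫⁻ x, g x ^ q * ENNReal.ofReal (w x)) := by gcongr
      _ = _ := by
          congr 2
          refine lintegral_congr fun x => ?_
          rw [hg, ← ENNReal.rpow_mul, hθ, div_mul_cancel₀ _ hq0.ne']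
  unfold lpNorm
  clear_value L
  calc _ ≤ (L ^ p * (C * ∫⁻ x, ‖f x‖ₑ ^ p * ENNReal.ofReal (w x))) ^ (1 / p) := by gcongr
    _ = _ := by
      rw [ENNReal.mul_rpow_of_nonneg _ _ (by positivity),
        ENNReal.mul_rpow_of_nonneg _ _ (by positivity), ← ENNReal.rpow_mul,
        mul_one_div_cancel hp0.ne', ENNReal.rpow_one, mul_assoc]

/-! ### Local maximal functions -/

theorem exists_closedBall_inter_subset (c q : Fin n → ℝ) {ρ R : ℝ} (hρ : 0 < ρ) (hR : ρ ≤ R) :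
    ∃ c', closedBall c ρ ∩ closedBall q R ⊆ closedBall c' ρ ∧
      closedBall c' ρ ⊆ closedBall q R := by
  have hR0 : 0 ≤ R := hρ.le.trans hR
  refine ⟨fun i => max (q i - (R - ρ)) (min (c i) (q i + (R - ρ))), ?_, ?_⟩
  · rintro y ⟨h1, h2⟩
    rw [mem_closedBall, dist_pi_le_iff hρ.le] at h1 ⊢
    rw [mem_closedBall, dist_pi_le_iff hR0] at h2
    intro i
    have h1 := h1 i
    have h2 := h2 i
    simp only [Real.dist_eq, abs_le] at *
    rcases le_total (c i) (q i + (R - ρ)) with h | h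
    · rw [min_eq_left h]
      rcases le_total (q i - (R - ρ)) (c i) with h' | h'
      · rw [max_eq_right h']; exact h1
      · rw [max_eq_left h']; constructor <;> linarith
    · rw [min_eq_right h, max_eq_right (by linarith)]; constructor <;> linarith
  · intro y hy
    rw [mem_closedBall, dist_pi_le_iff hρ.le] at hy
    rw [mem_closedBall, dist_pi_le_iff hR0]
    intro i
    have hy := hy i
    have h1 : max (q i - (R - ρ)) (min (c i) (q i + (R - ρ))) ≤ q i + (R - ρ) :=
      max_le (by linarith) (min_le_right _ _)
    have h2 := le_max_left (q i - (R - ρ)) (min (c i) (q i + (R - ρ)))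
    simp only [Real.dist_eq, abs_le] at *
    constructor <;> linarith

theorem ball_subset_ball_of_subset_closedBall {c q : Fin n → ℝ} {ρ R : ℝ} (hR : 0 < R)
    (h : ball c ρ ⊆ closedBall q R) : ball c ρ ⊆ ball q R := by
  rw [← interior_closedBall q hR.ne']
  exact interior_maximal h isOpen_ball

theorem exists_ball_inter_subset (c q : Fin n → ℝ) {ρ R : ℝ} (hρ : 0 < ρ) (hR : ρ ≤ R) :
    ∃ c', ball c ρ ∩ ball q R ⊆ ball c' ρ ∧ ball c' ρ ⊆ closedBall q R := by
  obtain ⟨c', h1, h2⟩ := exists_closedBall_inter_subset c q hρ hR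
  refine ⟨c', ?_, ball_subset_closedBall.trans h2⟩
  rw [← interior_closedBall c' hρ.ne']
  exact interior_maximal
    ((inter_subset_inter ball_subset_closedBall ball_subset_closedBall).trans h1)
    (isOpen_ball.inter isOpen_ball)

theorem radius_le_of_ball_subset (hn : 0 < n) {c q : Fin n → ℝ} {ρ R : ℝ} (hρ : 0 < ρ) (hR : 0 < R)
    (h : ball c ρ ⊆ closedBall q R) : ρ ≤ R := by
  have := measure_mono (μ := volume) h
  rw [volume_ball_eq c hρ, volume_closedBall_eq q hR, ENNReal.ofReal_le_ofReal_iff (by positivity),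
    pow_le_pow_iff_left₀ (by positivity) (by positivity) hn.ne'] at this
  linarith

open Classical in
/-- The average of `s` over a ball if the ball lies in the cube `closedBall q R`, and `0` otherwise.
Its `supBall` is the maximal function of `s` relative to that cube. -/
noncomputable def localAverage (q : Fin n → ℝ) (R : ℝ) (s : (Fin n → ℝ) → ℝ≥0∞) (c : Fin n → ℝ)
    (ρ : ℝ) : ℝ≥0∞ :=
  if ball c ρ ⊆ closedBall q R then ⨍⁻ y in ball c ρ, s y ∂volume else 0

theorem localAverage_eq {q : Fin n → ℝ} {R : ℝ} {s : (Fin n → ℝ) → ℝ≥0∞} {c : Fin n → ℝ} {ρ : ℝ}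
    (h : ball c ρ ⊆ closedBall q R) :
    localAverage q R s c ρ = ⨍⁻ y in ball c ρ, s y ∂volume := if_pos h

theorem subset_of_lt_localAverage {q : Fin n → ℝ} {R : ℝ} {s : (Fin n → ℝ) → ℝ≥0∞}
    {c : Fin n → ℝ} {ρ : ℝ} {t : ℝ≥0∞} (h : t < localAverage q R s c ρ) :
    ball c ρ ⊆ closedBall q R := by
  by_contra hcon
  simp [localAverage, hcon] at h

theorem setOf_lt_supBall_localAverage_subset {q : Fin n → ℝ} {R : ℝ} (hR : 0 < R)
    (s : (Fin n → ℝ) → ℝ≥0∞) (t : ℝ≥0∞) :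
    {x | t < supBall (localAverage q R s) x} ⊆ ball q R := by
  intro x hx
  obtain ⟨c, ρ, hρ, hxc, hlt⟩ := lt_supBall_iff.1 hx
  exact ball_subset_ball_of_subset_closedBall hR (subset_of_lt_localAverage hlt) hxc

theorem laverage_le_iff {c : Fin n → ℝ} {ρ : ℝ} (hρ : 0 < ρ) (s : (Fin n → ℝ) → ℝ≥0∞) (t : ℝ≥0∞) :
    ⨍⁻ y in ball c ρ, s y ∂volume ≤ t ↔ ∫⁻ y in ball c ρ, s y ≤ t * volume (ball c ρ) := by
  rw [setLAverage_eq, ENNReal.div_le_iff (volume_ball_ne_zero c hρ) (volume_ball_ne_top c ρ)]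

/-- `IsStopped q R s t x ρ` says that the balls that contain `x`, lie in the cube `closedBall q R`
and are larger than twice the radius `ρ` all have averages of `s` at most `t`. -/
def IsStopped (q : Fin n → ℝ) (R : ℝ) (s : (Fin n → ℝ) → ℝ≥0∞) (t : ℝ≥0∞) (x : Fin n → ℝ)
    (ρ : ℝ) : Prop :=
  ∀ c' ρ', 0 < ρ' → x ∈ ball c' ρ' → ball c' ρ' ⊆ closedBall q R → 2 * ρ < ρ' →
    ∫⁻ y in ball c' ρ', s y ≤ t * volume (ball c' ρ')

/-- The substitute for maximal dyadic cubes in a stopping time argument: every point of the level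
set of the local maximal function lies in a ball of nearly maximal radius. -/
theorem exists_isStopped (hn : 0 < n) {q : Fin n → ℝ} {R : ℝ} (hR : 0 < R)
    {s : (Fin n → ℝ) → ℝ≥0∞} {t : ℝ≥0∞} {x : Fin n → ℝ}
    (hx : t < supBall (localAverage q R s) x) :
    ∃ c ρ, 0 < ρ ∧ x ∈ ball c ρ ∧ t < localAverage q R s c ρ ∧ IsStopped q R s t x ρ := by
  set S : Set ℝ := {ρ | 0 < ρ ∧ ∃ c, x ∈ ball c ρ ∧ t < localAverage q R s c ρ} with hS
  have hbdd : BddAbove S := ⟨R, fun ρ hρ => by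
    obtain ⟨h0, c, -, hlt⟩ := hρ
    exact radius_le_of_ball_subset hn h0 hR (subset_of_lt_localAverage hlt)⟩
  obtain ⟨c₀, ρ₀, h0, hx0, hlt0⟩ := lt_supBall_iff.1 hx
  have hmem : ρ₀ ∈ S := ⟨h0, c₀, hx0, hlt0⟩
  have hpos : 0 < sSup S := h0.trans_le (le_csSup hbdd hmem)
  obtain ⟨ρ, ⟨hρ, c, hxc, hlt⟩, hρS⟩ := exists_lt_of_lt_csSup ⟨ρ₀, hmem⟩ (half_lt_self hpos)
  refine ⟨c, ρ, hρ, hxc, hlt, fun c' ρ' hρ' hx' hsub h2 => ?_⟩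
  rw [← laverage_le_iff hρ']
  by_contra hcon
  have : ρ' ∈ S := ⟨hρ', c', hx', by rw [localAverage_eq hsub]; exact not_le.1 hcon⟩
  linarith [le_csSup hbdd this]

theorem IsStopped.exists_ball {q : Fin n → ℝ} {R : ℝ} (hR : 0 < R)
    {s : (Fin n → ℝ) → ℝ≥0∞} {t : ℝ≥0∞} {x : Fin n → ℝ} {ρ : ℝ}
    (hst : IsStopped q R s t x ρ) (hxq : x ∈ ball q R)
    (hQ : ∫⁻ y in ball q R, s y ≤ t * volume (ball q R)) {c : Fin n → ℝ} {r : ℝ} (hr : 0 < r)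
    (hρr : 2 * ρ < r) (hx : x ∈ ball c r) :
    ∃ c' r', 0 < r' ∧ volume (ball c' r') ≤ volume (ball c r) ∧
      ball c r ∩ ball q R ⊆ ball c' r' ∧ ball c' r' ⊆ closedBall q R ∧
      ∫⁻ y in ball c' r', s y ≤ t * volume (ball c' r') := by
  rcases le_total R r with h | h
  · refine ⟨q, R, hR, ?_, inter_subset_right, ball_subset_closedBall, hQ⟩
    rw [volume_ball_eq q hR, volume_ball_eq c hr]
    gcongr
  · obtain ⟨c', h1, h2⟩ := exists_ball_inter_subset c q hr h
    refine ⟨c', r, hr, ?_, h1, h2, hst c' r hr (h1 ⟨hx, hxq⟩) h2 hρr⟩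
    rw [volume_ball_eq c' hr, volume_ball_eq c hr]

theorem volume_ball_seven_mul (c : Fin n → ℝ) {ρ : ℝ} (hρ : 0 < ρ) :
    volume (ball c (7 * ρ)) = (7 : ℝ≥0∞) ^ n * volume (ball c ρ) := by
  rw [measure_congr (ball_ae_eq_closedBall c (by positivity : 0 < 7 * ρ))]
  simpa using volume_closedBall_nat_mul c c (k := 7) (by norm_num) hρ

section Stopping

variable {q : Fin n → ℝ} {R : ℝ} {s : (Fin n → ℝ) → ℝ≥0∞} {t : ℝ≥0∞} {x c : Fin n → ℝ} {ρ : ℝ}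

theorem IsStopped.lintegral_le (hR : 0 < R) (hst : IsStopped q R s t x ρ) (hxq : x ∈ ball q R)
    (hQ : ∫⁻ y in ball q R, s y ≤ t * volume (ball q R)) (hρ : 0 < ρ) (hx : x ∈ ball c ρ) :
    ∫⁻ y in closedBall c (5 * ρ) ∩ ball q R, s y ≤ 7 ^ n * t * volume (ball c ρ) := by
  obtain ⟨c', r', hr', hvol, hsub, -, hint⟩ := hst.exists_ball hR hxq hQ
    (by positivity : 0 < 7 * ρ) (by linarith) (ball_subset_ball (by linarith) hx)
  calc ∫⁻ y in closedBall c (5 * ρ) ∩ ball q R, s y ≤ ∫⁻ y in ball c' r', s y :=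
        lintegral_mono_set ((inter_subset_inter_left _
          (closedBall_subset_ball (by linarith))).trans hsub)
    _ ≤ t * volume (ball c (7 * ρ)) := hint.trans (by gcongr)
    _ = _ := by rw [volume_ball_seven_mul c hρ]; ring

/-- On the enlarged stopping ball, the local maximal function exceeds the maximal function relative
to a comparable cube by at most a multiple of the height. -/
theorem IsStopped.supBall_le (hR : 0 < R) (hst : IsStopped q R s t x ρ) (hxq : x ∈ ball q R)
    (hQ : ∫⁻ y in ball q R, s y ≤ t * volume (ball q R)) (hρ : 0 < ρ) (hx : x ∈ ball c ρ)
    {c' : Fin n → ℝ} {r' : ℝ} (hsub : ball c (7 * ρ) ∩ ball q R ⊆ ball c' r')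
    {z : Fin n → ℝ} (hz : z ∈ closedBall c (5 * ρ)) :
    supBall (localAverage q R s) z ≤ 7 ^ n * t + supBall (localAverage c' r' s) z := by
  rw [supBall_le_iff]
  intro a r hr hza
  by_cases hval : ball a r ⊆ closedBall q R
  swap
  · simp [localAverage, hval]
  have hval' := ball_subset_ball_of_subset_closedBall hR hval
  rw [mem_closedBall] at hz
  have hza' := mem_ball.1 hza
  have hx' := mem_ball.1 hx
  rcases le_or_gt r ρ with h | h
  · have hsub' : ball a r ⊆ ball c' r' := by
      intro y hy
      refine hsub ⟨?_, hval' hy⟩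
      have hya := mem_ball.1 hy
      rw [mem_ball]
      calc dist y c ≤ dist y a + dist z a + dist z c := by
            rw [dist_comm z a]
            exact dist_triangle4 y a z c
        _ < 7 * ρ := by linarith
    rw [localAverage_eq hval, ← localAverage_eq (hsub'.trans ball_subset_closedBall)]
    exact (le_supBall (localAverage c' r' s) hr hza).trans le_add_self
  · refine le_add_right ?_
    have hxa : x ∈ ball a (7 * r) := by
      rw [mem_ball]
      calc dist x a ≤ dist x c + dist z c + dist z a := by
            rw [dist_comm z c]
            exact dist_triangle4 x c z a
        _ < 7 * r := by linarith
    obtain ⟨a', r'', -, hvol, hsub2, -, hint⟩ := hst.exists_ball hR hxq hQ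
      (by positivity : 0 < 7 * r) (by linarith) hxa
    rw [localAverage_eq hval, laverage_le_iff hr]
    calc ∫⁻ y in ball a r, s y ≤ ∫⁻ y in ball a' r'', s y :=
          lintegral_mono_set fun y hy =>
            hsub2 ⟨ball_subset_ball (by linarith) hy, hval' hy⟩
      _ ≤ t * volume (ball a (7 * r)) := hint.trans (by gcongr)
      _ = _ := by rw [volume_ball_seven_mul a hr]; ring

theorem IsStopped.lintegral_supBall_le (hR : 0 < R) (hst : IsStopped q R s t x ρ)
    (hxq : x ∈ ball q R) (hQ : ∫⁻ y in ball q R, s y ≤ t * volume (ball q R)) (hρ : 0 < ρ)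
    (hx : x ∈ ball c ρ) {A : ℝ≥0∞} (hA : ∀ (q : Fin n → ℝ) (R : ℝ), 0 < R →
      ∫⁻ y in ball q R, supBall (localAverage q R s) y ≤ A * ∫⁻ y in ball q R, s y) :
    ∫⁻ y in closedBall c (5 * ρ) ∩ ball q R, supBall (localAverage q R s) y ≤
      49 ^ n * (1 + A) * t * volume (ball c ρ) := by
  obtain ⟨c', r', hr', hvol, hsub, -, hint⟩ := hst.exists_ball hR hxq hQ
    (by positivity : 0 < 7 * ρ) (by linarith) (ball_subset_ball (by linarith) hx)
  have h7 : (1 : ℝ≥0∞) ≤ 7 ^ n := one_le_pow₀ (by norm_num)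
  rw [volume_ball_seven_mul c hρ] at hvol
  calc ∫⁻ y in closedBall c (5 * ρ) ∩ ball q R, supBall (localAverage q R s) y
      ≤ ∫⁻ y in closedBall c (5 * ρ) ∩ ball q R,
          (7 ^ n * t + supBall (localAverage c' r' s) y) :=
        setLIntegral_mono' (measurableSet_closedBall.inter measurableSet_ball) fun z hz =>
          hst.supBall_le hR hxq hQ hρ hx hsub hz.1
    _ ≤ ∫⁻ y in ball c' r', (7 ^ n * t + supBall (localAverage c' r' s) y) :=
        lintegral_mono_set ((inter_subset_inter_left _
          (closedBall_subset_ball (by linarith))).trans hsub)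
    _ ≤ 7 ^ n * t * volume (ball c' r') + A * (t * volume (ball c' r')) := by
        rw [lintegral_add_left measurable_const, setLIntegral_const]
        gcongr
        exact (hA c' r' hr').trans (by gcongr)
    _ ≤ 7 ^ n * t * (7 ^ n * volume (ball c ρ)) +
          7 ^ n * (A * (t * (7 ^ n * volume (ball c ρ)))) := by
        refine add_le_add (by gcongr) ?_
        calc A * (t * volume (ball c' r')) ≤ A * (t * (7 ^ n * volume (ball c ρ))) := by gcongr
          _ ≤ _ := le_mul_of_one_le_left' h7
    _ = _ := by
        rw [show (49 : ℝ≥0∞) = 7 * 7 by norm_num, mul_pow]; ring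

end Stopping

theorem measure_lt_supBall_localAverage_le (hn : 0 < n) {q : Fin n → ℝ} {R : ℝ} (hR : 0 < R)
    {s : (Fin n → ℝ) → ℝ≥0∞} {t : ℝ≥0∞} (κ : Measure (Fin n → ℝ)) (K : ℝ≥0∞)
    (h : ∀ x c ρ, 0 < ρ → x ∈ ball c ρ → x ∈ ball q R → IsStopped q R s t x ρ →
      κ (closedBall c (5 * ρ)) ≤ K * volume (ball c ρ)) :
    κ {x | t < supBall (localAverage q R s) x} ≤
      K * volume {x | t < supBall (localAverage q R s) x} := by
  set T := {x | t < supBall (localAverage q R s) x} with hT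
  have hex : ∀ x : Fin n → ℝ, ∃ c : Fin n → ℝ, ∃ ρ : ℝ, x ∈ T →
      0 < ρ ∧ x ∈ ball c ρ ∧ t < localAverage q R s c ρ ∧ IsStopped q R s t x ρ := by
    intro x
    by_cases hx : x ∈ T
    · obtain ⟨c, ρ, h⟩ := exists_isStopped hn hR hx
      exact ⟨c, ρ, fun _ => h⟩
    · exact ⟨0, 0, fun h => absurd h hx⟩
  choose c ρ hcρ using hex
  have hU : T = ⋃ x ∈ T, ball (c x) (ρ x) := by
    refine subset_antisymm (fun x hx => mem_biUnion hx (hcρ x hx).2.1)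
      (iUnion₂_subset fun x hx y hy => ?_)
    exact lt_supBall_iff.2 ⟨c x, ρ x, (hcρ x hx).1, hy, (hcρ x hx).2.2.1⟩
  have := measure_biUnion_ball_le κ volume K T c ρ (fun x hx => (hcρ x hx).1) fun x hx =>
    h x (c x) (ρ x) (hcρ x hx).1 (hcρ x hx).2.1
      (setOf_lt_supBall_localAverage_subset hR s t hx) (hcρ x hx).2.2.2
  rwa [← hU] at this

/-! ### The sharp reverse Hölder inequality -/

/-- The layer cake formula, split at the height `a`. -/
theorem lintegral_rpow_le_of_measure_lt_le {α : Type*} [MeasurableSpace α] (κ ν : Measure α)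
    [SFinite κ] [SFinite ν] {h : α → ℝ≥0∞} (hh : Measurable h) {δ a : ℝ} (hδ : 0 < δ)
    (B D : ℝ≥0∞) (hB : κ univ ≤ B) (hD : ∀ t : ℝ, 0 < t → a ≤ t →
      κ {x | ENNReal.ofReal t < h x} ≤ D * ENNReal.ofReal t * ν {x | ENNReal.ofReal t < h x}) :
    ∫⁻ x, h x ^ δ ∂κ ≤ ENNReal.ofReal a ^ δ * B +
      D * ENNReal.ofReal δ * ∫⁻ x, h x ^ (1 + δ) ∂ν := by
  have hδ1 : 0 < 1 + δ := by linarith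
  rw [lintegral_rpow_eq_lintegral_measure_lt κ hh hδ,
    lintegral_rpow_eq_lintegral_measure_lt ν hh hδ1, rpow_eq_lintegral_Ioi _ hδ]
  have hm1 : Measurable fun t : ℝ => (if ENNReal.ofReal t < ENNReal.ofReal a then
      ENNReal.ofReal (δ * t ^ (δ - 1)) else 0) := by
    refine Measurable.ite (measurableSet_lt ENNReal.measurable_ofReal measurable_const) ?_
      measurable_const
    fun_prop
  have hanti : Antitone fun t : ℝ => ν {x | ENNReal.ofReal t < h x} := fun t u htu =>
    measure_mono fun x hx => lt_of_le_of_lt (ENNReal.ofReal_le_ofReal htu) hx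
  have hm2 : Measurable fun t : ℝ => ENNReal.ofReal ((1 + δ) * t ^ (1 + δ - 1)) *
      ν {x | ENNReal.ofReal t < h x} := by
    refine Measurable.mul (by fun_prop) hanti.measurable
  rw [← lintegral_mul_const _ hm1, ← lintegral_const_mul _ hm2,
    ← lintegral_add_left (hm1.mul_const _)]
  refine setLIntegral_mono' measurableSet_Ioi fun t ht => ?_
  have ht : 0 < t := ht
  by_cases hta : t < a
  · rw [if_pos ((ENNReal.ofReal_lt_ofReal_iff (ht.trans hta)).2 hta)]
    refine le_add_right ?_
    gcongr
    exact (measure_mono (subset_univ _)).trans hB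
  · refine le_add_left ?_
    have e : ENNReal.ofReal (δ * t ^ (δ - 1)) * ENNReal.ofReal t ≤
        ENNReal.ofReal δ * ENNReal.ofReal ((1 + δ) * t ^ (1 + δ - 1)) := by
      rw [← ENNReal.ofReal_mul (by positivity), ← ENNReal.ofReal_mul (by positivity)]
      refine ENNReal.ofReal_le_ofReal ?_
      have : t ^ (δ - 1) * t = t ^ (1 + δ - 1) := by
        rw [← Real.rpow_add_one ht.ne']; congr 1; ring
      have hp : 0 < t ^ (1 + δ - 1) := by positivity
      calc δ * t ^ (δ - 1) * t = δ * t ^ (1 + δ - 1) := by rw [mul_assoc, this]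
        _ ≤ δ * ((1 + δ) * t ^ (1 + δ - 1)) := by
          gcongr
          nlinarith
    calc _ ≤ ENNReal.ofReal (δ * t ^ (δ - 1)) *
          (D * ENNReal.ofReal t * ν {x | ENNReal.ofReal t < h x}) := by
          gcongr
          exact hD t ht (not_lt.1 hta)
      _ = D * (ENNReal.ofReal (δ * t ^ (δ - 1)) * ENNReal.ofReal t) *
          ν {x | ENNReal.ofReal t < h x} := by ring
      _ ≤ D * (ENNReal.ofReal δ * ENNReal.ofReal ((1 + δ) * t ^ (1 + δ - 1))) *
          ν {x | ENNReal.ofReal t < h x} := by gcongr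
      _ = _ := by ring

/-- Lebesgue's differentiation theorem bounds a function by its local maximal function. -/
theorem ae_le_supBall_localAverage {q : Fin n → ℝ} {R : ℝ}
    {s : (Fin n → ℝ) → ℝ≥0∞} (hs : Measurable s) (hfin : ∫⁻ y in ball q R, s y ≠ ∞) :
    ∀ᵐ x, x ∈ ball q R → s x ≤ supBall (localAverage q R s) x := by
  have hfin' : ∫⁻ y, (ball q R).indicator s y ≠ ∞ := by
    rwa [lintegral_indicator measurableSet_ball]
  filter_upwards [(Besicovitch.vitaliFamily (volume : Measure (Fin n → ℝ))).ae_tendsto_lintegral_div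
    (hs.indicator measurableSet_ball).aemeasurable hfin'] with x hx hxq
  rw [indicator_of_mem hxq] at hx
  have ht := hx.comp (Besicovitch.tendsto_filterAt volume x)
  refine le_of_tendsto ht ?_
  obtain ⟨ε, hε, hsub⟩ := Metric.isOpen_iff.1 isOpen_ball x hxq
  filter_upwards [Ioo_mem_nhdsGT hε] with r hr
  have hr0 : 0 < r := hr.1
  have hsub' : ball x r ⊆ ball q R := (ball_subset_ball hr.2.le).trans hsub
  have e : (∫⁻ y in closedBall x r, (ball q R).indicator s y) / volume (closedBall x r) =
      localAverage q R s x r := by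
    rw [localAverage_eq (hsub'.trans ball_subset_closedBall), setLAverage_eq,
      setLIntegral_closedBall_eq x hr0, ← measure_congr (ball_ae_eq_closedBall x hr0)]
    congr 1
    exact setLIntegral_congr_fun measurableSet_ball fun y hy => indicator_of_mem (hsub' hy) s
  simp only [Function.comp_apply]
  rw [e]
  exact le_supBall (localAverage q R s) hr0 (mem_ball_self hr0)

/-- The reverse Hölder inequality with a maximal function `m` truncated at the height `N`. The
truncation makes the integral of `min m N ^ δ * m` finite, so that a multiple of it can be
absorbed. -/
theorem lintegral_min_supBall_rpow_mul_le (hn : 0 < n) {s : (Fin n → ℝ) → ℝ≥0∞}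
    (hs : Measurable s) (hfin : ∀ (q : Fin n → ℝ) (R : ℝ), ∫⁻ y in ball q R, s y ≠ ∞) {A : ℝ}
    (hA1 : 1 ≤ A) (hA : ∀ (q : Fin n → ℝ) (R : ℝ), 0 < R →
      ∫⁻ y in ball q R, supBall (localAverage q R s) y ≤ ENNReal.ofReal A * ∫⁻ y in ball q R, s y)
    {δ : ℝ} (hδ : 0 < δ) (hδA : 4 * 49 ^ n * A * δ ≤ 1) (q : Fin n → ℝ) {R : ℝ} (hR : 0 < R)
    (N : ℕ) :
    ∫⁻ x in ball q R, min (supBall (localAverage q R s) x) N ^ δ * s x ≤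
      2 * (⨍⁻ y in ball q R, s y ∂volume) ^ δ * ∫⁻ y in ball q R, s y := by
  set m := supBall (localAverage q R s) with hm
  have hmm : Measurable m := measurable_supBall _
  set h : (Fin n → ℝ) → ℝ≥0∞ := fun x => min (m x) N with hh
  have hhm : Measurable h := hmm.min measurable_const
  set S := ∫⁻ y in ball q R, s y with hS
  have hSt : S ≠ ∞ := hfin q R
  set a := (⨍⁻ y in ball q R, s y ∂volume).toReal with ha
  have hat : ⨍⁻ y in ball q R, s y ∂volume ≠ ∞ := (laverage_lt_top hSt).ne
  have hae : ENNReal.ofReal a = ⨍⁻ y in ball q R, s y ∂volume := ENNReal.ofReal_toReal hat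
  have ha0 : 0 ≤ a := ENNReal.toReal_nonneg
  have hQ : ∀ t : ℝ, a ≤ t → ∫⁻ y in ball q R, s y ≤ ENNReal.ofReal t * volume (ball q R) := by
    intro t ht
    rw [← laverage_le_iff hR, ← hae]
    exact ENNReal.ofReal_le_ofReal ht
  rw [← hae]
  -- the level sets of the truncation are those of `m`, below the height `N`
  have hlevel : ∀ (κ : Measure (Fin n → ℝ)) (D : ℝ≥0∞) (t : ℝ),
      κ {x | ENNReal.ofReal t < m x} ≤ D * volume {x | ENNReal.ofReal t < m x} →
      κ {x | ENNReal.ofReal t < h x} ≤ D * volume {x | ENNReal.ofReal t < h x} := by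
    intro κ D t hκ
    by_cases htN : ENNReal.ofReal t < N
    · simpa [hh, lt_min_iff, htN] using hκ
    · simp [hh, htN]
  have hzero : ∀ x, x ∉ ball q R → m x = 0 := by
    intro x hx
    by_contra hne
    exact hx (setOf_lt_supBall_localAverage_subset hR s 0 (pos_iff_ne_zero.2 hne))
  set κ := (volume.withDensity m).restrict (ball q R) with hκ
  set σ := (volume.withDensity s).restrict (ball q R) with hσ
  have hκu : κ univ ≤ ENNReal.ofReal A * S := by
    rw [hκ, Measure.restrict_apply_univ, withDensity_apply _ measurableSet_ball]
    exact hA q R hR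
  have hσu : σ univ ≤ S := by
    rw [hσ, Measure.restrict_apply_univ, withDensity_apply _ measurableSet_ball]
  have e : ∀ g : (Fin n → ℝ) → ℝ≥0∞, Measurable g →
      ∫⁻ x, h x ^ δ ∂((volume.withDensity g).restrict (ball q R)) =
        ∫⁻ x in ball q R, h x ^ δ * g x := by
    intro g hg
    rw [restrict_withDensity measurableSet_ball,
      lintegral_withDensity_eq_lintegral_mul _ hg (hhm.pow_const δ)]
    exact lintegral_congr fun x => mul_comm _ _
  have hclosed : ∀ (g : (Fin n → ℝ) → ℝ≥0∞) (c : Fin n → ℝ) (ρ : ℝ),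
      ((volume.withDensity g).restrict (ball q R)) (closedBall c ρ) =
        ∫⁻ y in closedBall c ρ ∩ ball q R, g y := by
    intro g c ρ
    rw [Measure.restrict_apply measurableSet_closedBall,
      withDensity_apply _ (measurableSet_closedBall.inter measurableSet_ball)]
  have hI := lintegral_rpow_le_of_measure_lt_le κ volume hhm (a := a) hδ (ENNReal.ofReal A * S)
    (49 ^ n * (1 + ENNReal.ofReal A)) hκu fun t ht hat => by
      refine hlevel κ _ t (measure_lt_supBall_localAverage_le hn hR κ _ ?_)
      intro x c ρ hρ hxc hxq hst
      rw [hκ, hclosed]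
      exact hst.lintegral_supBall_le hR hxq (hQ t hat) hρ hxc hA
  have hJ := lintegral_rpow_le_of_measure_lt_le σ volume hhm (a := a) hδ S (7 ^ n) hσu
    fun t ht hat => by
      refine hlevel σ _ t (measure_lt_supBall_localAverage_le hn hR σ _ ?_)
      intro x c ρ hρ hxc hxq hst
      rw [hσ, hclosed]
      exact hst.lintegral_le hR hxq (hQ t hat) hρ hxc
  rw [hκ, e m hmm] at hI
  rw [hσ, e s hs] at hJ
  set I := ∫⁻ x in ball q R, h x ^ δ * m x with hIdef
  have hV : ∫⁻ x, h x ^ (1 + δ) ≤ I := by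
    rw [hIdef, ← lintegral_indicator measurableSet_ball]
    refine lintegral_mono fun x => ?_
    by_cases hx : x ∈ ball q R
    · rw [indicator_of_mem hx, add_comm, ENNReal.rpow_add_of_nonneg _ _ hδ.le zero_le_one,
        ENNReal.rpow_one]
      gcongr
      exact min_le_left _ _
    · have : h x = 0 := by simp [hh, hzero x hx]
      simp only [this]
      rw [ENNReal.zero_rpow_of_pos (by linarith)]
      exact zero_le
  have hIfin : I ≠ ∞ := by
    have : I ≤ (N : ℝ≥0∞) ^ δ * (ENNReal.ofReal A * S) := by
      calc I ≤ ∫⁻ x in ball q R, (N : ℝ≥0∞) ^ δ * m x := by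
            refine lintegral_mono fun x => ?_
            gcongr
            exact min_le_right _ _
        _ = (N : ℝ≥0∞) ^ δ * ∫⁻ x in ball q R, m x := lintegral_const_mul _ hmm
        _ ≤ _ := by gcongr; exact hA q R hR
    exact ne_top_of_le_ne_top (ENNReal.mul_ne_top
      (ENNReal.rpow_ne_top_of_nonneg hδ.le (by simp))
      (ENNReal.mul_ne_top ENNReal.ofReal_ne_top hSt)) this
  set G := ENNReal.ofReal a ^ δ with hG
  have hGt : G ≠ ∞ := ENNReal.rpow_ne_top_of_nonneg hδ.le ENNReal.ofReal_ne_top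
  -- absorption, carried out in the real numbers
  have h49 : (1 : ℝ) ≤ 49 ^ n := one_le_pow₀ (by norm_num)
  have h7 : (7 : ℝ) ^ n ≤ 49 ^ n := by gcongr; norm_num
  have hIr : I.toReal ≤ 2 * (G.toReal * (A * S.toReal)) := by
    have h1 := ENNReal.toReal_mono (ENNReal.add_ne_top.2 ⟨ENNReal.mul_ne_top hGt
      (ENNReal.mul_ne_top ENNReal.ofReal_ne_top hSt), ENNReal.mul_ne_top (ENNReal.mul_ne_top
      (ENNReal.mul_ne_top (by simp) (by simp)) ENNReal.ofReal_ne_top) hIfin⟩)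
      (hI.trans (by gcongr) : I ≤ G * (ENNReal.ofReal A * S) +
        49 ^ n * (1 + ENNReal.ofReal A) * ENNReal.ofReal δ * I)
    rw [ENNReal.toReal_add (ENNReal.mul_ne_top hGt
      (ENNReal.mul_ne_top ENNReal.ofReal_ne_top hSt)) (ENNReal.mul_ne_top (ENNReal.mul_ne_top
      (ENNReal.mul_ne_top (by simp) (by simp)) ENNReal.ofReal_ne_top) hIfin)] at h1
    simp only [ENNReal.toReal_mul, ENNReal.toReal_pow, ENNReal.toReal_ofNat,
      ENNReal.toReal_ofReal (by linarith : 0 ≤ A), ENNReal.toReal_ofReal hδ.le] at h1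
    rw [ENNReal.toReal_add (by simp) (by simp), ENNReal.toReal_one,
      ENNReal.toReal_ofReal (by linarith : 0 ≤ A)] at h1
    have h2 : (49 : ℝ) ^ n * (1 + A) * δ ≤ 1 / 2 := by
      have : (49 : ℝ) ^ n * (1 + A) * δ ≤ 49 ^ n * (2 * A) * δ := by gcongr; linarith
      linarith
    have h3 : (49 : ℝ) ^ n * (1 + A) * δ * I.toReal ≤ 1 / 2 * I.toReal := by
      gcongr
    linarith
  have hJfin : ∫⁻ x in ball q R, h x ^ δ * s x ≤ G * S + 7 ^ n * ENNReal.ofReal δ * I :=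
    hJ.trans (by gcongr)
  refine hJfin.trans ?_
  rw [two_mul, add_mul]
  refine add_le_add le_rfl ?_
  rw [← ENNReal.toReal_le_toReal (ENNReal.mul_ne_top (ENNReal.mul_ne_top (by simp) (by simp)) hIfin)
    (ENNReal.mul_ne_top hGt hSt)]
  simp only [ENNReal.toReal_mul, ENNReal.toReal_pow, ENNReal.toReal_ofNat,
    ENNReal.toReal_ofReal hδ.le]
  have hGS : 0 ≤ G.toReal * S.toReal := by positivity
  calc (7 : ℝ) ^ n * δ * I.toReal ≤ 49 ^ n * δ * (2 * (G.toReal * (A * S.toReal))) := by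
        gcongr
    _ = (2 * 49 ^ n * A * δ) * (G.toReal * S.toReal) := by ring
    _ ≤ 1 * (G.toReal * S.toReal) := by
        gcongr
        have : 0 ≤ (49 : ℝ) ^ n * A * δ := by positivity
        linarith
    _ = _ := one_mul _

/-- The sharp reverse Hölder inequality: the gain in integrability is inversely proportional to the
constant in the local Fujii--Wilson condition `hA`, while the constant `2` does not depend on it. -/
theorem lintegral_rpow_one_add_le (hn : 0 < n) {s : (Fin n → ℝ) → ℝ≥0∞}
    (hs : Measurable s) (hst : ∀ᵐ x, s x ≠ ∞)
    (hfin : ∀ (q : Fin n → ℝ) (R : ℝ), ∫⁻ y in ball q R, s y ≠ ∞) {A : ℝ}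
    (hA1 : 1 ≤ A) (hA : ∀ (q : Fin n → ℝ) (R : ℝ), 0 < R →
      ∫⁻ y in ball q R, supBall (localAverage q R s) y ≤ ENNReal.ofReal A * ∫⁻ y in ball q R, s y)
    {δ : ℝ} (hδ : 0 < δ) (hδA : 4 * 49 ^ n * A * δ ≤ 1) (q : Fin n → ℝ) {R : ℝ} (hR : 0 < R) :
    ∫⁻ x in ball q R, s x ^ (1 + δ) ≤
      2 * (⨍⁻ y in ball q R, s y ∂volume) ^ δ * ∫⁻ y in ball q R, s y := by
  set m := supBall (localAverage q R s) with hm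
  have hmm : Measurable m := measurable_supBall _
  have hlim : Filter.Tendsto (fun N : ℕ => ∫⁻ x in ball q R, min (m x) N ^ δ * s x) Filter.atTop
      (nhds (∫⁻ x in ball q R, m x ^ δ * s x)) := by
    refine lintegral_tendsto_of_tendsto_of_monotone (fun N => ?_) (ae_of_all _ fun x => ?_) ?_
    · exact (((hmm.min measurable_const).pow_const δ).mul hs).aemeasurable
    · intro N N' hNN
      have : (N : ℝ≥0∞) ≤ N' := by exact_mod_cast hNN
      dsimp only
      gcongr
    · refine ae_restrict_of_ae (hst.mono fun x hx => ?_)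
      refine ENNReal.Tendsto.mul_const ?_ (Or.inr hx)
      refine (ENNReal.continuous_rpow_const.tendsto _).comp ?_
      have : Filter.Tendsto (fun N : ℕ => min (m x) (N : ℝ≥0∞)) Filter.atTop
          (nhds (min (m x) ∞)) := tendsto_const_nhds.min ENNReal.tendsto_nat_nhds_top
      simpa using this
  calc ∫⁻ x in ball q R, s x ^ (1 + δ) ≤ ∫⁻ x in ball q R, m x ^ δ * s x := by
        refine lintegral_mono_ae ?_
        rw [ae_restrict_iff' measurableSet_ball]
        filter_upwards [ae_le_supBall_localAverage hs (hfin q R)] with x hx hxq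
        rw [add_comm, ENNReal.rpow_add_of_nonneg _ _ hδ.le zero_le_one, ENNReal.rpow_one]
        gcongr
        exact hx hxq
    _ ≤ _ := le_of_tendsto' hlim fun N =>
        lintegral_min_supBall_rpow_mul_le hn hs hfin hA1 hA hδ hδA q hR N

/-! ### Muckenhoupt weights -/

theorem one_sub_conjExponent {p : ℝ} (hp : 1 < p) : 1 - p.conjExponent = -1 / (p - 1) := by
  have : p - 1 ≠ 0 := by linarith
  rw [Real.conjExponent]; field_simp; ring

theorem dualWeight_eq {p : ℝ} (hp : 1 < p) (w : (Fin n → ℝ) → ℝ) (x : Fin n → ℝ) :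
    dualWeight p w x = ENNReal.ofReal (w x) ^ (-1 / (p - 1)) := by
  rw [dualWeight, one_sub_conjExponent hp]

theorem div_mul_div_rpow (X Y : ℝ≥0∞) {V : ℝ≥0∞} (hV0 : V ≠ 0) (hV : V ≠ ∞) {p : ℝ} (hp : 1 < p) :
    X / V * (Y / V) ^ (p - 1) = X * Y ^ (p - 1) / V ^ p := by
  have hp1 : 0 ≤ p - 1 := by linarith
  have e : V ^ p = V * V ^ (p - 1) := by
    conv_rhs => rw [← ENNReal.rpow_one V, ← ENNReal.rpow_mul, one_mul,
      ← ENNReal.rpow_add _ _ hV0 hV]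
    congr 1; ring
  rw [ENNReal.div_rpow_of_nonneg _ _ hp1, e, div_eq_mul_inv, div_eq_mul_inv, div_eq_mul_inv,
    ENNReal.mul_inv (Or.inl hV0) (Or.inl hV)]
  ring

theorem apConst_le_iff {p : ℝ} (hp : 1 < p) {w : (Fin n → ℝ) → ℝ} {A : ℝ≥0∞} :
    apConst p w ≤ A ↔ HasApBound p (fun x => ENNReal.ofReal (w x)) A := by
  have hp0 : 0 ≤ p := by linarith
  have key : ∀ (c : Fin n → ℝ) (ρ : ℝ), 0 < ρ →
      ((⨍⁻ y in closedBall c ρ, ENNReal.ofReal (w y) ∂volume) *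
        (⨍⁻ y in closedBall c ρ, ENNReal.ofReal (w y) ^ (-1 / (p - 1)) ∂volume) ^ (p - 1) ≤ A ↔
      (∫⁻ y in closedBall c ρ, ENNReal.ofReal (w y)) *
        (∫⁻ y in closedBall c ρ, ENNReal.ofReal (w y) ^ (-1 / (p - 1))) ^ (p - 1) ≤
      A * volume (closedBall c ρ) ^ p) := by
    intro c ρ hρ
    have hV0 := volume_closedBall_ne_zero c hρ
    have hV := volume_closedBall_ne_top c ρ
    rw [setLAverage_eq, setLAverage_eq, div_mul_div_rpow _ _ hV0 hV hp, ENNReal.div_le_iff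
      (by simp [ENNReal.rpow_eq_zero_iff, hV0, hV]) (ENNReal.rpow_ne_top_of_nonneg hp0 hV)]
  unfold apConst HasApBound
  simp only [iSup_le_iff, one_sub_conjExponent hp]
  constructor
  · intro h c ρ hρ
    rw [← key c ρ hρ, closedBall_eq_cube c hρ.le]
    exact h _ _ (by positivity)
  · intro h a r hr
    rw [cube_eq_closedBall a hr.le, key _ _ (by positivity)]
    exact h _ _ (by positivity)

theorem hasApBound_apConst {p : ℝ} (hp : 1 < p) (w : (Fin n → ℝ) → ℝ) :
    HasApBound p (fun x => ENNReal.ofReal (w x)) (apConst p w) :=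
  (apConst_le_iff hp).1 le_rfl

theorem ae_iff_forall_restrict_closedBall {P : (Fin n → ℝ) → Prop} (k₀ : ℕ) :
    (∀ᵐ x, P x) ↔ ∀ k : ℕ, k₀ ≤ k → ∀ᵐ x ∂(volume.restrict (closedBall 0 (k : ℝ))), P x := by
  refine ⟨fun h k _ => ae_restrict_of_ae h, fun h => ?_⟩
  rw [← Measure.restrict_univ (μ := volume), ← iUnion_closedBall_nat (0 : Fin n → ℝ),
    ae_restrict_iUnion_iff]
  intro k
  refine ae_restrict_of_ae_restrict_of_subset (closedBall_subset_closedBall ?_)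
    (h (max k₀ k) (le_max_left _ _))
  exact_mod_cast le_max_right k₀ k

theorem exists_closedBall_subset_nat (c : Fin n → ℝ) (ρ : ℝ) (k₀ : ℕ) :
    ∃ k : ℕ, k₀ ≤ k ∧ 0 < k ∧ closedBall c ρ ⊆ closedBall 0 (k : ℝ) := by
  obtain ⟨k, hk⟩ := exists_nat_ge (ρ + dist c 0)
  refine ⟨max (max k₀ k) 1, le_max_of_le_left (le_max_left _ _), by simp,
    closedBall_subset_closedBall' (hk.trans ?_)⟩
  exact_mod_cast le_max_of_le_left (le_max_right _ _)

namespace IsApWeight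

variable {p : ℝ} {w : (Fin n → ℝ) → ℝ}

theorem exists_lintegral_ne_zero (hw : IsApWeight p w) (hm : Measurable w) :
    ∃ k₀ : ℕ, ∀ k : ℕ, k₀ ≤ k →
      ∫⁻ y in closedBall (0 : Fin n → ℝ) (k : ℝ), ENNReal.ofReal (w y) ≠ 0 := by
  by_contra! hcon
  refine hw.not_ae_zero ((ae_iff_forall_restrict_closedBall 0).2 fun k _ => ?_)
  obtain ⟨l, hkl, hl⟩ := hcon k
  rw [lintegral_eq_zero_iff hm.ennreal_ofReal] at hl
  refine ae_restrict_of_ae_restrict_of_subset (closedBall_subset_closedBall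
    (by exact_mod_cast hkl)) (hl.mono fun x hx => ?_)
  simp only [Pi.zero_apply, ENNReal.ofReal_eq_zero] at hx
  exact le_antisymm hx (hw.nonneg x)

theorem lintegral_dual_ne_top (hp : 1 < p) (hw : IsApWeight p w) (hm : Measurable w)
    (c : Fin n → ℝ) (ρ : ℝ) :
    ∫⁻ y in closedBall c ρ, ENNReal.ofReal (w y) ^ (-1 / (p - 1)) ≠ ∞ := by
  obtain ⟨k₀, hk₀⟩ := hw.exists_lintegral_ne_zero hm
  obtain ⟨k, hk, hkpos, hsub⟩ := exists_closedBall_subset_nat c ρ k₀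
  refine ne_top_of_le_ne_top ?_ (lintegral_mono_set hsub)
  intro htop
  have h := hasApBound_apConst hp w 0 (k : ℝ) (by exact_mod_cast hkpos)
  rw [htop, ENNReal.top_rpow_of_pos (by linarith), ENNReal.mul_top (hk₀ k hk), top_le_iff] at h
  exact ENNReal.mul_ne_top hw.apConst_lt_top.ne
    (ENNReal.rpow_ne_top_of_nonneg (by linarith) (volume_closedBall_ne_top _ _)) h

theorem ae_dual_ne_top (hp : 1 < p) (hw : IsApWeight p w) (hm : Measurable w) :
    ∀ᵐ x, ENNReal.ofReal (w x) ^ (-1 / (p - 1)) ≠ ∞ := by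
  refine (ae_iff_forall_restrict_closedBall 0).2 fun k _ => ?_
  exact (ae_lt_top (hm.ennreal_ofReal.pow_const _)
    (hw.lintegral_dual_ne_top hp hm 0 k)).mono fun x hx => hx.ne

theorem ae_ne_zero (hp : 1 < p) (hw : IsApWeight p w) (hm : Measurable w) :
    ∀ᵐ x, ENNReal.ofReal (w x) ≠ 0 := by
  refine (hw.ae_dual_ne_top hp hm).mono fun x hx h0 => hx ?_
  rw [h0, ENNReal.zero_rpow_of_neg (div_neg_of_neg_of_pos (by norm_num) (by linarith))]

theorem lintegral_dual_ne_zero (hp : 1 < p) (hm : Measurable w) (c : Fin n → ℝ) {ρ : ℝ}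
    (hρ : 0 < ρ) : ∫⁻ y in closedBall c ρ, ENNReal.ofReal (w y) ^ (-1 / (p - 1)) ≠ 0 := by
  have hneg : -1 / (p - 1) < 0 := div_neg_of_neg_of_pos (by norm_num) (by linarith)
  refine (setLIntegral_pos_iff (hm.ennreal_ofReal.pow_const _) |>.2 ?_).ne'
  have : (Function.support fun y => ENNReal.ofReal (w y) ^ (-1 / (p - 1))) = univ := by
    refine eq_univ_of_forall fun y => ?_
    simp [Function.mem_support, ENNReal.rpow_eq_zero_iff, hneg.le]
  rw [this, univ_inter]
  exact measure_closedBall_pos volume c hρ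

theorem lintegral_ne_top (hw : IsApWeight p w) (c : Fin n → ℝ) (ρ : ℝ) :
    ∫⁻ y in closedBall c ρ, ENNReal.ofReal (w y) ≠ ∞ := by
  have h := (hw.locallyIntegrable.integrableOn_isCompact (isCompact_closedBall c ρ)).2
  refine (lt_of_le_of_lt (lintegral_mono fun y => ?_) h).ne
  exact Real.ofReal_le_enorm (w y)

theorem lintegral_ne_zero (hp : 1 < p) (hw : IsApWeight p w) (hm : Measurable w) (c : Fin n → ℝ)
    {ρ : ℝ} (hρ : 0 < ρ) : ∫⁻ y in closedBall c ρ, ENNReal.ofReal (w y) ≠ 0 := by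
  rw [Ne, lintegral_eq_zero_iff hm.ennreal_ofReal]
  intro h
  have h2 := ae_restrict_of_ae (s := closedBall c ρ) (hw.ae_ne_zero hp hm)
  have : (volume.restrict (closedBall c ρ)) univ = 0 := by
    rw [← ae_eq_empty.1 (Filter.eventuallyEq_set.2 (h.mp (h2.mono fun x hx hx' => ?_)))]
    exact absurd hx' hx
  rw [Measure.restrict_apply_univ] at this
  exact volume_closedBall_ne_zero c hρ this

end IsApWeight

/-! ### The Fujii--Wilson constant -/

/-- The part of the `A_∞` condition that the reverse Hölder inequality uses. -/
theorem lintegral_supBall_localAverage_le (s : (Fin n → ℝ) → ℝ≥0∞) {q : Fin n → ℝ} {R : ℝ}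
    (hR : 0 < R) (h0 : ∫⁻ y in closedBall q R, s y ≠ 0) (ht : ∫⁻ y in closedBall q R, s y ≠ ∞) :
    ∫⁻ y in ball q R, supBall (localAverage q R s) y ≤ aInftyConst s * ∫⁻ y in ball q R, s y := by
  rw [← setLIntegral_closedBall_eq q hR s]
  have hle : (∫⁻ y in closedBall q R, s y)⁻¹ *
      ∫⁻ y in closedBall q R, maximalFunction ((closedBall q R).indicator s) y ≤
      aInftyConst s := by
    rw [closedBall_eq_cube q hR.le]
    exact le_iSup₂_of_le (fun i => q i - R) (2 * R)
      (le_iSup_of_le (by positivity : 0 < 2 * R) le_rfl)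
  have hpt : ∀ x, supBall (localAverage q R s) x ≤
      maximalFunction ((closedBall q R).indicator s) x := by
    intro x
    rw [supBall_le_iff]
    intro c ρ hρ hx
    by_cases hval : ball c ρ ⊆ closedBall q R
    swap
    · simp [localAverage, hval]
    have e : localAverage q R s c ρ =
        ⨍⁻ y in closedBall c ρ, (closedBall q R).indicator s y ∂volume := by
      rw [localAverage_eq hval, ← setLAverage_congr (ball_ae_eq_closedBall c hρ), setLAverage_eq,
        setLAverage_eq]
      congr 1
      exact setLIntegral_congr_fun measurableSet_ball fun y hy =>
        (indicator_of_mem (hval hy) s).symm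
    rw [e]
    have hx' := ball_subset_closedBall hx
    rw [closedBall_eq_cube c hρ.le] at hx' ⊢
    exact le_iSup₂_of_le (fun i => c i - ρ) (2 * ρ)
      (le_iSup₂_of_le (by positivity : 0 < 2 * ρ) hx' le_rfl)
  calc ∫⁻ y in ball q R, supBall (localAverage q R s) y
      ≤ ∫⁻ y in closedBall q R, maximalFunction ((closedBall q R).indicator s) y :=
        (lintegral_mono hpt).trans (lintegral_mono_set ball_subset_closedBall)
    _ = ((∫⁻ y in closedBall q R, s y)⁻¹ *
          ∫⁻ y in closedBall q R, maximalFunction ((closedBall q R).indicator s) y) *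
          ∫⁻ y in closedBall q R, s y := by
        rw [mul_right_comm, ENNReal.inv_mul_cancel h0 ht, one_mul]
    _ ≤ _ := by gcongr

theorem one_le_aInftyConst (s : (Fin n → ℝ) → ℝ≥0∞) {q : Fin n → ℝ} {R : ℝ}
    (hR : 0 < R) (h0 : ∫⁻ y in closedBall q R, s y ≠ 0) (ht : ∫⁻ y in closedBall q R, s y ≠ ∞) :
    1 ≤ aInftyConst s := by
  have h := lintegral_supBall_localAverage_le s hR h0 ht
  rw [setLIntegral_closedBall_eq q hR] at h0 ht
  have h2 : ∫⁻ y in ball q R, s y ≤ ∫⁻ y in ball q R, supBall (localAverage q R s) y := by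
    calc ∫⁻ y in ball q R, s y = ∫⁻ _ in ball q R, ⨍⁻ y in ball q R, s y ∂volume := by
          rw [setLIntegral_const, setLAverage_eq, ENNReal.div_mul_cancel (volume_ball_ne_zero q hR)
            (volume_ball_ne_top q R)]
      _ ≤ _ := setLIntegral_mono' measurableSet_ball fun x hx => by
          rw [← localAverage_eq ball_subset_closedBall]
          exact le_supBall (localAverage q R s) hR hx
  have h3 := h2.trans h
  rw [← ENNReal.mul_le_mul_iff_left h0 ht, one_mul]
  exact h3

/-! ### The `A_∞` constant of the dual weight is controlled by the `A_p` constant -/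

/-- The average of `g` with respect to `μ` over a ball, divided by the measure of the enlarged ball.
With this normalization no doubling property of `μ` is needed. -/
noncomputable def enlargedAverage (μ : Measure (Fin n → ℝ)) (g : (Fin n → ℝ) → ℝ≥0∞)
    (c : Fin n → ℝ) (ρ : ℝ) : ℝ≥0∞ :=
  (∫⁻ y in ball c ρ, g y ∂μ) / μ (closedBall c (5 * ρ))

theorem measure_lt_supBall_enlargedAverage_le (μ : Measure (Fin n → ℝ)) [SFinite μ]
    (g : (Fin n → ℝ) → ℝ≥0∞) {t : ℝ} (ht : 0 < t) :
    μ {x | ENNReal.ofReal t < supBall (enlargedAverage μ g) x} ≤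
      ENNReal.ofReal (t ^ (-1 : ℝ)) * ∫⁻ y, g y ∂μ := by
  refine (measure_lt_supBall_le μ (μ.withDensity g) (ENNReal.ofReal (t ^ (-1 : ℝ))) _ _
    fun c ρ hρ hlt => ?_).trans ?_
  · rw [withDensity_apply _ measurableSet_ball]
    have h1 : ENNReal.ofReal t * μ (closedBall c (5 * ρ)) ≤ ∫⁻ y in ball c ρ, g y ∂μ :=
      ENNReal.mul_le_of_le_div hlt.le
    calc μ (closedBall c (5 * ρ))
        = ENNReal.ofReal (t ^ (-1 : ℝ)) * (ENNReal.ofReal t * μ (closedBall c (5 * ρ))) := by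
          rw [← mul_assoc, ← ENNReal.ofReal_mul (by positivity), Real.rpow_neg_one,
            inv_mul_cancel₀ ht.ne', ENNReal.ofReal_one, one_mul]
      _ ≤ _ := by gcongr
  · gcongr
    refine (measure_mono (subset_univ _)).trans (le_of_eq ?_)
    rw [withDensity_apply _ MeasurableSet.univ, Measure.restrict_univ]

theorem lintegral_supBall_enlargedAverage_rpow_le (μ : Measure (Fin n → ℝ)) [SFinite μ]
    {g : (Fin n → ℝ) → ℝ≥0∞} (hg : Measurable g) {s : ℝ} (hs : 1 < s) :
    ∫⁻ x, supBall (enlargedAverage μ g) x ^ s ∂μ ≤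
      ENNReal.ofReal (2 ^ s * s / (s - 1)) * ∫⁻ x, g x ^ s ∂μ := by
  rw [← mul_one (ENNReal.ofReal _)]
  refine lintegral_rpow_le_of_weak_type μ hg (measurable_supBall _) one_pos hs 1 fun t ht => ?_
  have hms : MeasurableSet {x | ENNReal.ofReal t < g x} := measurableSet_lt measurable_const hg
  have := measure_lt_supBall_enlargedAverage_le μ ({x | ENNReal.ofReal t < g x}.indicator g) ht
  rw [lintegral_indicator hms] at this
  simp only [one_mul, ENNReal.rpow_one]
  refine (measure_mono fun x hx => ?_).trans this
  simp only [mem_ofPred_eq, lt_supBall_iff] at hx ⊢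
  obtain ⟨c, ρ, hρ, hxb, hlt⟩ := hx
  refine ⟨c, ρ, hρ, hxb, ?_⟩
  by_contra hcon
  refine absurd hlt (not_lt.2 ?_)
  calc enlargedAverage μ g c ρ
      ≤ (∫⁻ y in ball c ρ, ({x | ENNReal.ofReal t < g x}.indicator g y + ENNReal.ofReal t) ∂μ) /
          μ (closedBall c (5 * ρ)) := by
        unfold enlargedAverage
        gcongr with y
        exact le_indicator_add g _ y
    _ = enlargedAverage μ ({x | ENNReal.ofReal t < g x}.indicator g) c ρ +
          ENNReal.ofReal t * μ (ball c ρ) / μ (closedBall c (5 * ρ)) := by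
        rw [lintegral_add_right _ measurable_const, ENNReal.add_div, setLIntegral_const]
        rfl
    _ ≤ ENNReal.ofReal t + ENNReal.ofReal t := by
        refine add_le_add (not_lt.1 hcon) (ENNReal.div_le_of_le_mul ?_)
        gcongr
        exact ball_subset_closedBall.trans (closedBall_subset_closedBall (by linarith))
    _ = ENNReal.ofReal (2 * t) := by
        rw [← ENNReal.ofReal_add ht.le ht.le]; congr 1; ring

/-- In the maximal function of `χ_Q s` at a point of the cube `Q`, only the cubes inside `Q`
matter. -/
theorem exists_subset_setLAverage_indicator_le (s : (Fin n → ℝ) → ℝ≥0∞) {q c x : Fin n → ℝ}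
    {R ρ : ℝ} (hR : 0 < R) (hρ : 0 < ρ) (hxq : x ∈ closedBall q R) (hxc : x ∈ closedBall c ρ) :
    ∃ c' ρ', 0 < ρ' ∧ x ∈ closedBall c' ρ' ∧ closedBall c' ρ' ⊆ closedBall q R ∧
      ⨍⁻ y in closedBall c ρ, (closedBall q R).indicator s y ∂volume ≤
        ⨍⁻ y in closedBall c' ρ', s y ∂volume := by
  have e : ∫⁻ y in closedBall c ρ, (closedBall q R).indicator s y =
      ∫⁻ y in closedBall c ρ ∩ closedBall q R, s y := by
    rw [setLIntegral_indicator measurableSet_closedBall, inter_comm]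
  rcases le_total R ρ with h | h
  · refine ⟨q, R, hR, hxq, subset_rfl, ?_⟩
    rw [setLAverage_eq, setLAverage_eq, e, volume_closedBall_eq c hρ, volume_closedBall_eq q hR]
    gcongr
    exact inter_subset_right
  · obtain ⟨c', h1, h2⟩ := exists_closedBall_inter_subset c q hρ h
    refine ⟨c', ρ, hρ, h1 ⟨hxc, hxq⟩, h2, ?_⟩
    rw [setLAverage_eq, setLAverage_eq, e, volume_closedBall_eq c hρ, volume_closedBall_eq c' hρ]
    gcongr

/-- The `A_p` condition on the enlargement of a cube `P` bounds the average of the dual weight over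
`P` by a power of `|P| / w(P*)`, which is an average of `1 / w` with respect to `w`. -/
theorem setLAverage_dual_le {p : ℝ} (hp : 1 < p) {W : (Fin n → ℝ) → ℝ≥0∞} (hW : Measurable W)
    (h0 : ∀ᵐ x, W x ≠ 0) (ht : ∀ x, W x ≠ ∞) {A : ℝ≥0∞} (hA : HasApBound p W A)
    {q c x : Fin n → ℝ} {R ρ : ℝ} (hρ : 0 < ρ) (hx : x ∈ closedBall c ρ)
    (hsub : closedBall c ρ ⊆ closedBall q R)
    (hD0 : ∫⁻ y in closedBall c (5 * (2 * ρ)), W y ≠ 0)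
    (hDt : ∫⁻ y in closedBall c (5 * (2 * ρ)), W y ≠ ∞) :
    ⨍⁻ y in closedBall c ρ, W y ^ (-1 / (p - 1)) ∂volume ≤
      (((10 : ℝ≥0∞) ^ n) ^ p * A * supBall (enlargedAverage (volume.withDensity W)
        ((closedBall q R).indicator fun y => (W y)⁻¹)) x) ^ (1 / (p - 1)) := by
  have hp1 : 0 < p - 1 := by linarith
  set μ := volume.withDensity W with hμ
  set g : (Fin n → ℝ) → ℝ≥0∞ := (closedBall q R).indicator fun y => (W y)⁻¹ with hg
  have hgm : Measurable g := hW.inv.indicator measurableSet_closedBall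
  set V := volume (closedBall c ρ) with hV
  have hV0 : V ≠ 0 := volume_closedBall_ne_zero c hρ
  have hVt : V ≠ ∞ := volume_closedBall_ne_top c ρ
  set D := closedBall c (5 * (2 * ρ)) with hD
  have hVD : volume D = 10 ^ n * V := by
    have := volume_closedBall_nat_mul c c (k := 10) (by norm_num) hρ
    rw [measure_congr (ball_ae_eq_closedBall c hρ)] at this
    rw [hD, show 5 * (2 * ρ) = ((10 : ℕ) : ℝ) * ρ by push_cast; ring, this,
      Nat.cast_ofNat]
  have hPD : closedBall c ρ ⊆ D := closedBall_subset_closedBall (by linarith)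
  have h1 : V / ∫⁻ y in D, W y ≤ supBall (enlargedAverage μ g) x := by
    refine le_trans ?_ (le_supBall (enlargedAverage μ g) (by positivity : 0 < 2 * ρ)
      (closedBall_subset_ball (by linarith) hx))
    rw [enlargedAverage, hμ, withDensity_closedBall]
    gcongr
    rw [restrict_withDensity measurableSet_ball, lintegral_withDensity_eq_lintegral_mul _ hW hgm]
    calc V = ∫⁻ y in closedBall c ρ, 1 := by rw [setLIntegral_const, one_mul]
      _ ≤ ∫⁻ y in closedBall c ρ, (W * g) y := by
          refine lintegral_mono_ae ?_
          rw [ae_restrict_iff' measurableSet_closedBall]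
          filter_upwards [h0] with y hy hyc
          rw [Pi.mul_apply, hg, indicator_of_mem (hsub hyc), ENNReal.mul_inv_cancel hy (ht y)]
      _ ≤ _ := lintegral_mono_set (closedBall_subset_ball (by linarith))
  have h2 : (∫⁻ y in D, W y ^ (-1 / (p - 1))) ^ (p - 1) ≤
      A * (10 ^ n * V) ^ p / ∫⁻ y in D, W y := by
    rw [ENNReal.le_div_iff_mul_le (Or.inl hD0) (Or.inl hDt), mul_comm, ← hVD]
    exact hA c _ (by positivity)
  rw [← ENNReal.rpow_inv_le_iff (by positivity)]
  have h3 : ((1 : ℝ) / (p - 1))⁻¹ = p - 1 := by rw [one_div, inv_inv]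
  rw [h3, setLAverage_eq, ENNReal.div_rpow_of_nonneg _ _ hp1.le]
  have hVp0 : V ^ (p - 1) ≠ 0 := by simp [ENNReal.rpow_eq_zero_iff, hV0, hVt]
  have hVpt : V ^ (p - 1) ≠ ∞ := ENNReal.rpow_ne_top_of_nonneg hp1.le hVt
  rw [ENNReal.div_le_iff hVp0 hVpt]
  have e : V ^ p = V * V ^ (p - 1) := by
    conv_rhs => rw [← ENNReal.rpow_one V, ← ENNReal.rpow_mul, one_mul,
      ← ENNReal.rpow_add _ _ hV0 hVt]
    congr 1; ring
  calc (∫⁻ y in closedBall c ρ, W y ^ (-1 / (p - 1))) ^ (p - 1)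
      ≤ (∫⁻ y in D, W y ^ (-1 / (p - 1))) ^ (p - 1) := by gcongr
    _ ≤ _ := h2
    _ = (10 ^ n) ^ p * A * (V / ∫⁻ y in D, W y) * V ^ (p - 1) := by
        rw [ENNReal.mul_rpow_of_nonneg _ _ (by linarith), e, div_eq_mul_inv, div_eq_mul_inv]
        ring
    _ ≤ _ := by gcongr

theorem aInftyConst_dual_le {p : ℝ} (hp : 1 < p) {w : (Fin n → ℝ) → ℝ} (hw : IsApWeight p w)
    (hm : Measurable w) :
    aInftyConst (dualWeight p w) ≤
      ((10 : ℝ≥0∞) ^ n) ^ (p / (p - 1)) * ENNReal.ofReal (2 ^ (p / (p - 1)) * p) ^ (1 / p) *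
        apConst p w ^ (1 / (p - 1)) := by
  have hp0 : 0 < p := by linarith
  have hp1 : 0 < p - 1 := by linarith
  set A := apConst p w with hAdef
  set W : (Fin n → ℝ) → ℝ≥0∞ := fun x => ENNReal.ofReal (w x) with hWdef
  have hW : Measurable W := hm.ennreal_ofReal
  have ht : ∀ x, W x ≠ ∞ := fun x => ENNReal.ofReal_ne_top
  have h0 : ∀ᵐ x, W x ≠ 0 := hw.ae_ne_zero hp hm
  have hA : HasApBound p W A := hasApBound_apConst hp w
  have hσ : dualWeight p w = fun x => W x ^ (-1 / (p - 1)) := funext fun x => dualWeight_eq hp w x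
  rw [hσ]
  refine iSup_le fun a => iSup₂_le fun r hr => ?_
  rw [cube_eq_closedBall a hr.le, mul_comm, ← div_eq_mul_inv]
  refine ENNReal.div_le_of_le_mul ?_
  have hR : 0 < r / 2 := by positivity
  generalize (fun i => a i + r / 2) = q
  generalize r / 2 = R at hR
  set σ : (Fin n → ℝ) → ℝ≥0∞ := fun x => W x ^ (-1 / (p - 1)) with hσdef
  set μ := volume.withDensity W with hμ
  set g : (Fin n → ℝ) → ℝ≥0∞ := (closedBall q R).indicator fun y => (W y)⁻¹ with hg
  have hgm : Measurable g := hW.inv.indicator measurableSet_closedBall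
  set T := supBall (enlargedAverage μ g) with hT
  have hTm : Measurable T := measurable_supBall _
  set S := ∫⁻ x in closedBall q R, σ x with hS
  set K := ((10 : ℝ≥0∞) ^ n) ^ p * A with hK
  have hKt : K ≠ ∞ := ENNReal.mul_ne_top (ENNReal.rpow_ne_top_of_nonneg hp0.le (by simp))
    hw.apConst_lt_top.ne
  have hpt : ∀ x ∈ closedBall q R, maximalFunction ((closedBall q R).indicator σ) x ≤
      (K * T x) ^ (1 / (p - 1)) := by
    intro x hx
    refine iSup₂_le fun b l => iSup₂_le fun hl hxl => ?_
    rw [cube_eq_closedBall b hl.le] at hxl ⊢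
    obtain ⟨c, ρ, hρ, hxc, hsub, hle⟩ :=
      exists_subset_setLAverage_indicator_le σ hR (by positivity : 0 < l / 2) hx hxl
    exact hle.trans (setLAverage_dual_le hp hW h0 ht hA hρ hxc hsub
      (hw.lintegral_ne_zero hp hm c (by positivity)) (hw.lintegral_ne_top c _))
  have hstrong : ∫⁻ x in closedBall q R, T x ^ (p / (p - 1)) * W x ≤
      ENNReal.ofReal (2 ^ (p / (p - 1)) * p) * S := by
    have h1 := lintegral_supBall_enlargedAverage_rpow_le μ hgm
      (by rw [lt_div_iff₀ hp1]; linarith : 1 < p / (p - 1))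
    have e1 : (2 : ℝ) ^ (p / (p - 1)) * (p / (p - 1)) / (p / (p - 1) - 1) =
        2 ^ (p / (p - 1)) * p := by
      have : p / (p - 1) - 1 = 1 / (p - 1) := by field_simp; ring
      rw [this]; field_simp
    have e2 : ∫⁻ x, g x ^ (p / (p - 1)) ∂μ ≤ S := by
      rw [hμ, lintegral_withDensity_eq_lintegral_mul _ hW (hgm.pow_const _), hS,
        ← lintegral_indicator measurableSet_closedBall]
      refine lintegral_mono_ae (h0.mono fun x hx => ?_)
      rw [Pi.mul_apply]
      by_cases hxq : x ∈ closedBall q R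
      · rw [hg, indicator_of_mem hxq, indicator_of_mem hxq, ← ENNReal.rpow_neg_one,
          ← ENNReal.rpow_mul, hσdef]
        nth_rw 1 [← ENNReal.rpow_one (W x)]
        rw [← ENNReal.rpow_add _ _ hx (ht x)]
        refine le_of_eq ?_
        congr 1
        field_simp; ring
      · rw [hg, indicator_of_notMem hxq, indicator_of_notMem hxq,
          ENNReal.zero_rpow_of_pos (by positivity), mul_zero]
    have e3 : ∫⁻ x, T x ^ (p / (p - 1)) ∂μ = ∫⁻ x, T x ^ (p / (p - 1)) * W x := by
      rw [hμ, lintegral_withDensity_eq_lintegral_mul _ hW (hTm.pow_const _)]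
      exact lintegral_congr fun x => mul_comm _ _
    rw [e1, ← hT, e3] at h1
    exact (setLIntegral_le_lintegral _ _).trans (h1.trans (by gcongr))
  have hhold := lintegral_rpow_le_mul_dual (volume.restrict (closedBall q R))
    (hTm.pow_const (1 / (p - 1))) hW (ae_restrict_of_ae h0) ht hp
  have e4 : ∀ x, (T x ^ (1 / (p - 1))) ^ p = T x ^ (p / (p - 1)) := fun x => by
    rw [← ENNReal.rpow_mul]; congr 1; field_simp
  simp_rw [e4] at hhold
  have hhold2 : ∫⁻ x in closedBall q R, T x ^ (1 / (p - 1)) ≤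
      ENNReal.ofReal (2 ^ (p / (p - 1)) * p) ^ (1 / p) * S := by
    rw [← ENNReal.rpow_le_rpow_iff hp0]
    refine hhold.trans ?_
    rw [ENNReal.mul_rpow_of_nonneg _ _ hp0.le, ← ENNReal.rpow_mul, one_div_mul_cancel hp0.ne',
      ENNReal.rpow_one]
    calc _ ≤ ENNReal.ofReal (2 ^ (p / (p - 1)) * p) * S * S ^ (p - 1) := by gcongr
      _ = _ := by
        rw [mul_assoc]
        congr 1
        nth_rw 1 [← ENNReal.rpow_one S]
        rw [← ENNReal.rpow_add_of_nonneg _ _ zero_le_one hp1.le]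
        congr 1; ring
  calc ∫⁻ x in closedBall q R, maximalFunction ((closedBall q R).indicator σ) x
      ≤ ∫⁻ x in closedBall q R, (K * T x) ^ (1 / (p - 1)) :=
        setLIntegral_mono' measurableSet_closedBall hpt
    _ = K ^ (1 / (p - 1)) * ∫⁻ x in closedBall q R, T x ^ (1 / (p - 1)) := by
        rw [← lintegral_const_mul _ (hTm.pow_const _)]
        exact lintegral_congr fun x => ENNReal.mul_rpow_of_nonneg _ _ (by positivity)
    _ ≤ K ^ (1 / (p - 1)) * (ENNReal.ofReal (2 ^ (p / (p - 1)) * p) ^ (1 / p) * S) := by gcongr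
    _ = _ := by
        rw [hK, ENNReal.mul_rpow_of_nonneg _ _ (by positivity), ← ENNReal.rpow_mul,
          mul_one_div]
        ring

/-! ### Independence of the representative of the weight -/

theorem apConst_congr_ae (p : ℝ) {w w' : (Fin n → ℝ) → ℝ} (h : w =ᵐ[volume] w') :
    apConst p w = apConst p w' := by
  have e : ∀ (φ : ℝ → ℝ≥0∞) (Q : Set (Fin n → ℝ)),
      ⨍⁻ y in Q, φ (w y) ∂volume = ⨍⁻ y in Q, φ (w' y) ∂volume := fun φ Q =>
    laverage_congr ((ae_restrict_of_ae h).mono fun x hx => congrArg φ hx)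
  unfold apConst
  simp_rw [e ENNReal.ofReal, e fun t => ENNReal.ofReal t ^ (1 - p.conjExponent)]

theorem maximalFunction_congr_ae {g g' : (Fin n → ℝ) → ℝ≥0∞} (h : g =ᵐ[volume] g') :
    maximalFunction g = maximalFunction g' := by
  ext x
  have e : ∀ Q : Set (Fin n → ℝ), ⨍⁻ y in Q, g y ∂volume = ⨍⁻ y in Q, g' y ∂volume := fun Q =>
    laverage_congr (ae_restrict_of_ae h)
  unfold maximalFunction
  simp_rw [e]

theorem aInftyConst_congr_ae {s s' : (Fin n → ℝ) → ℝ≥0∞} (h : s =ᵐ[volume] s') :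
    aInftyConst s = aInftyConst s' := by
  unfold aInftyConst
  congr! 6 with a r hr
  · rw [lintegral_congr_ae (ae_restrict_of_ae h)]
  · rw [maximalFunction_congr_ae (h.mono fun x hx => by simp only [indicator, hx] :
      (cube a r).indicator s =ᵐ[volume] (cube a r).indicator s')]

theorem opNorm_congr_ae (p : ℝ) {w w' : (Fin n → ℝ) → ℝ} (h : w =ᵐ[volume] w')
    (T : ((Fin n → ℝ) → ℝ) → (Fin n → ℝ) → ℝ≥0∞) : opNorm p w T = opNorm p w' T := by
  have : ∀ g, lpNorm p w g = lpNorm p w' g := by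
    intro g
    unfold lpNorm
    congr 1
    exact lintegral_congr_ae (h.mono fun x hx => by simp only [hx])
  unfold opNorm
  simp_rw [this]

theorem IsApWeight.congr_ae {p : ℝ} {w w' : (Fin n → ℝ) → ℝ} (hw : IsApWeight p w)
    (h : w =ᵐ[volume] w') (h0 : ∀ x, 0 ≤ w' x) : IsApWeight p w' where
  nonneg := h0
  locallyIntegrable := hw.locallyIntegrable.congr h
  not_ae_zero h' := hw.not_ae_zero (h.mp (h'.mono fun _ hx hx' => hx'.trans hx))
  apConst_lt_top := apConst_congr_ae p h ▸ hw.apConst_lt_top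

theorem IsApWeight.exists_measurable {p : ℝ} {w : (Fin n → ℝ) → ℝ} (hw : IsApWeight p w) :
    ∃ w', Measurable w' ∧ IsApWeight p w' ∧ w =ᵐ[volume] w' := by
  have ham := hw.locallyIntegrable.aestronglyMeasurable.aemeasurable
  have h : w =ᵐ[volume] fun x => |ham.mk w x| := ham.ae_eq_mk.mono fun x hx => by
    dsimp only
    rw [← hx, abs_of_nonneg (hw.nonneg x)]
  exact ⟨_, ham.measurable_mk.abs, hw.congr_ae h fun x => abs_nonneg _, h⟩

/-! ### The mixed `A_p`--`A_∞` bound -/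

theorem IsApWeight.one_le_aInftyConst_dual {p : ℝ} (hp : 1 < p) {w : (Fin n → ℝ) → ℝ}
    (hw : IsApWeight p w) (hm : Measurable w) : 1 ≤ aInftyConst (dualWeight p w) := by
  have hσ : dualWeight p w = fun x => ENNReal.ofReal (w x) ^ (-1 / (p - 1)) :=
    funext fun x => dualWeight_eq hp w x
  rw [hσ]
  exact one_le_aInftyConst _ (q := 0) one_pos (IsApWeight.lintegral_dual_ne_zero hp hm 0 one_pos)
    (hw.lintegral_dual_ne_top hp hm 0 1)

theorem IsApWeight.one_le_apConst {p : ℝ} (hp : 1 < p) {w : (Fin n → ℝ) → ℝ}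
    (hw : IsApWeight p w) (hm : Measurable w) : 1 ≤ apConst p w := by
  have h := lintegral_rpow_le_mul_dual (volume.restrict (closedBall (0 : Fin n → ℝ) 1))
    (measurable_const (a := (1 : ℝ≥0∞))) hm.ennreal_ofReal
    (ae_restrict_of_ae (hw.ae_ne_zero hp hm)) (fun x => ENNReal.ofReal_ne_top) hp
  simp only [ENNReal.one_rpow, one_mul, setLIntegral_const] at h
  have h2 := h.trans (hasApBound_apConst hp w 0 1 one_pos)
  have hV0 := volume_closedBall_ne_zero (0 : Fin n → ℝ) one_pos
  have hVt := volume_closedBall_ne_top (0 : Fin n → ℝ) 1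
  refine (ENNReal.mul_le_mul_iff_left ?_ (ENNReal.rpow_ne_top_of_nonneg (by linarith) hVt)).1
    (by rwa [one_mul])
  simp [ENNReal.rpow_eq_zero_iff]

theorem exists_aInftyConst_dual_le (n : ℕ) {p : ℝ} (hp : 1 < p) :
    ∃ c : ℝ≥0, ∀ w : (Fin n → ℝ) → ℝ, IsApWeight p w →
      aInftyConst (dualWeight p w) ≤ c * apConst p w ^ (1 / (p - 1)) := by
  refine ⟨(((10 : ℝ≥0∞) ^ n) ^ (p / (p - 1)) *
    ENNReal.ofReal (2 ^ (p / (p - 1)) * p) ^ (1 / p)).toNNReal, fun w hw => ?_⟩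
  have hp0 : 0 < p := by linarith
  have hp1 : 0 < p - 1 := by linarith
  rw [ENNReal.coe_toNNReal (ENNReal.mul_ne_top
    (ENNReal.rpow_ne_top_of_nonneg (by positivity) (by simp))
    (ENNReal.rpow_ne_top_of_nonneg (by positivity) ENNReal.ofReal_ne_top))]
  obtain ⟨w', hm, hw', hae⟩ := hw.exists_measurable
  have : dualWeight p w =ᵐ[volume] dualWeight p w' := hae.mono fun x hx => by
    simp only [dualWeight, hx]
  rw [apConst_congr_ae p hae, aInftyConst_congr_ae this]
  exact aInftyConst_dual_le hp hw' hm

/-- Self-improvement of the `A_p` condition: raising the dual weight to the power `1 + δ` amounts to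
lowering the exponent `p`. -/
theorem hasApBound_of_reverseHolder {p δ : ℝ} (hp : 1 < p) (hδ : 0 < δ)
    {W : (Fin n → ℝ) → ℝ≥0∞} {A : ℝ≥0∞} (hA : HasApBound p W A)
    (hRH : ∀ (q : Fin n → ℝ) (R : ℝ), 0 < R →
      ∫⁻ x in closedBall q R, (W x ^ (-1 / (p - 1))) ^ (1 + δ) ≤
        2 * (⨍⁻ y in closedBall q R, W y ^ (-1 / (p - 1)) ∂volume) ^ δ *
          ∫⁻ y in closedBall q R, W y ^ (-1 / (p - 1))) :
    HasApBound (1 + (p - 1) / (1 + δ)) W (2 ^ (p - 1) * A) := by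
  have hp1 : 0 < p - 1 := by linarith
  have hδ1 : 0 < 1 + δ := by linarith
  intro c ρ hρ
  have hV0 := volume_closedBall_ne_zero c hρ
  have hVt := volume_closedBall_ne_top c ρ
  set V := volume (closedBall c ρ) with hV
  set S := ∫⁻ y in closedBall c ρ, W y ^ (-1 / (p - 1)) with hS
  have h := hRH c ρ hρ
  have hA' := hA c ρ hρ
  rw [← hS] at h hA'
  rw [setLAverage_eq, ← hS, ← hV] at h
  have e1 : ∀ x, W x ^ (-1 / (1 + (p - 1) / (1 + δ) - 1)) = (W x ^ (-1 / (p - 1))) ^ (1 + δ) := by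
    intro x
    rw [← ENNReal.rpow_mul]
    congr 1
    rw [add_sub_cancel_left]
    field_simp
  simp_rw [e1]
  rw [add_sub_cancel_left]
  have hu : 0 ≤ (p - 1) / (1 + δ) := by positivity
  have hle : (p - 1) / (1 + δ) ≤ p - 1 := div_le_self hp1.le (by linarith)
  calc (∫⁻ y in closedBall c ρ, W y) *
        (∫⁻ x in closedBall c ρ, (W x ^ (-1 / (p - 1))) ^ (1 + δ)) ^ ((p - 1) / (1 + δ))
      ≤ (∫⁻ y in closedBall c ρ, W y) * (2 * (S / V) ^ δ * S) ^ ((p - 1) / (1 + δ)) := by gcongr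
    _ = (∫⁻ y in closedBall c ρ, W y) * (2 ^ ((p - 1) / (1 + δ)) *
          (S ^ (p - 1) / V ^ (δ * ((p - 1) / (1 + δ))))) := by
        congr 1
        have e2 : 2 * (S / V) ^ δ * S = 2 * S ^ (1 + δ) / V ^ δ := by
          rw [ENNReal.div_rpow_of_nonneg _ _ hδ.le,
            ENNReal.rpow_add_of_nonneg _ _ zero_le_one hδ.le, ENNReal.rpow_one, div_eq_mul_inv,
            div_eq_mul_inv]
          ring
        rw [e2, ENNReal.div_rpow_of_nonneg _ _ hu, ENNReal.mul_rpow_of_nonneg _ _ hu,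
          ← ENNReal.rpow_mul, ← ENNReal.rpow_mul, mul_div_cancel₀ _ hδ1.ne', mul_div_assoc]
    _ ≤ (∫⁻ y in closedBall c ρ, W y) * (2 ^ (p - 1) *
          (S ^ (p - 1) / V ^ (δ * ((p - 1) / (1 + δ))))) := by
        gcongr
        norm_num
    _ = 2 ^ (p - 1) * ((∫⁻ y in closedBall c ρ, W y) * S ^ (p - 1)) /
          V ^ (δ * ((p - 1) / (1 + δ))) := by
        simp only [div_eq_mul_inv]; ring
    _ ≤ 2 ^ (p - 1) * (A * V ^ p) / V ^ (δ * ((p - 1) / (1 + δ))) := by gcongr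
    _ = _ := by
        rw [← mul_assoc, mul_div_assoc, ← ENNReal.rpow_sub _ _ hV0 hVt]
        congr 2
        field_simp
        ring

/-- The exponents `r < q < p` of `opNorm_orliczMaximal_le` are taken with gaps comparable to the inverse
of the `A_∞` constant of the dual weight, as the reverse Hölder inequality permits. -/
theorem opNorm_orliczMaximal_le_mixed (hn : 0 < n) {lam : ℝ} (hlam : 0 < lam) {p : ℝ} (hp : 1 < p)
    {w : (Fin n → ℝ) → ℝ} (hw : IsApWeight p w) (hm : Measurable w) :
    opNorm p w (orliczMaximal (youngLog lam)) ≤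
      (ENNReal.ofReal (luxConst lam * (32 * 49 ^ n * p / (p - 1)) ^ lam) * 2 ^ n *
        (ENNReal.ofReal (2 ^ p * p * (32 * 49 ^ n) / (p - 1)) *
          (((5 : ℝ≥0∞) ^ n) ^ p * 2 ^ (p - 1))) ^ (1 / p)) *
      (apConst p w ^ (1 / p) * aInftyConst (dualWeight p w) ^ (1 / p + lam)) := by
  have hp0 : 0 < p := by linarith
  have hp1 : 0 < p - 1 := by linarith
  have hσ : dualWeight p w = fun x => ENNReal.ofReal (w x) ^ (-1 / (p - 1)) :=
    funext fun x => dualWeight_eq hp w x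
  have hFt : aInftyConst (dualWeight p w) ≠ ∞ := by
    obtain ⟨c, hc⟩ := exists_aInftyConst_dual_le n hp
    exact ne_top_of_le_ne_top (ENNReal.mul_ne_top ENNReal.coe_ne_top
      (ENNReal.rpow_ne_top_of_nonneg (by positivity) hw.apConst_lt_top.ne)) (hc w hw)
  have hF1 := hw.one_le_aInftyConst_dual hp hm
  set F := aInftyConst (dualWeight p w) with hF
  set a := F.toReal with ha
  have haF : ENNReal.ofReal a = F := ENNReal.ofReal_toReal hFt
  have ha1 : 1 ≤ a := by
    rw [ha, ← ENNReal.toReal_one]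
    exact ENNReal.toReal_mono hFt hF1
  have ha0 : 0 < a := by linarith
  have h49 : (1 : ℝ) ≤ 49 ^ n := one_le_pow₀ (by norm_num)
  set δ := 1 / (4 * 49 ^ n * a) with hδdef
  have hδ : 0 < δ := by positivity
  have hδ1 : δ ≤ 1 := by
    rw [hδdef, div_le_one (by positivity)]
    nlinarith
  have hsm : Measurable fun x => ENNReal.ofReal (w x) ^ (-1 / (p - 1)) :=
    hm.ennreal_ofReal.pow_const _
  -- the `A_p` condition improves to `A_r` with `p - r` comparable to `1 / a`
  have hAr := hasApBound_of_reverseHolder hp hδ (hasApBound_apConst hp w) fun q R hR => by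
    rw [setLAverage_congr (ball_ae_eq_closedBall q hR).symm, setLIntegral_closedBall_eq q hR,
      setLIntegral_closedBall_eq q hR]
    refine lintegral_rpow_one_add_le hn hsm (hw.ae_dual_ne_top hp hm) (fun q R => ?_) ha1
      (fun q R hR => ?_) hδ ?_ q hR
    · exact ne_top_of_le_ne_top (hw.lintegral_dual_ne_top hp hm q R)
        (lintegral_mono_set ball_subset_closedBall)
    · rw [haF, hF, hσ]
      exact lintegral_supBall_localAverage_le _ hR
        (IsApWeight.lintegral_dual_ne_zero hp hm q hR) (hw.lintegral_dual_ne_top hp hm q R)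
    · rw [hδdef, mul_one_div_cancel (by positivity)]
  set r := 1 + (p - 1) / (1 + δ) with hr
  have hr1 : 1 < r := by
    have : 0 < (p - 1) / (1 + δ) := by positivity
    linarith
  have hpr : (p - 1) * δ / 2 ≤ p - r := by
    have : p - r = (p - 1) * δ / (1 + δ) := by rw [hr]; field_simp; ring
    rw [this]
    gcongr
    linarith
  have hpδ : 0 < (p - 1) * δ := by positivity
  have hrp : r < p := by linarith
  set q := (p + r) / 2 with hq
  have hqp : q < p := by rw [hq]; linarith
  have hrq : r < q := by rw [hq]; linarith
  have hq0 : 0 < q := by linarith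
  have hqr : (p - 1) * δ / 4 ≤ q - r := by rw [hq]; linarith
  have hε : (p - 1) * δ / (4 * p) ≤ p / q - 1 := by
    have e : p / q - 1 = (p - q) / q := by field_simp
    rw [e, div_le_div_iff₀ (by positivity) hq0]
    have h1 : (p - 1) * δ / 4 ≤ p - q := by rw [hq]; linarith
    nlinarith
  have hmain := opNorm_orliczMaximal_le hlam hm (hw.ae_ne_zero hp hm) hr1 hrq hqp
    (by rw [hq]; linarith) hAr
  refine hmain.trans ?_
  have hL : ENNReal.ofReal (luxConst lam * (p / q - 1) ^ (-lam)) ≤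
      ENNReal.ofReal (luxConst lam * (32 * 49 ^ n * p / (p - 1)) ^ lam) * F ^ lam := by
    rw [← haF, ENNReal.ofReal_rpow_of_pos ha0, ← ENNReal.ofReal_mul
      (mul_nonneg (by linarith [one_le_luxConst lam]) (by positivity))]
    refine ENNReal.ofReal_le_ofReal ?_
    rw [mul_assoc]
    refine mul_le_mul_of_nonneg_left ?_ (by linarith [one_le_luxConst lam])
    have hε0 : 0 < (p - 1) * δ / (4 * p) := by positivity
    calc (p / q - 1) ^ (-lam) ≤ ((p - 1) * δ / (4 * p)) ^ (-lam) :=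
          Real.rpow_le_rpow_of_nonpos hε0 hε (by linarith)
      _ = (16 * 49 ^ n * p / (p - 1) * a) ^ lam := by
          rw [Real.rpow_neg hε0.le, ← Real.inv_rpow hε0.le]
          congr 1
          rw [hδdef]
          field_simp
          norm_num
      _ ≤ (32 * 49 ^ n * p / (p - 1) * a) ^ lam := by gcongr; norm_num
      _ = _ := Real.mul_rpow (by positivity) ha0.le
  have hC : ENNReal.ofReal (2 ^ q * q / (q - r)) ≤
      ENNReal.ofReal (2 ^ p * p * (32 * 49 ^ n) / (p - 1)) * F := by
    rw [← haF, ← ENNReal.ofReal_mul (by positivity)]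
    refine ENNReal.ofReal_le_ofReal ?_
    have h2q : (2 : ℝ) ^ q ≤ 2 ^ p := Real.rpow_le_rpow_of_exponent_le (by norm_num) hqp.le
    calc 2 ^ q * q / (q - r) ≤ 2 ^ p * p / ((p - 1) * δ / 4) := by gcongr
      _ = 2 ^ p * p * (16 * 49 ^ n) / (p - 1) * a := by
          rw [hδdef]; field_simp; norm_num
      _ ≤ _ := by gcongr; norm_num
  have h5 : ((5 : ℝ≥0∞) ^ n) ^ r ≤ ((5 : ℝ≥0∞) ^ n) ^ p :=
    ENNReal.rpow_le_rpow_of_exponent_le (one_le_pow₀ (by norm_num)) hrp.le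
  set C := ENNReal.ofReal (2 ^ p * p * (32 * 49 ^ n) / (p - 1)) with hCdef
  calc _ ≤ ENNReal.ofReal (luxConst lam * (32 * 49 ^ n * p / (p - 1)) ^ lam) * F ^ lam * 2 ^ n *
        (C * F * (((5 : ℝ≥0∞) ^ n) ^ p * (2 ^ (p - 1) * apConst p w))) ^ (1 / p) := by gcongr
    _ = ENNReal.ofReal (luxConst lam * (32 * 49 ^ n * p / (p - 1)) ^ lam) * F ^ lam * 2 ^ n *
        ((C * (((5 : ℝ≥0∞) ^ n) ^ p * 2 ^ (p - 1))) * F * apConst p w) ^ (1 / p) := by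
        congr 2; ring
    _ = _ := by
        rw [ENNReal.mul_rpow_of_nonneg _ _ (by positivity),
          ENNReal.mul_rpow_of_nonneg _ _ (by positivity),
          ENNReal.rpow_add_of_nonneg _ _ (by positivity) hlam.le]
        ring

theorem exists_opNorm_le_mixed (hn : 0 < n) {lam : ℝ} (hlam : 0 < lam) {p : ℝ} (hp : 1 < p) :
    ∃ c : ℝ≥0, ∀ w : (Fin n → ℝ) → ℝ, IsApWeight p w →
      opNorm p w (orliczMaximal (youngLog lam)) ≤
        c * (apConst p w ^ (1 / p) * aInftyConst (dualWeight p w) ^ (1 / p + lam)) := by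
  have hp0 : 0 < p := by linarith
  have hp1 : 0 < p - 1 := by linarith
  refine ⟨(ENNReal.ofReal (luxConst lam * (32 * 49 ^ n * p / (p - 1)) ^ lam) * 2 ^ n *
        (ENNReal.ofReal (2 ^ p * p * (32 * 49 ^ n) / (p - 1)) *
          (((5 : ℝ≥0∞) ^ n) ^ p * 2 ^ (p - 1))) ^ (1 / p)).toNNReal, fun w hw => ?_⟩
  rw [ENNReal.coe_toNNReal (ENNReal.mul_ne_top
    (ENNReal.mul_ne_top ENNReal.ofReal_ne_top (by simp))
    (ENNReal.rpow_ne_top_of_nonneg (by positivity) (ENNReal.mul_ne_top ENNReal.ofReal_ne_top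
      (ENNReal.mul_ne_top (ENNReal.rpow_ne_top_of_nonneg hp0.le (by simp))
        (ENNReal.rpow_ne_top_of_nonneg hp1.le (by simp))))))]
  obtain ⟨w', hm, hw', hae⟩ := hw.exists_measurable
  have : dualWeight p w =ᵐ[volume] dualWeight p w' := hae.mono fun x hx => by
    simp only [dualWeight, hx]
  rw [apConst_congr_ae p hae, aInftyConst_congr_ae this, opNorm_congr_ae p hae]
  exact opNorm_orliczMaximal_le_mixed hn hlam hp hw' hm

theorem exists_mixed_le_apConst (n : ℕ) {lam : ℝ} (hlam : 0 < lam) {p : ℝ} (hp : 1 < p) :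
    ∃ c : ℝ≥0, ∀ w : (Fin n → ℝ) → ℝ, IsApWeight p w →
      apConst p w ^ (1 / p) * aInftyConst (dualWeight p w) ^ (1 / p + lam) ≤
        c * apConst p w ^ ((1 + lam) / (p - 1)) := by
  have hp0 : 0 < p := by linarith
  have hp1 : 0 < p - 1 := by linarith
  have hpl : 0 ≤ 1 / p + lam := by positivity
  obtain ⟨c, hc⟩ := exists_aInftyConst_dual_le n hp
  refine ⟨c ^ (1 / p + lam), fun w hw => ?_⟩
  calc apConst p w ^ (1 / p) * aInftyConst (dualWeight p w) ^ (1 / p + lam)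
      ≤ apConst p w ^ (1 / p) * (c * apConst p w ^ (1 / (p - 1))) ^ (1 / p + lam) := by
        gcongr
        exact hc w hw
    _ = _ := by
        rw [ENNReal.mul_rpow_of_nonneg _ _ hpl, ← ENNReal.rpow_mul, mul_left_comm,
          ← ENNReal.rpow_add_of_nonneg _ _ (by positivity) (by positivity),
          ENNReal.coe_rpow_of_nonneg _ hpl]
        congr 2
        field_simp
        ring

/-! ### Power weights -/

theorem lintegral_closedBall_norm_rpow (hn : 0 < n) {δ : ℝ} (hδ : 0 < δ) {ρ : ℝ} (hρ : 0 < ρ) :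
    ∫⁻ x in closedBall (0 : Fin n → ℝ) ρ, ENNReal.ofReal (‖x‖ ^ (δ - n)) =
      ENNReal.ofReal (2 ^ n * (n / δ) * ρ ^ δ) := by
  have : Nonempty (Fin n) := ⟨⟨0, hn⟩⟩
  have hdim : Module.finrank ℝ (Fin n → ℝ) = n := Module.finrank_fin_fun ℝ
  set φ : ℝ → ℝ := (Iic ρ).indicator fun u => u ^ (δ - n) with hφ
  have hrad : ∀ u ∈ Ioi (0 : ℝ), u ^ (n - 1) • φ u = (Iic ρ).indicator (fun u => u ^ (δ - 1)) u := by
    intro u hu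
    have hu : 0 < u := hu
    by_cases h : u ∈ Iic ρ
    · rw [hφ, indicator_of_mem h, indicator_of_mem h, smul_eq_mul, ← Real.rpow_natCast,
        ← Real.rpow_add hu, Nat.cast_sub hn]
      congr 1
      push_cast; ring
    · rw [hφ, indicator_of_notMem h, indicator_of_notMem h, smul_zero]
  have hIoc : Ioi (0 : ℝ) ∩ Iic ρ = Ioc 0 ρ := Ioi_inter_Iic
  have hint1 : IntegrableOn (fun u : ℝ => u ^ (δ - 1)) (Ioc 0 ρ) := by
    have := intervalIntegral.intervalIntegrable_rpow' (a := 0) (b := ρ)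
      (by linarith : -1 < δ - 1)
    rwa [intervalIntegrable_iff_integrableOn_Ioc_of_le hρ.le] at this
  have hint : Integrable (fun x : Fin n → ℝ => φ ‖x‖) := by
    rw [integrable_fun_norm_addHaar volume, hdim, integrableOn_congr_fun hrad measurableSet_Ioi,
      IntegrableOn, integrable_indicator_iff measurableSet_Iic, IntegrableOn,
      Measure.restrict_restrict measurableSet_Iic, inter_comm, hIoc]
    exact hint1
  have hval := integral_fun_norm_addHaar (volume : Measure (Fin n → ℝ)) φ
  rw [hdim, setIntegral_congr_fun measurableSet_Ioi hrad, setIntegral_indicator measurableSet_Iic,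
    hIoc, ← intervalIntegral.integral_of_le hρ.le, integral_rpow (Or.inl (by linarith)),
    Measure.real, volume_ball_eq _ one_pos, sub_add_cancel, Real.zero_rpow hδ.ne'] at hval
  have hnn : ∀ x : Fin n → ℝ, 0 ≤ φ ‖x‖ := fun x => by
    rw [hφ, indicator_apply]
    split_ifs <;> positivity
  have h := ofReal_integral_eq_lintegral_ofReal hint (ae_of_all _ hnn)
  rw [hval] at h
  rw [← lintegral_indicator measurableSet_closedBall]
  calc _ = ∫⁻ x : Fin n → ℝ, ENNReal.ofReal (φ ‖x‖) := by
        refine lintegral_congr fun x => ?_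
        by_cases hx : x ∈ closedBall (0 : Fin n → ℝ) ρ
        · rw [indicator_of_mem hx, hφ, indicator_of_mem (by simpa using hx)]
        · rw [indicator_of_notMem hx, hφ, indicator_of_notMem (by simpa using hx),
            ENNReal.ofReal_zero]
    _ = _ := by
        rw [← h]
        congr 1
        rw [ENNReal.toReal_ofReal (by positivity)]
        simp only [smul_eq_mul, nsmul_eq_mul, mul_one, sub_zero]
        field_simp

/-- The weight `|x| ^ ((n - δ) (p - 1))`, whose dual weight is `|x| ^ (δ - n)`. -/
noncomputable def powerWeight (n : ℕ) (p δ : ℝ) (x : Fin n → ℝ) : ℝ := ‖x‖ ^ ((n - δ) * (p - 1))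

theorem ae_ne_zero_pi (hn : 0 < n) : ∀ᵐ x : Fin n → ℝ, x ≠ 0 := by
  have : Nonempty (Fin n) := ⟨⟨0, hn⟩⟩
  exact Measure.ae_ne volume 0

theorem ofReal_powerWeight_rpow {p δ : ℝ} (hp : 1 < p) {x : Fin n → ℝ} (hx : x ≠ 0) :
    ENNReal.ofReal (powerWeight n p δ x) ^ (-1 / (p - 1)) = ENNReal.ofReal (‖x‖ ^ (δ - n)) := by
  have hp1 : p - 1 ≠ 0 := by linarith
  have hx0 : 0 < ‖x‖ := norm_pos_iff.2 hx
  rw [powerWeight, ENNReal.ofReal_rpow_of_pos (by positivity), ← Real.rpow_mul hx0.le]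
  congr 2
  field_simp
  ring

theorem lintegral_powerWeight_dual_eq (hn : 0 < n) {p δ : ℝ} (hp : 1 < p) (s : Set (Fin n → ℝ)) :
    ∫⁻ x in s, ENNReal.ofReal (powerWeight n p δ x) ^ (-1 / (p - 1)) =
      ∫⁻ x in s, ENNReal.ofReal (‖x‖ ^ (δ - n)) :=
  lintegral_congr_ae (ae_restrict_of_ae ((ae_ne_zero_pi hn).mono fun _ hx =>
    ofReal_powerWeight_rpow hp hx))

theorem hasApBound_powerWeight (hn : 0 < n) {p δ : ℝ} (hp : 1 < p) (hδ : 0 < δ) (hδn : δ ≤ n) :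
    HasApBound p (fun x => ENNReal.ofReal (powerWeight n p δ x))
      (ENNReal.ofReal ((3 ^ n * n / δ) ^ (p - 1))) := by
  have hp1 : 0 < p - 1 := by linarith
  have hb : 0 ≤ (n : ℝ) - δ := by linarith
  have ha : 0 ≤ ((n : ℝ) - δ) * (p - 1) := by positivity
  have hn' : (0 : ℝ) < n := by exact_mod_cast hn
  intro c ρ hρ
  rw [lintegral_powerWeight_dual_eq hn hp]
  have hV := volume_closedBall_eq c hρ
  have hV0 : (0 : ℝ) < (2 * ρ) ^ n := by positivity
  -- upper bounds for the two integrals, in terms of upper bounds for the integrands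
  have hWle : ∀ M : ℝ, (∀ x ∈ closedBall c ρ, ‖x‖ ≤ M) → 0 ≤ M →
      ∫⁻ x in closedBall c ρ, ENNReal.ofReal (powerWeight n p δ x) ≤
        ENNReal.ofReal (M ^ (((n : ℝ) - δ) * (p - 1)) * (2 * ρ) ^ n) := by
    intro M hM hM0
    rw [ENNReal.ofReal_mul (by positivity), ← hV, ← setLIntegral_const]
    refine setLIntegral_mono' measurableSet_closedBall fun x hx => ENNReal.ofReal_le_ofReal ?_
    exact Real.rpow_le_rpow (norm_nonneg _) (hM x hx) ha
  have hfinal : ∀ X Y : ℝ, 0 ≤ X → 0 ≤ Y →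
      X * Y ^ (p - 1) ≤ (3 ^ n * n / δ) ^ (p - 1) * ((2 * ρ) ^ n) ^ p →
      ENNReal.ofReal X * ENNReal.ofReal Y ^ (p - 1) ≤
        ENNReal.ofReal ((3 ^ n * n / δ) ^ (p - 1)) * volume (closedBall c ρ) ^ p := by
    intro X Y hX hY h
    rw [hV, ENNReal.ofReal_rpow_of_nonneg hY hp1.le, ENNReal.ofReal_rpow_of_pos hV0,
      ← ENNReal.ofReal_mul hX, ← ENNReal.ofReal_mul (by positivity)]
    exact ENNReal.ofReal_le_ofReal h
  have hVp : ((2 * ρ) ^ n) ^ p = (2 * ρ) ^ n * ((2 * ρ) ^ n) ^ (p - 1) := by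
    rw [← Real.rpow_one_add' hV0.le (by linarith)]; congr 1; ring
  rcases le_or_gt (2 * ρ) ‖c‖ with h | h
  · have hc : 0 < ‖c‖ := by linarith
    have hxle : ∀ x ∈ closedBall c ρ, ‖x‖ ≤ 3 / 2 * ‖c‖ := by
      intro x hx
      have h1 := mem_closedBall_iff_norm.1 hx
      have h2 := norm_le_norm_add_norm_sub' x c
      linarith
    have hxge : ∀ x ∈ closedBall c ρ, ‖c‖ / 2 ≤ ‖x‖ := by
      intro x hx
      have h1 := mem_closedBall_iff_norm'.1 hx
      have h2 := norm_le_norm_add_norm_sub' c x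
      linarith
    have hσle : ∫⁻ x in closedBall c ρ, ENNReal.ofReal (‖x‖ ^ (δ - n)) ≤
        ENNReal.ofReal ((‖c‖ / 2) ^ (δ - n) * (2 * ρ) ^ n) := by
      rw [ENNReal.ofReal_mul (by positivity), ← hV, ← setLIntegral_const]
      refine setLIntegral_mono' measurableSet_closedBall fun x hx => ENNReal.ofReal_le_ofReal ?_
      exact Real.rpow_le_rpow_of_nonpos (by positivity) (hxge x hx) (by linarith)
    refine (mul_le_mul' (hWle _ hxle (by positivity)) (ENNReal.rpow_le_rpow hσle hp1.le)).trans ?_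
    refine hfinal _ _ (by positivity) (by positivity) ?_
    rw [Real.mul_rpow (by positivity) hV0.le, hVp, ← Real.rpow_mul (by positivity)]
    have e : (3 / 2 * ‖c‖) ^ (((n : ℝ) - δ) * (p - 1)) * (‖c‖ / 2) ^ ((δ - n) * (p - 1)) =
        3 ^ (((n : ℝ) - δ) * (p - 1)) := by
      rw [show (δ - n) * (p - 1) = -(((n : ℝ) - δ) * (p - 1)) by ring,
        Real.rpow_neg (by positivity), ← div_eq_mul_inv,
        ← Real.div_rpow (by positivity) (by positivity)]
      congr 1
      field_simp
    have e2 : (3 : ℝ) ^ (((n : ℝ) - δ) * (p - 1)) ≤ (3 ^ n * n / δ) ^ (p - 1) := by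
      rw [Real.rpow_mul (by norm_num)]
      refine Real.rpow_le_rpow (by positivity) ?_ hp1.le
      have h1 : (3 : ℝ) ^ ((n : ℝ) - δ) ≤ 3 ^ n := by
        rw [← Real.rpow_natCast]
        exact Real.rpow_le_rpow_of_exponent_le (by norm_num) (by linarith)
      have h2 : 1 ≤ n / δ := (one_le_div hδ).2 hδn
      rw [mul_div_assoc]
      nlinarith [pow_pos (by norm_num : (0 : ℝ) < 3) n]
    calc _ = ((3 / 2 * ‖c‖) ^ (((n : ℝ) - δ) * (p - 1)) * (‖c‖ / 2) ^ ((δ - n) * (p - 1))) *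
          ((2 * ρ) ^ n * ((2 * ρ) ^ n) ^ (p - 1)) := by ring
      _ ≤ _ := by rw [e]; gcongr
  · have hsub : closedBall c ρ ⊆ closedBall 0 (3 * ρ) :=
      closedBall_subset_closedBall' (by rw [dist_zero_right]; linarith)
    have hσle : ∫⁻ x in closedBall c ρ, ENNReal.ofReal (‖x‖ ^ (δ - n)) ≤
        ENNReal.ofReal (2 ^ n * (n / δ) * (3 * ρ) ^ δ) := by
      rw [← lintegral_closedBall_norm_rpow hn hδ (by positivity)]
      exact lintegral_mono_set hsub
    refine (mul_le_mul' (hWle (3 * ρ) (fun x hx => by simpa using hsub hx) (by positivity))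
      (ENNReal.rpow_le_rpow hσle hp1.le)).trans ?_
    refine hfinal _ _ (by positivity) (by positivity) (le_of_eq ?_)
    rw [hVp, Real.rpow_mul (by positivity)]
    have e : (3 * ρ) ^ ((n : ℝ) - δ) * (2 ^ n * (n / δ) * (3 * ρ) ^ δ) =
        3 ^ n * n / δ * (2 * ρ) ^ n := by
      have : (3 * ρ) ^ ((n : ℝ) - δ) * (3 * ρ) ^ δ = 3 ^ n * ρ ^ n := by
        rw [← Real.rpow_add (by positivity), sub_add_cancel, Real.rpow_natCast, mul_pow]
      calc _ = 2 ^ n * (n / δ) * ((3 * ρ) ^ ((n : ℝ) - δ) * (3 * ρ) ^ δ) := by ring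
        _ = _ := by rw [this, mul_pow]; ring
    calc _ = (2 * ρ) ^ n * (((3 * ρ) ^ ((n : ℝ) - δ)) ^ (p - 1) *
          (2 ^ n * (n / δ) * (3 * ρ) ^ δ) ^ (p - 1)) := by ring
      _ = (2 * ρ) ^ n * (3 ^ n * n / δ * (2 * ρ) ^ n) ^ (p - 1) := by
          rw [← Real.mul_rpow (by positivity) (by positivity), e]
      _ = _ := by rw [Real.mul_rpow (by positivity) hV0.le]; ring

theorem apConst_powerWeight_le (hn : 0 < n) {p δ : ℝ} (hp : 1 < p) (hδ : 0 < δ) (hδn : δ ≤ n) :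
    apConst p (powerWeight n p δ) ≤ ENNReal.ofReal ((3 ^ n * n / δ) ^ (p - 1)) :=
  (apConst_le_iff hp).2 (hasApBound_powerWeight hn hp hδ hδn)

theorem continuous_powerWeight {p δ : ℝ} (hp : 1 < p) (hδn : δ ≤ n) :
    Continuous (powerWeight n p δ) :=
  continuous_norm.rpow_const fun _ => Or.inr (mul_nonneg (by linarith) (by linarith))

theorem isApWeight_powerWeight (hn : 0 < n) {p δ : ℝ} (hp : 1 < p) (hδ : 0 < δ) (hδn : δ ≤ n) :
    IsApWeight p (powerWeight n p δ) where
  nonneg x := by unfold powerWeight; positivity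
  locallyIntegrable := (continuous_powerWeight hp hδn).locallyIntegrable
  not_ae_zero h := by
    obtain ⟨x, hx, hx0⟩ := (h.and (ae_ne_zero_pi hn)).exists
    have : 0 < ‖x‖ := norm_pos_iff.2 hx0
    unfold powerWeight at hx
    exact (Real.rpow_pos_of_pos this _).ne' hx
  apConst_lt_top := (apConst_powerWeight_le hn hp hδ hδn).trans_lt ENNReal.ofReal_lt_top

/-! ### Lower bounds for the operator norm -/

/-- The extremal function `|x| ^ (δ - n)` on the unit cube. -/
noncomputable def extremal (n : ℕ) (δ : ℝ) : (Fin n → ℝ) → ℝ :=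
  (closedBall (0 : Fin n → ℝ) 1).indicator fun x => ‖x‖ ^ (δ - n)

/-- The constant in the lower bound for the maximal function of `extremal n δ`. -/
noncomputable def extremalConst (n : ℕ) (lam : ℝ) : ℝ :=
  min (n * Real.exp (-1) * (n / 8) ^ lam) ((n / (8 * (1 + lam))) ^ (1 + lam))

theorem extremalConst_pos (hn : 0 < n) {lam : ℝ} (hlam : 0 < lam) : 0 < extremalConst n lam := by
  have hn' : (0 : ℝ) < n := by exact_mod_cast hn
  unfold extremalConst
  exact lt_min (by positivity) (by positivity)

theorem extremalConst_mul_rpow_le (hn : 0 < n) {lam δ : ℝ} (hlam : 0 < lam) (hδ : 0 < δ) :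
    extremalConst n lam * δ ^ (-(1 + lam)) ≤ Real.exp (n / (8 * δ)) := by
  have hn' : (0 : ℝ) < n := by exact_mod_cast hn
  have ha : 0 < 1 + lam := by linarith
  calc extremalConst n lam * δ ^ (-(1 + lam))
      ≤ (n / (8 * (1 + lam))) ^ (1 + lam) * δ ^ (-(1 + lam)) := by
        gcongr
        exact min_le_right _ _
    _ = (n / (8 * δ) / (1 + lam)) ^ (1 + lam) := by
        rw [Real.rpow_neg hδ.le, ← Real.inv_rpow hδ.le, ← Real.mul_rpow (by positivity)
          (by positivity)]
        congr 1
        field_simp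
    _ ≤ Real.exp (n / (8 * δ) / (1 + lam)) ^ (1 + lam) := by
        refine Real.rpow_le_rpow (by positivity) ?_ ha.le
        linarith [Real.add_one_le_exp ((n : ℝ) / (8 * δ) / (1 + lam))]
    _ = _ := by
        rw [← Real.exp_mul]
        congr 1
        field_simp

/-- On the cube centred at the origin that has `x` on its boundary, the part of `extremal n δ` within
distance `exp (-1 / δ) ‖x‖` of the origin carries a fixed proportion of the mass, and there the
logarithm is at least comparable to `1 / δ`. -/
theorem le_orliczMaximal_extremal (hn : 0 < n) {lam δ : ℝ} (hlam : 0 < lam) (hδ : 0 < δ)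
    (hδn : δ ≤ 3 * n / 4) {x : Fin n → ℝ} (hx0 : x ≠ 0) (hx1 : ‖x‖ ≤ 1) :
    ENNReal.ofReal (extremalConst n lam * δ ^ (-(1 + lam)) * ‖x‖ ^ (δ - n)) ≤
      orliczMaximal (youngLog lam) (extremal n δ) x := by
  have hn' : (0 : ℝ) < n := by exact_mod_cast hn
  set ρ := ‖x‖ with hρdef
  have hρ : 0 < ρ := norm_pos_iff.2 hx0
  have hxQ : x ∈ closedBall (0 : Fin n → ℝ) ρ := by simp [hρdef]
  have hsup : luxemburgNorm (youngLog lam) (closedBall 0 ρ) (extremal n δ) ≤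
      orliczMaximal (youngLog lam) (extremal n δ) x := by
    rw [closedBall_eq_cube _ hρ.le] at hxQ ⊢
    exact le_iSup₂_of_le _ (2 * ρ) (le_iSup₂_of_le (by positivity : 0 < 2 * ρ) hxQ le_rfl)
  refine le_trans ?_ hsup
  set L := extremalConst n lam * δ ^ (-(1 + lam)) with hL
  have hc0 := extremalConst_pos hn hlam
  have hL0 : 0 < L := by positivity
  refine le_iInf fun t => le_iInf fun ht => le_iInf fun havg => ENNReal.ofReal_le_ofReal ?_
  by_contra hcon
  rw [not_le] at hcon
  refine absurd havg (not_le.2 ?_)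
  set ρ' := ρ * Real.exp (-(1 / δ)) with hρ'
  have hρ'0 : 0 < ρ' := by positivity
  have hexp1 : Real.exp (-(1 / δ)) ≤ 1 := Real.exp_le_one_iff.2 (by
    have : 0 < 1 / δ := by positivity
    linarith)
  have hρ'ρ : ρ' ≤ ρ := mul_le_of_le_one_right hρ.le hexp1
  have hpt : ∀ y ∈ closedBall (0 : Fin n → ℝ) ρ', y ≠ 0 →
      (n / (8 * δ)) ^ lam / t * ‖y‖ ^ (δ - n) ≤ youngLog lam (|extremal n δ y| / t) := by
    intro y hy hy0
    have hy' : ‖y‖ ≤ ρ' := by simpa using hy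
    have hypos : 0 < ‖y‖ := norm_pos_iff.2 hy0
    have hf : |extremal n δ y| = ‖y‖ ^ (δ - n) := by
      rw [extremal, indicator_of_mem (by simpa using hy'.trans (hρ'ρ.trans hx1)),
        abs_of_nonneg (by positivity)]
    rw [hf]
    set v := ‖y‖ ^ (δ - n) / t with hv
    have hv0 : 0 < v := by positivity
    have hvge : Real.exp (n / (8 * δ)) ≤ v := by
      rw [hv, le_div_iff₀ ht]
      calc Real.exp (n / (8 * δ)) * t ≤ Real.exp (n / (8 * δ)) * (L * ρ ^ (δ - n)) := by gcongr
        _ ≤ Real.exp (n / (8 * δ)) * (Real.exp (n / (8 * δ)) * ρ ^ (δ - n)) := by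
            gcongr
            exact extremalConst_mul_rpow_le hn hlam hδ
        _ = Real.exp (n / (4 * δ)) * ρ ^ (δ - n) := by
            rw [← mul_assoc, ← Real.exp_add]
            congr 2
            field_simp
            norm_num
        _ ≤ Real.exp (-(1 / δ) * (δ - n)) * ρ ^ (δ - n) := by
            gcongr
            have : -(1 / δ) * (δ - n) = (n - δ) / δ := by field_simp; ring
            rw [this, div_le_div_iff₀ (by positivity) hδ]
            nlinarith
        _ = ρ' ^ (δ - n) := by
            rw [hρ', Real.mul_rpow hρ.le (Real.exp_pos _).le, Real.exp_mul, mul_comm]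
        _ ≤ ‖y‖ ^ (δ - n) := Real.rpow_le_rpow_of_nonpos hypos hy' (by linarith)
    have hlog : n / (8 * δ) ≤ Real.log (Real.exp 1 + v) := by
      rw [Real.le_log_iff_exp_le (by positivity)]
      linarith [Real.exp_pos 1]
    calc (n / (8 * δ)) ^ lam / t * ‖y‖ ^ (δ - n) = v * (n / (8 * δ)) ^ lam := by rw [hv]; ring
      _ ≤ _ := by
        unfold youngLog
        gcongr
  have hVpos : (0 : ℝ) < (2 * ρ) ^ n := by positivity
  rw [setLAverage_eq, volume_closedBall_eq _ hρ, ENNReal.lt_div_iff_mul_lt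
    (Or.inl (by simpa using hVpos)) (Or.inl ENNReal.ofReal_ne_top), one_mul]
  have hk0 : 0 ≤ (n / (8 * δ)) ^ lam / t := by positivity
  have hint : ENNReal.ofReal ((n / (8 * δ)) ^ lam / t * (2 ^ n * (n / δ) * ρ' ^ δ)) ≤
      ∫⁻ y in closedBall (0 : Fin n → ℝ) ρ, ENNReal.ofReal (youngLog lam (|extremal n δ y| / t)) := by
    rw [ENNReal.ofReal_mul hk0, ← lintegral_closedBall_norm_rpow hn hδ hρ'0,
      ← lintegral_const_mul' _ _ ENNReal.ofReal_ne_top]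
    refine le_trans ?_ (lintegral_mono_set (closedBall_subset_closedBall hρ'ρ))
    refine lintegral_mono_ae ?_
    rw [ae_restrict_iff' measurableSet_closedBall]
    filter_upwards [ae_ne_zero_pi hn] with y hy0 hy
    rw [← ENNReal.ofReal_mul hk0]
    exact ENNReal.ofReal_le_ofReal (hpt y hy hy0)
  refine lt_of_lt_of_le ((ENNReal.ofReal_lt_ofReal_iff (by positivity)).2 ?_) hint
  have hρ'δ : ρ' ^ δ = ρ ^ δ * Real.exp (-1) := by
    rw [hρ', Real.mul_rpow hρ.le (Real.exp_pos _).le, ← Real.exp_mul]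
    congr 2
    field_simp
  have hLle : L ≤ n * Real.exp (-1) * (n / 8) ^ lam * δ ^ (-(1 + lam)) := by
    rw [hL]
    gcongr
    exact min_le_left _ _
  have hδl : (n / (8 * δ)) ^ lam * (n / δ) * Real.exp (-1) =
      n * Real.exp (-1) * (n / 8) ^ lam * δ ^ (-(1 + lam)) := by
    rw [Real.rpow_neg hδ.le, Real.rpow_add hδ, Real.rpow_one, ← div_div,
      Real.div_rpow (by positivity) hδ.le]
    field_simp
  have hρn : ρ ^ (δ - n) * ρ ^ n = ρ ^ δ := by
    rw [← Real.rpow_natCast, ← Real.rpow_add hρ, sub_add_cancel]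
  rw [hρ'δ, mul_pow]
  calc (2 : ℝ) ^ n * ρ ^ n = 2 ^ n * ρ ^ n * (t / t) := by rw [div_self ht.ne', mul_one]
    _ < 2 ^ n * ρ ^ n * (L * ρ ^ (δ - n) / t) := by gcongr
    _ ≤ 2 ^ n * ρ ^ n * ((n / (8 * δ)) ^ lam * (n / δ) * Real.exp (-1) * ρ ^ (δ - n) / t) := by
        rw [hδl]; gcongr
    _ = (n / (8 * δ)) ^ lam / t * (2 ^ n * (n / δ) * ((ρ ^ (δ - n) * ρ ^ n) * Real.exp (-1))) := by
        ring
    _ = _ := by rw [hρn]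

/-- The hypothesis on the weight says that `|f| ^ p w` is `|x| ^ (δ' - n)` on the unit cube for
`f = extremal n δ`, so that the norm of `f` is finite and not zero. -/
theorem le_opNorm_orliczMaximal (hn : 0 < n) {lam δ δ' p : ℝ} (hlam : 0 < lam) (hp : 0 < p)
    (hδ : 0 < δ) (hδn : δ ≤ 3 * n / 4) (hδ' : 0 < δ') {w : (Fin n → ℝ) → ℝ}
    (hw : ∀ x, x ≠ 0 → (‖x‖ ^ (δ - n)) ^ p * w x = ‖x‖ ^ (δ' - n)) :
    ENNReal.ofReal (extremalConst n lam * δ ^ (-(1 + lam))) ≤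
      opNorm p w (orliczMaximal (youngLog lam)) := by
  have hn' : (0 : ℝ) < n := by exact_mod_cast hn
  set L := extremalConst n lam * δ ^ (-(1 + lam)) with hL
  have hL0 : 0 < L := mul_pos (extremalConst_pos hn hlam) (by positivity)
  have hint : ∫⁻ x, ‖extremal n δ x‖ₑ ^ p * ENNReal.ofReal (w x) =
      ENNReal.ofReal (2 ^ n * (n / δ') * 1 ^ δ') := by
    rw [← lintegral_closedBall_norm_rpow hn hδ' one_pos,
      ← lintegral_indicator measurableSet_closedBall]
    refine lintegral_congr_ae ((ae_ne_zero_pi hn).mono fun x hx => ?_)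
    by_cases hx1 : x ∈ closedBall (0 : Fin n → ℝ) 1
    · dsimp only
      rw [extremal, indicator_of_mem hx1, indicator_of_mem hx1, ← hw x hx,
        Real.enorm_of_nonneg (by positivity), ENNReal.ofReal_rpow_of_nonneg (by positivity) hp.le,
        ← ENNReal.ofReal_mul (by positivity)]
    · dsimp only
      rw [extremal, indicator_of_notMem hx1, indicator_of_notMem hx1]
      simp [hp]
  set X := ENNReal.ofReal (2 ^ n * (n / δ') * 1 ^ δ') with hX
  have hX0 : X ≠ 0 := by
    rw [hX, Ne, ENNReal.ofReal_eq_zero, not_le]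
    positivity
  have hXt : X ≠ ∞ := ENNReal.ofReal_ne_top
  have hN : lpNorm p w (fun x => ‖extremal n δ x‖ₑ) = X ^ (1 / p) := by
    unfold lpNorm
    rw [hint]
  have hNt : X ^ (1 / p) ≠ ∞ := ENNReal.rpow_ne_top_of_nonneg (by positivity) hXt
  have hN0 : X ^ (1 / p) ≠ 0 := by simp [ENNReal.rpow_eq_zero_iff, hX0, hXt]
  have hmeas : AEMeasurable (extremal n δ) volume := by
    refine Measurable.aemeasurable (Measurable.indicator ?_ measurableSet_closedBall)
    fun_prop
  refine le_sInf fun C hC => ?_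
  have h := hC _ hmeas (by rw [hN]; exact hNt.lt_top)
  rw [hN] at h
  refine (ENNReal.mul_le_mul_iff_left hN0 hNt).1 (le_trans ?_ h)
  have hpt : ∀ x : Fin n → ℝ, x ≠ 0 → ENNReal.ofReal L * ‖extremal n δ x‖ₑ ≤
      orliczMaximal (youngLog lam) (extremal n δ) x := by
    intro x hx
    by_cases hx1 : x ∈ closedBall (0 : Fin n → ℝ) 1
    · rw [extremal, indicator_of_mem hx1, Real.enorm_of_nonneg (by positivity),
        ← ENNReal.ofReal_mul hL0.le]
      exact le_orliczMaximal_extremal hn hlam hδ hδn hx (by simpa using hx1)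
    · rw [extremal, indicator_of_notMem hx1]
      simp
  calc ENNReal.ofReal L * X ^ (1 / p)
      = (∫⁻ x, (ENNReal.ofReal L * ‖extremal n δ x‖ₑ) ^ p * ENNReal.ofReal (w x)) ^ (1 / p) := by
        simp_rw [ENNReal.mul_rpow_of_nonneg _ _ hp.le, mul_assoc]
        rw [lintegral_const_mul' _ _ (ENNReal.rpow_ne_top_of_nonneg hp.le ENNReal.ofReal_ne_top),
          hint, ENNReal.mul_rpow_of_nonneg _ _ (by positivity), ← ENNReal.rpow_mul,
          mul_one_div_cancel hp.ne', ENNReal.rpow_one]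
    _ ≤ lpNorm p w (orliczMaximal (youngLog lam) (extremal n δ)) := by
        unfold lpNorm
        refine ENNReal.rpow_le_rpow (lintegral_mono_ae ?_) (by positivity)
        filter_upwards [ae_ne_zero_pi hn] with x hx
        gcongr
        exact hpt x hx

theorem le_opNorm_powerWeight (hn : 0 < n) {lam δ p : ℝ} (hlam : 0 < lam) (hp : 1 < p)
    (hδ : 0 < δ) (hδn : δ ≤ 3 * n / 4) :
    ENNReal.ofReal (extremalConst n lam * δ ^ (-(1 + lam))) ≤
      opNorm p (powerWeight n p δ) (orliczMaximal (youngLog lam)) := by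
  refine le_opNorm_orliczMaximal hn hlam (by linarith) hδ hδn hδ fun x hx => ?_
  have hx0 : 0 < ‖x‖ := norm_pos_iff.2 hx
  rw [powerWeight, ← Real.rpow_mul hx0.le, ← Real.rpow_add hx0]
  congr 1
  ring

/-! ### The unweighted norm -/

theorem le_opNorm_one (hn : 0 < n) {lam p : ℝ} (hlam : 0 < lam) (hp : 1 < p) (hp2 : p ≤ 2) :
    ENNReal.ofReal (extremalConst n lam * (3 * n / 2) ^ (-(1 + lam)) * (p - 1) ^ (-(1 + lam))) ≤
      opNorm (n := n) p (fun _ => 1) (orliczMaximal (youngLog lam)) := by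
  have hn' : (0 : ℝ) < n := by exact_mod_cast hn
  have hp1 : 0 < p - 1 := by linarith
  have hc0 := extremalConst_pos hn hlam
  have hδ : 0 < 3 * n * (p - 1) / (2 * p) := by positivity
  -- the exponent `δ` is half-way above the threshold for `|x| ^ ((δ - n) p)` to be integrable
  refine le_trans (ENNReal.ofReal_le_ofReal ?_) (le_opNorm_orliczMaximal hn hlam (by linarith)
    (δ := 3 * n * (p - 1) / (2 * p)) (δ' := n * (p - 1) / 2) hδ ?_ (by positivity) fun x hx => ?_)
  · rw [mul_assoc, ← Real.mul_rpow (by positivity) hp1.le]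
    gcongr _ * ?_
    refine Real.rpow_le_rpow_of_nonpos hδ ?_ (by linarith)
    rw [div_le_iff₀ (by positivity)]
    have : 0 ≤ (n : ℝ) * (p - 1) * (p - 1) := by positivity
    nlinarith
  · rw [div_le_div_iff₀ (by positivity) (by norm_num)]
    nlinarith
  · have hx0 : 0 < ‖x‖ := norm_pos_iff.2 hx
    rw [mul_one, ← Real.rpow_mul hx0.le]
    congr 1
    field_simp
    ring

theorem opNorm_one_le {lam p : ℝ} (hlam : 0 < lam) (hp : 1 < p) (hp2 : p ≤ 2) :
    opNorm (n := n) p (fun _ => 1) (orliczMaximal (youngLog lam)) ≤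
      ENNReal.ofReal (luxConst lam * 5 ^ lam * 2 ^ n * (24 * 25 ^ n) * (p - 1) ^ (-(1 + lam))) := by
  have hp1 : 0 < p - 1 := by linarith
  have hA : HasApBound (1 + (p - 1) / 3) (fun _ : Fin n → ℝ => ENNReal.ofReal 1) 1 := by
    intro c ρ hρ
    have hV0 := volume_closedBall_ne_zero c hρ
    have hVt := volume_closedBall_ne_top c ρ
    simp only [ENNReal.ofReal_one, ENNReal.one_rpow, setLIntegral_const, one_mul]
    conv_lhs => rw [← ENNReal.rpow_one (volume (closedBall c ρ)), ← ENNReal.rpow_mul, one_mul,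
      ← ENNReal.rpow_add _ _ hV0 hVt]
    rw [add_sub_cancel]
  have h := opNorm_orliczMaximal_le hlam (w := fun _ : Fin n → ℝ => 1) measurable_const
    (ae_of_all _ fun _ => by simp) (r := 1 + (p - 1) / 3) (q := 1 + 2 * (p - 1) / 3) (p := p)
    (by linarith) (by linarith) (by linarith) (by linarith) hA
  refine h.trans ?_
  set q := 1 + 2 * (p - 1) / 3 with hq
  set r := 1 + (p - 1) / 3 with hr
  have hq0 : 0 < q := by linarith
  have hq2 : q ≤ 2 := by linarith
  have hε : (p - 1) / 5 ≤ p / q - 1 := by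
    have e : p / q - 1 = (p - q) / q := by field_simp
    rw [e, div_le_div_iff₀ (by norm_num) hq0]
    nlinarith
  have hlux := one_le_luxConst lam
  have h1 : luxConst lam * (p / q - 1) ^ (-lam) ≤ luxConst lam * 5 ^ lam * (p - 1) ^ (-lam) := by
    rw [mul_assoc]
    gcongr
    calc (p / q - 1) ^ (-lam) ≤ ((p - 1) / 5) ^ (-lam) :=
          Real.rpow_le_rpow_of_nonpos (by positivity) hε (by linarith)
      _ = _ := by
        rw [Real.div_rpow hp1.le (by norm_num), Real.rpow_neg (by norm_num : (0 : ℝ) ≤ 5)]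
        field_simp
  have h2 : 2 ^ q * q / (q - r) ≤ 24 / (p - 1) := by
    have h2q : (2 : ℝ) ^ q ≤ 4 := by
      calc (2 : ℝ) ^ q ≤ 2 ^ (2 : ℝ) := Real.rpow_le_rpow_of_exponent_le (by norm_num) hq2
        _ = 4 := by norm_num
    have : q - r = (p - 1) / 3 := by rw [hq, hr]; ring
    rw [this, div_le_div_iff₀ (by positivity) hp1]
    have : 2 ^ q * q ≤ 4 * 2 := by gcongr
    nlinarith
  have h3 : ((5 : ℝ≥0∞) ^ n) ^ r ≤ ENNReal.ofReal (25 ^ n) := by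
    calc ((5 : ℝ≥0∞) ^ n) ^ r ≤ ((5 : ℝ≥0∞) ^ n) ^ (2 : ℝ) :=
          ENNReal.rpow_le_rpow_of_exponent_le (one_le_pow₀ (by norm_num)) (by linarith)
      _ = _ := by
          rw [ENNReal.ofReal_pow (by norm_num), ENNReal.ofReal_ofNat, ENNReal.rpow_ofNat,
            ← pow_mul, mul_comm, pow_mul]
          norm_num
  have h25 : (1 : ℝ) ≤ 25 ^ n := one_le_pow₀ (by norm_num)
  have hX1 : 1 ≤ 24 / (p - 1) * 25 ^ n := by
    have : 1 ≤ 24 / (p - 1) := by rw [one_le_div hp1]; linarith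
    nlinarith
  calc _ ≤ ENNReal.ofReal (luxConst lam * 5 ^ lam * (p - 1) ^ (-lam)) * 2 ^ n *
        (ENNReal.ofReal (24 / (p - 1)) * (ENNReal.ofReal (25 ^ n) * 1)) ^ (1 / p) := by gcongr
    _ ≤ ENNReal.ofReal (luxConst lam * 5 ^ lam * (p - 1) ^ (-lam)) * 2 ^ n *
        ENNReal.ofReal (24 / (p - 1) * 25 ^ n) := by
        gcongr
        rw [mul_one, ← ENNReal.ofReal_mul (by positivity)]
        conv_rhs => rw [← ENNReal.rpow_one (ENNReal.ofReal _)]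
        refine ENNReal.rpow_le_rpow_of_exponent_le (by simpa using hX1) ?_
        rw [div_le_one (by linarith)]
        linarith
    _ = _ := by
        rw [← ENNReal.ofReal_ofNat 2, ← ENNReal.ofReal_pow (by norm_num),
          ← ENNReal.ofReal_mul (by positivity), ← ENNReal.ofReal_mul (by positivity)]
        congr 1
        rw [show -(1 + lam) = -lam + (-1) by ring, Real.rpow_add hp1, Real.rpow_neg_one]
        field_simp

/-! ### Sharpness of the exponents -/

theorem le_of_forall_rpow_neg_le {s u c C δ₀ : ℝ} (hc : 0 < c) (hδ₀ : 0 < δ₀)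
    (h : ∀ δ, 0 < δ → δ ≤ δ₀ → c * δ ^ (-s) ≤ C * δ ^ (-u)) : s ≤ u := by
  by_contra! hcon
  have hlim := tendsto_rpow_atTop (sub_pos.2 hcon)
  obtain ⟨x, hx1, hx2⟩ := ((hlim.eventually_gt_atTop (C / c)).and
    (Filter.eventually_ge_atTop (1 / δ₀))).exists
  have hx0 : 0 < x := lt_of_lt_of_le (by positivity) hx2
  have h1 := h x⁻¹ (by positivity) (by
    rw [inv_le_comm₀ hx0 hδ₀, ← one_div]; exact hx2)
  rw [Real.inv_rpow hx0.le, Real.inv_rpow hx0.le, Real.rpow_neg hx0.le, Real.rpow_neg hx0.le,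
    inv_inv, inv_inv] at h1
  have hxu : 0 < x ^ u := by positivity
  rw [Real.rpow_sub hx0, div_lt_div_iff₀ hc hxu] at hx1
  linarith

/-- The bound is tested on the power weights as `δ` tends to `0`. Their `A_∞` constant is estimated
only through their `A_p` constant, which is why `β₂` has to be non-negative. -/
theorem mixed_exponents_ge (hn : 0 < n) {lam p : ℝ} (hlam : 0 < lam) (hp : 1 < p)
    {β₁ β₂ : ℝ} (hβ₂ : 0 ≤ β₂) {c : ℝ≥0}
    (h : ∀ w : (Fin n → ℝ) → ℝ, IsApWeight p w →
      opNorm p w (orliczMaximal (youngLog lam)) ≤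
        c * (apConst p w ^ β₁ * aInftyConst (dualWeight p w) ^ β₂)) :
    (1 + lam) / (p - 1) ≤ β₁ + β₂ / (p - 1) := by
  have hn' : (0 : ℝ) < n := by exact_mod_cast hn
  have hp1 : 0 < p - 1 := by linarith
  obtain ⟨c₁, hc₁⟩ := exists_aInftyConst_dual_le n hp
  -- as the constant is at least `1`, a negative total exponent can be replaced by `0`
  set γ := max (β₁ + β₂ / (p - 1)) 0 with hγ
  have hγ0 : 0 ≤ γ := le_max_right _ _
  have key : 1 + lam ≤ (p - 1) * γ := by
    refine le_of_forall_rpow_neg_le (c := extremalConst n lam)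
      (C := (c : ℝ) * (c₁ : ℝ) ^ β₂ * (3 ^ n * n) ^ ((p - 1) * γ)) (δ₀ := 3 * n / 4)
      (extremalConst_pos hn hlam) (by positivity) fun δ hδ hδn => ?_
    have hδn' : δ ≤ n := by linarith
    have hw := isApWeight_powerWeight hn hp hδ hδn'
    have hm : Measurable (powerWeight n p δ) := (continuous_powerWeight hp hδn').measurable
    have h1 := hw.one_le_apConst hp hm
    have hA := apConst_powerWeight_le hn hp hδ hδn'
    have h2 := (le_opNorm_powerWeight hn hlam hp hδ hδn).trans (h _ hw)
    set A := apConst p (powerWeight n p δ) with hAdef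
    have hA0 : A ≠ 0 := (zero_lt_one.trans_le h1).ne'
    have hAt : A ≠ ∞ := hw.apConst_lt_top.ne
    have h3 : ENNReal.ofReal (extremalConst n lam * δ ^ (-(1 + lam))) ≤
        ENNReal.ofReal ((c : ℝ) * (c₁ : ℝ) ^ β₂ * ((3 ^ n * n / δ) ^ (p - 1)) ^ γ) := by
      calc _ ≤ _ := h2
        _ ≤ c * (A ^ β₁ * (c₁ * A ^ (1 / (p - 1))) ^ β₂) := by
            gcongr
            exact hc₁ _ hw
        _ = c * (c₁ : ℝ≥0∞) ^ β₂ * A ^ (β₁ + β₂ / (p - 1)) := by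
            rw [ENNReal.mul_rpow_of_nonneg _ _ hβ₂, ← ENNReal.rpow_mul, ENNReal.rpow_add _ _ hA0 hAt,
              show 1 / (p - 1) * β₂ = β₂ / (p - 1) by ring]
            ring
        _ ≤ c * (c₁ : ℝ≥0∞) ^ β₂ * A ^ γ := by
            gcongr
            exact le_max_left _ _
        _ ≤ c * (c₁ : ℝ≥0∞) ^ β₂ * ENNReal.ofReal ((3 ^ n * n / δ) ^ (p - 1)) ^ γ := by gcongr
        _ = _ := by
            rw [ENNReal.ofReal_mul (by positivity), ENNReal.ofReal_mul (by positivity),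
              ENNReal.ofReal_coe_nnreal, ENNReal.ofReal_rpow_of_nonneg (by positivity) hγ0,
              ← ENNReal.ofReal_rpow_of_nonneg (by positivity) hβ₂, ENNReal.ofReal_coe_nnreal]
    have h4 := (ENNReal.ofReal_le_ofReal_iff (by positivity)).1 h3
    refine h4.trans (le_of_eq ?_)
    rw [← Real.rpow_mul (by positivity), Real.div_rpow (by positivity) hδ.le,
      Real.rpow_neg hδ.le]
    ring
  have hγpos : 0 < γ := by
    by_contra hcon
    have : γ = 0 := le_antisymm (not_lt.1 hcon) hγ0
    rw [this] at key
    linarith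
  have hγeq : γ = β₁ + β₂ / (p - 1) := by
    rcases max_choice (β₁ + β₂ / (p - 1)) 0 with h' | h'
    · exact h'
    · rw [← hγ] at h'; linarith
  rw [← hγeq, div_le_iff₀ hp1]
  linarith

end OrliczMax

theorem theorem4p2 (n : ℕ) (hn : 0 < n) (lam : ℝ) (hlam : 0 < lam) :
    -- for each `p`, the weighted bounds and the sharpness of their exponents
    (∀ p : ℝ, 1 < p →
      (∃ c : ℝ≥0, ∀ w : (Fin n → ℝ) → ℝ, OrliczMax.IsApWeight p w →
        OrliczMax.opNorm p w (OrliczMax.orliczMaximal (OrliczMax.youngLog lam)) ≤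
          c * (OrliczMax.apConst p w ^ (1 / p) *
            OrliczMax.aInftyConst (OrliczMax.dualWeight p w) ^ (1 / p + lam))) ∧
      (∃ c : ℝ≥0, ∀ w : (Fin n → ℝ) → ℝ, OrliczMax.IsApWeight p w →
        OrliczMax.apConst p w ^ (1 / p) *
            OrliczMax.aInftyConst (OrliczMax.dualWeight p w) ^ (1 / p + lam) ≤
          c * OrliczMax.apConst p w ^ ((1 + lam) / (p - 1))) ∧
      -- the exponent of the `A_p` bound cannot be decreased
      (∀ β : ℝ,
        (∃ c : ℝ≥0, ∀ w : (Fin n → ℝ) → ℝ, OrliczMax.IsApWeight p w →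
          OrliczMax.opNorm p w (OrliczMax.orliczMaximal (OrliczMax.youngLog lam)) ≤
            c * OrliczMax.apConst p w ^ β) →
        (1 + lam) / (p - 1) ≤ β) ∧
      -- neither exponent of the mixed bound can be decreased
      (∀ β : ℝ,
        (∃ c : ℝ≥0, ∀ w : (Fin n → ℝ) → ℝ, OrliczMax.IsApWeight p w →
          OrliczMax.opNorm p w (OrliczMax.orliczMaximal (OrliczMax.youngLog lam)) ≤
            c * (OrliczMax.apConst p w ^ β *
              OrliczMax.aInftyConst (OrliczMax.dualWeight p w) ^ (1 / p + lam))) →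
        1 / p ≤ β) ∧
      (∀ β : ℝ,
        (∃ c : ℝ≥0, ∀ w : (Fin n → ℝ) → ℝ, OrliczMax.IsApWeight p w →
          OrliczMax.opNorm p w (OrliczMax.orliczMaximal (OrliczMax.youngLog lam)) ≤
            c * (OrliczMax.apConst p w ^ (1 / p) *
              OrliczMax.aInftyConst (OrliczMax.dualWeight p w) ^ β)) →
        1 / p + lam ≤ β) ∧
      -- more generally, no mixed bound holds below the line through these exponents
      (∀ β₁ β₂ : ℝ, 0 ≤ β₂ →
        (∃ c : ℝ≥0, ∀ w : (Fin n → ℝ) → ℝ, OrliczMax.IsApWeight p w →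
          OrliczMax.opNorm p w (OrliczMax.orliczMaximal (OrliczMax.youngLog lam)) ≤
            c * (OrliczMax.apConst p w ^ β₁ *
              OrliczMax.aInftyConst (OrliczMax.dualWeight p w) ^ β₂)) →
        (1 + lam) / (p - 1) ≤ β₁ + β₂ / (p - 1))) ∧
    -- the size of the unweighted norm as `p` tends to `1`
    (∃ c C : ℝ, 0 < c ∧ 0 < C ∧ ∀ p : ℝ, 1 < p → p ≤ 2 →
      ENNReal.ofReal (c * (p - 1) ^ (-(1 + lam))) ≤
          OrliczMax.opNorm (n := n) p (fun _ => 1)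
            (OrliczMax.orliczMaximal (OrliczMax.youngLog lam)) ∧
        OrliczMax.opNorm (n := n) p (fun _ => 1)
            (OrliczMax.orliczMaximal (OrliczMax.youngLog lam)) ≤
          ENNReal.ofReal (C * (p - 1) ^ (-(1 + lam)))) := by
  refine ⟨fun p hp => ?_, ?_⟩
  · have hp0 : 0 < p := by linarith
    have hp1 : 0 < p - 1 := by linarith
    refine ⟨OrliczMax.exists_opNorm_le_mixed hn hlam hp, OrliczMax.exists_mixed_le_apConst n hlam hp,
      ?_, ?_, ?_, ?_⟩
    · rintro β ⟨c, hc⟩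
      simpa using OrliczMax.mixed_exponents_ge hn hlam hp (β₁ := β) (β₂ := 0) le_rfl (c := c)
        fun w hw => by simpa using hc w hw
    · rintro β ⟨c, hc⟩
      have h := OrliczMax.mixed_exponents_ge hn hlam hp (by positivity) hc
      have e : (1 + lam) / (p - 1) = 1 / p + (1 / p + lam) / (p - 1) := by
        field_simp
        ring
      linarith
    · rintro β ⟨c, hc⟩
      have e : (1 + lam) / (p - 1) = 1 / p + (1 / p + lam) / (p - 1) := by
        field_simp
        ring
      rcases le_or_gt 0 β with hβ | hβ
      · have h := OrliczMax.mixed_exponents_ge hn hlam hp hβ hc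
        rw [e] at h
        exact (div_le_div_iff_of_pos_right hp1).1 (by linarith)
      · -- since the `A_∞` constant is at least `1`, its negative power may be dropped
        have h := OrliczMax.mixed_exponents_ge hn hlam hp (β₁ := 1 / p) (β₂ := 0) le_rfl (c := c)
          fun w hw => by
            refine (hc w hw).trans ?_
            gcongr
            obtain ⟨w', hm, hw', hae⟩ := hw.exists_measurable
            have hd : OrliczMax.dualWeight p w =ᵐ[volume] OrliczMax.dualWeight p w' :=
              hae.mono fun x hx => by simp only [OrliczMax.dualWeight, hx]
            rw [OrliczMax.aInftyConst_congr_ae hd]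
            exact hw'.one_le_aInftyConst_dual hp hm
        rw [e, zero_div, add_zero] at h
        have : 0 < (1 / p + lam) / (p - 1) := by positivity
        linarith
    · rintro β₁ β₂ hβ₂ ⟨c, hc⟩
      exact OrliczMax.mixed_exponents_ge hn hlam hp hβ₂ hc
  · have hn' : (0 : ℝ) < n := by exact_mod_cast hn
    have hc := OrliczMax.extremalConst_pos hn hlam
    have hl := OrliczMax.one_le_luxConst lam
    exact ⟨OrliczMax.extremalConst n lam * (3 * n / 2) ^ (-(1 + lam)),
      OrliczMax.luxConst lam * 5 ^ lam * 2 ^ n * (24 * 25 ^ n), by positivity, by positivity,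
      fun p hp hp2 => ⟨OrliczMax.le_opNorm_one hn hlam hp hp2, OrliczMax.opNorm_one_le hlam hp hp2⟩⟩
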